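/- **Setting.** Let $k$ be a field, let $\hat{\mathcal P}$ be a set and let $\hat S=\bigoplus_{u\in\hat{\mathcal P}}ke_u$ be the elementary $k$-algebra with orthogonal idempotents $e_u$. All modules over $\hat S$ are unitary, and $k$ acts centrally on bimodules. A *$b$-algebra* over $\hat S$ is a graded $\hat S$-$\hat S$-bimodule $\hat Z=\bigoplus_{q\in\mathbb Z}\hat Z_q$ with homogeneous bimodule morphisms $\hat b_n:\hat Z^{\otimes n}\to\hat Z$ ($n\ge1$, tensor products over $\hat S$) of degree $1$ such that $\sum_{r+s+t=n,\ s\ge1}\hat b_{r+1+t}(\mathrm{id}^{\otimes r}\otimes\hat b_s\otimes\mathrm{id}^{\otimes t})=0$ for all $n\geq 1$. The Koszul rule $(f\otimes g)(m\otimes n)=(-1)^{|g||m|}f(m)\otimes g(n)$ is used throughout. It is a *$(b,\nu)$-algebra* if the following hold. * There is an automorphism $\nu$ of $\hat S$ permuting the $e_u$ (write $\nu(e_u)=e_{\nu(u)}$) such that $\langle\nu\rangle$ acts freely on $\hat{\mathcal P}$. * There are commuting left and right actions of $\nu$ on $\hat Z$ by $k$-linear automorphisms of degree $-1$ with $\nu(e_ua)=e_{\nu(u)}(\nu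 a)$, $\nu(ae_u)=(\nu a)e_u$, $(ae_u)\nu=(a\nu)e_{\nu^{-1}(u)}$ and $(e_ua)\nu=e_u(a\nu)$. * There is a set $\mathcal P$ of representatives of the $\langle\nu\rangle$-orbits such that, with $\hat{\mathcal P}_s=\nu^s(\mathcal P)$, $\hat Z_{s,t}=\bigoplus_{v\in\hat{\mathcal P}_s,u\in\hat{\mathcal P}_t}e_v\hat Ze_u$ and $\rho_{s,t}(a)=\nu^{-s}a\nu^{t}$ for $a\in\hat Z_{s,t}$, the restriction of $\hat b_n$ to $\hat Z_{s_0,s_1}\otimes\cdots\otimes\hat Z_{s_{n-1},s_n}$ equals $(-1)^{s_0-s_n}\rho_{s_0,s_n}^{-1}\hat b_n(\rho_{s_0,s_1}\otimes\cdots\otimes\rho_{s_{n-1},s_n})$. Such a $\mathcal P$ is fixed. It is *unitary strict* if for each $u$ there is $\mathfrak e_u\in e_u\hat Ze_u$ of degree $-1$ such that $\hat b_2(\mathfrak e_u\otimes a)=e_ua$ and $\hat b_2(a\otimes\mathfrak e_u)=(-1)^{|a|+1}ae_u$ for homogeneous $a$, and such that for $n\ne2$ the map $\hat b_n$ vanishes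 on every composable sequence of directed elements (elements of the subspaces $e_v\hat Ze_w$) containing $\mathfrak e_u$. For right $\hat S$-modules $X,Y$ of finite support (that is, $Xe_u=0$ for almost all $u$) put $$\mathrm{ad}(X,Y)=\bigoplus_{u,v}\mathrm{Hom}_k(Xe_u,Ye_v)\otimes_k e_v\hat Ze_u,\qquad \hat b^{ad}_n\big((f_n\otimes a_n)\otimes\cdots\otimes(f_1\otimes a_1)\big)=f_n\cdots f_1\otimes\hat b_n(a_n\otimes\cdots\otimes a_1),$$ graded through $\hat Z$, and write $g\circ f=\hat b_2^{ad}(g\otimes f)$. A *twisted module* $(X,\delta_X)$ is such an $X$ with $\delta_X\in\mathrm{ad}(X,X)_0$ satisfying two conditions: * there is a finite filtration $0=X_0\subseteq\cdots\subseteq X_\ell=X$ by submodules such that all coefficients of $\delta_X$ in a basis of $\hat Z$ map $X_r$ into $X_{r-1}$ for $1\le r\le\ell$; * $\sum_{s\ge1}\hat b^{ad}_s(\delta_X^{\otimes s})=0$. Put $$\hat b_1^{tw}(f)=\sum_{i_0,i_1\ge0}\hat b^{ad}_{i_0+i_1+1}(\delta_Y^{\otimes i_1}\otimes f\otimes\delta_X^{\otimes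 i_0}),\qquad g\star f=\sum_{i_0,i_1,i_2\ge0}\hat b^{ad}_{i_0+i_1+i_2+2}(\delta_W^{\otimes i_2}\otimes g\otimes\delta_Y^{\otimes i_1}\otimes f\otimes\delta_X^{\otimes i_0}).$$ In $\mathcal Z(\hat Z)$, the morphisms $(X,\delta_X)\to(Y,\delta_Y)$ are the $f\in\mathrm{ad}(X,Y)_{-1}$ with $\hat b^{tw}_1(f)=0$, composition is $\star$ (not associative in general), and the identities are $\mathbb I_X=\sum_u\mathrm{id}_{Xe_u}\otimes\mathfrak e_u$. Moreover $\mathrm{Hom}_{\mathcal H(\hat Z)}=\mathrm{Hom}_{\mathcal Z(\hat Z)}/\hat b_1^{tw}(\mathrm{ad}(X,Y)_{-2})$. The module $X[1]$ is the space $X$ on which $e_u$ acts as $e_{\nu^{-1}(u)}$ does on $X$; let $\phi_X:X\to X[1]$ be the identity map. For $f=\sum_af_a\otimes a$ put $f[1]=\sum_a\phi_Yf_a\phi_X^{-1}\otimes\nu a\nu^{-1}$, and put $(X,\delta_X)[1]=(X[1],\delta_X[1])$. Further let $\tau_X=\sum_u(\phi_X^{-1})|_{X[1]e_{\nu(u)}}\otimes(-1)^{s(u)}\mathfrak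 e_u\nu^{-1}\in\mathrm{ad}(X[1],X)_0$, where $u\in\hat{\mathcal P}_{s(u)}$. A *special conflation* from $(X,\delta_X)$ to $(Y,\delta_Y)$ is a pair of morphisms $(X,\delta_X)\xrightarrow{f}(E,\delta_E)\xrightarrow{g}(Y,\delta_Y)$ of $\mathcal Z(\hat Z)$ between twisted modules, of the form $f=\sum_uf_u\otimes\mathfrak e_u$, $g=\sum_ug_u\otimes\mathfrak e_u$, with $0\to Xe_u\xrightarrow{f_u}Ee_u\xrightarrow{g_u}Ye_u\to0$ exact for all $u$. Write $(f,E,g)\simeq(f',E',g')$ if there is an isomorphism $h:(E,\delta_E)\to(E',\delta_{E'})$ of $\mathcal Z(\hat Z)$ with $h\star f=f'\star\mathbb I_X$ and $g'\star h=\mathbb I_Y\star g$. **Proposition.** Let $\hat Z$ be a unitary strict $(b,\nu)$-algebra and let $(X,\delta_X),(Y,\delta_Y)$ be twisted modules. Then: 1. $(X,\delta_X)[1]$ is a twisted module, and $\simeq$ is an equivalence relation on the special conflations from $(X,\delta_X)$ to $(Y,\delta_Y)$. Denote by $\mathrm{Ext}_{\mathcal Z(\hat Z)}((Y,\delta_Y),(X,\delta_X))$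 the collection of its classes $[\xi]$. 2. For every $h\in\mathrm{Hom}_{\mathcal Z(\hat Z)}((Y,\delta_Y),(X,\delta_X)[1])$ the pair $$\xi_h:\ (X,\delta_X)\xrightarrow{(\mathbb I_X,0)^t}\Big(X\oplus Y,\begin{pmatrix}\delta_X&-\tau_X\circ h\\0&\delta_Y\end{pmatrix}\Big)\xrightarrow{(0,\mathbb I_Y)}(Y,\delta_Y)$$ is a special conflation. 3. The map $\Psi:h\mapsto[\xi_h]$ from $\mathrm{Hom}_{\mathcal Z(\hat Z)}((Y,\delta_Y),(X,\delta_X)[1])$ to $\mathrm{Ext}_{\mathcal Z(\hat Z)}((Y,\delta_Y),(X,\delta_X))$ is surjective, and it induces a bijection $$\mathrm{Hom}_{\mathcal H(\hat Z)}((Y,\delta_Y),(X,\delta_X)[1])\to\mathrm{Ext}_{\mathcal Z(\hat Z)}((Y,\delta_Y),(X,\delta_X)).$$ -/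

import Mathlib

open scoped TensorProduct

universe w uk uP uZ

noncomputable section

namespace BNu

/-! ## Modules over the elementary algebra with index set `P`

The elementary `k`-algebra with distinguished idempotents `e_u`, `u ∈ P`, is `S = ⨁_u k e_u`.
A unitary `S`-module is the same thing as a `k`-vector space with a family of pairwise orthogonal
idempotent operators `e_u` such that the space is the direct sum of their images. -/

/-- The operators `e u` are orthogonal idempotents and `M = ⨁_u e_u M`. -/
structure IsUnitaryAction {k : Type*} [Field k] {P : Type*} {M : Type*} [AddCommGroup M]
    [Module k M] (e : P → Module.End k M) : Prop where
  idem : ∀ u x, e u (e u x) = e u x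
  orth : ∀ u v, u ≠ v → ∀ x, e u (e v x) = 0
  finite : ∀ x, {u | e u x ≠ 0}.Finite
  sum : ∀ x, ∑ᶠ u, e u x = x

/-- A graded unitary `S`-`S`-bimodule structure on the vector space `Z`:
`lact u a = e_u a`, `ract u a = a e_u`, and `gr q` is the homogeneous component of degree `q`. -/
structure GradedBimodule (k : Type uk) [Field k] (P : Type uP) (Z : Type uZ) [AddCommGroup Z]
    [Module k Z] where
  lact : P → Module.End k Z
  ract : P → Module.End k Z
  lact_unitary : IsUnitaryAction lact
  ract_unitary : IsUnitaryAction ract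
  lact_ract : ∀ v u a, lact v (ract u a) = ract u (lact v a)
  gr : ℤ → Submodule k Z
  gr_internal : DirectSum.IsInternal gr
  lact_gr : ∀ u q a, a ∈ gr q → lact u a ∈ gr q
  ract_gr : ∀ u q a, a ∈ gr q → ract u a ∈ gr q

/-- `a ∈ e_v Z e_u`. -/
def GradedBimodule.Directed {k : Type uk} [Field k] {P : Type uP} {Z : Type uZ} [AddCommGroup Z]
    [Module k Z] (A : GradedBimodule k P Z) (v u : P) (a : Z) : Prop :=
  A.lact v a = a ∧ A.ract u a = a

/-- For `l = [a_1, …, a_n]`, the value `b_n(a_1 ⊗ ⋯ ⊗ a_n)`. -/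
def opList {k : Type*} [Field k] {Z : Type*} [AddCommGroup Z] [Module k Z]
    (b : ∀ n : ℕ, MultilinearMap k (fun _ : Fin n => Z) Z) (l : List Z) : Z :=
  b l.length l.get

/-- A `b`-algebra. The operations `b_n`, `n ≥ 1`, are `k`-multilinear maps which are balanced and
compatible with the outer actions, that is, morphisms of bimodules from the `n`-fold tensor power
of `Z` over `S` to `Z`. There is no operation `b_0`; the slot `n = 0` is filled by zero. -/
structure BAlgebra (k : Type uk) [Field k] (P : Type uP) (Z : Type uZ) [AddCommGroup Z]
    [Module k Z] extends GradedBimodule k P Z where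
  b : ∀ n : ℕ, MultilinearMap k (fun _ : Fin n => Z) Z
  b_zero : b 0 = 0
  b_left : ∀ u a l, opList b (lact u a :: l) = lact u (opList b (a :: l))
  b_right : ∀ u a l, opList b (l ++ [ract u a]) = ract u (opList b (l ++ [a]))
  b_balanced : ∀ u a a' l l',
    opList b (l ++ ract u a :: a' :: l') = opList b (l ++ a :: lact u a' :: l')
  /-- Each `b_n` is homogeneous of degree `1`. -/
  b_degree : ∀ (n : ℕ) (d : Fin n → ℤ) (a : Fin n → Z), (∀ i, a i ∈ gr (d i)) →
    b n a ∈ gr (∑ i, d i + 1)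
  /-- `∑_{r+s+t=n} b_{r+1+t}(id^{⊗r} ⊗ b_s ⊗ id^{⊗t}) = 0`, evaluated on homogeneous elements;
  by the Koszul rule the summand carries the sign `(-1)^{|a_1|+⋯+|a_r|}`. -/
  b_relation : ∀ (l : List Z) (d : List ℤ), List.Forall₂ (fun a q => a ∈ gr q) l d →
    ∑ r ∈ Finset.range l.length, ∑ s ∈ Finset.Icc 1 (l.length - r),
      (d.take r).sum.negOnePow •
        opList b (l.take r ++ opList b ((l.drop r).take s) :: l.drop (r + s)) = 0

/-- A directed element `c` is strict if `b_n`, for `n ≠ 2`, vanishes on every composable sequence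
of directed elements in which `c` occurs. -/
def BAlgebra.IsStrict {k : Type uk} [Field k] {P : Type uP} {Z : Type uZ} [AddCommGroup Z]
    [Module k Z] (A : BAlgebra k P Z) (c : Z) : Prop :=
  ∀ (n : ℕ), n ≠ 2 → ∀ (x : Fin (n + 1) → P) (a : Fin n → Z),
    (∀ i, A.Directed (x i.castSucc) (x i.succ) (a i)) → (∃ i, a i = c) → A.b n a = 0

/-- The set `P_s = ν^s(P_0)`. -/
def layer {P : Type*} (ν : Equiv.Perm P) (P₀ : Set P) (s : ℤ) : Set P := (ν ^ s) '' P₀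

/-- The subspace `Z_{s,t} = ⨁_{v ∈ P_s, u ∈ P_t} e_v Z e_u`. -/
def GradedBimodule.block {k : Type uk} [Field k] {P : Type uP} {Z : Type uZ} [AddCommGroup Z]
    [Module k Z] (A : GradedBimodule k P Z) (ν : Equiv.Perm P) (P₀ : Set P) (s t : ℤ) :
    Submodule k Z :=
  ⨆ v ∈ layer ν P₀ s, ⨆ u ∈ layer ν P₀ t, LinearMap.range (A.lact v ∘ₗ A.ract u)

/-- `ρ_{s,t}(a) = ν^{-s} a ν^t`; it is homogeneous of degree `s - t`. -/
def rho {k : Type*} [Field k] {Z : Type*} [AddCommGroup Z] [Module k Z] (νL νR : Z ≃ₗ[k] Z)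
    (s t : ℤ) : Z ≃ₗ[k] Z :=
  (νR ^ t).trans (νL ^ (-s))

/-- A `(b,ν)`-algebra: a `b`-algebra with a two-sided translation `ν` (with `νL a = ν a` and
`νR a = a ν`) and a set `P₀` of representatives of the `⟨ν⟩`-orbits in `P` such that
`b_n` restricted to `Z_{s_0,s_1} ⊗ ⋯ ⊗ Z_{s_{n-1},s_n}` equals
`(-1)^{s_0-s_n} ρ_{s_0,s_n}^{-1} b_n (ρ_{s_0,s_1} ⊗ ⋯ ⊗ ρ_{s_{n-1},s_n})`. -/
structure BNuAlgebra (k : Type uk) [Field k] (P : Type uP) (Z : Type uZ) [AddCommGroup Z]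
    [Module k Z] extends BAlgebra k P Z where
  ν : Equiv.Perm P
  ν_free : ∀ (u : P) (t : ℤ), t ≠ 0 → (ν ^ t) u ≠ u
  νL : Z ≃ₗ[k] Z
  νR : Z ≃ₗ[k] Z
  νL_gr : ∀ q a, a ∈ gr q → νL a ∈ gr (q - 1)
  νR_gr : ∀ q a, a ∈ gr q → νR a ∈ gr (q - 1)
  νL_νR : ∀ a, νR (νL a) = νL (νR a)
  νL_lact : ∀ u a, νL (lact u a) = lact (ν u) (νL a)
  νL_ract : ∀ u a, νL (ract u a) = ract u (νL a)
  νR_ract : ∀ u a, νR (ract u a) = ract (ν⁻¹ u) (νR a)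
  νR_lact : ∀ u a, νR (lact u a) = lact u (νR a)
  P₀ : Set P
  P₀_spec : ∀ u, ∃! p, p ∈ P₀ ∧ ∃ s : ℤ, (ν ^ s) p = u
  /-- On homogeneous elements the Koszul rule contributes to
  `(ρ_{s_0,s_1} ⊗ ⋯ ⊗ ρ_{s_{n-1},s_n})(a_1 ⊗ ⋯ ⊗ a_n)` the sign with exponent
  `∑_{l<m} |ρ_{s_{m-1},s_m}| |a_l| = ∑_l (s_l - s_n) |a_l|`. -/
  b_translation : ∀ (n : ℕ) (s : Fin (n + 1) → ℤ) (d : Fin n → ℤ) (a : Fin n → Z),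
    (∀ i, a i ∈ toBAlgebra.block ν P₀ (s i.castSucc) (s i.succ)) → (∀ i, a i ∈ gr (d i)) →
    b n a = (s 0 - s (Fin.last n) + ∑ i, (s i.succ - s (Fin.last n)) * d i).negOnePow •
      (rho νL νR (s 0) (s (Fin.last n))).symm
        (b n fun i => rho νL νR (s i.castSucc) (s i.succ) (a i))

/-- A unitary strict `(b,ν)`-algebra, with strict units `unit u ∈ e_u Z e_u` of degree `-1`. -/
structure UnitaryBNuAlgebra (k : Type uk) [Field k] (P : Type uP) (Z : Type uZ) [AddCommGroup Z]
    [Module k Z] extends BNuAlgebra k P Z where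
  unit : P → Z
  unit_gr : ∀ u, unit u ∈ gr (-1)
  unit_directed : ∀ u, lact u (ract u (unit u)) = unit u
  unit_strict : ∀ u, toBAlgebra.IsStrict (unit u)
  unit_left : ∀ u q a, a ∈ gr q → b 2 ![unit u, a] = lact u a
  unit_right : ∀ u q a, a ∈ gr q → b 2 ![a, unit u] = (q + 1).negOnePow • ract u a

/-! ## Right modules with finite support -/

/-- A unitary right `S`-module with finite support; `e u x` is `x e_u`. -/
structure FSMod (k : Type uk) [Field k] (P : Type uP) where
  carrier : Type w
  [acg : AddCommGroup carrier]
  [mod : Module k carrier]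
  e : P → Module.End k carrier
  unitary : IsUnitaryAction e
  finite_support : {u | e u ≠ 0}.Finite

attribute [instance] FSMod.acg FSMod.mod

instance {k : Type uk} [Field k] {P : Type uP} : CoeSort (FSMod.{w} k P) (Type w) :=
  ⟨FSMod.carrier⟩

section Modules

variable {k : Type uk} [Field k] {P : Type uP}

/-- The subspace `X e_u`. -/
def FSMod.comp (X : FSMod.{w} k P) (u : P) : Submodule k X := LinearMap.range (X.e u)

/-- Morphisms of right `S`-modules. -/
structure FSMod.Hom (X Y : FSMod.{w} k P) where
  map : X →ₗ[k] Y
  map_e : ∀ u x, map (X.e u x) = Y.e u (map x)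

theorem FSMod.Hom.map_comp {X Y : FSMod.{w} k P} (φ : FSMod.Hom X Y) (u : P) :
    ∀ x ∈ X.comp u, φ.map x ∈ Y.comp u := by
  rintro _ ⟨x, rfl⟩
  exact ⟨φ.map x, (φ.map_e u x).symm⟩

/-- The restriction `φ_u : X e_u → Y e_u`. -/
def FSMod.Hom.res {X Y : FSMod.{w} k P} (φ : FSMod.Hom X Y) (u : P) :
    X.comp u →ₗ[k] Y.comp u :=
  φ.map.restrict (φ.map_comp u)

/-- The identity morphism. -/
def FSMod.Hom.id (X : FSMod.{w} k P) : FSMod.Hom X X := ⟨LinearMap.id, fun _ _ => rfl⟩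

/-- The module `X[1]`: the same space, on which `e_u` acts as `e_{ν⁻¹(u)}` does on `X`. -/
def FSMod.shift (ν : Equiv.Perm P) (X : FSMod.{w} k P) : FSMod.{w} k P where
  carrier := X.carrier
  e u := X.e (ν⁻¹ u)
  unitary :=
    { idem := fun _ x => X.unitary.idem _ x
      orth := fun _ _ h x => X.unitary.orth _ _ (fun h' => h (ν⁻¹.injective h')) x
      finite := fun x => (X.unitary.finite x).preimage (ν⁻¹.injective.injOn)
      sum := fun x => (finsum_comp_equiv (f := fun u => X.e u x) ν⁻¹).trans (X.unitary.sum x) }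
  finite_support := X.finite_support.preimage (ν⁻¹.injective.injOn)

/-- `φ(X) : X → X[1]`, the identity of the underlying space. -/
def FSMod.phi (ν : Equiv.Perm P) (X : FSMod.{w} k P) : X ≃ₗ[k] X.shift ν :=
  LinearEquiv.refl k X.carrier

/-- The direct sum `X ⊕ Y`. -/
def FSMod.prod (X Y : FSMod.{w} k P) : FSMod.{w} k P where
  carrier := X × Y
  e u := (X.e u).prodMap (Y.e u)
  unitary :=
    { idem := fun u x => Prod.ext (X.unitary.idem u x.1) (Y.unitary.idem u x.2)
      orth := fun u v h x => Prod.ext (X.unitary.orth u v h x.1) (Y.unitary.orth u v h x.2)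
      finite := fun x => by
        refine ((X.unitary.finite x.1).union (Y.unitary.finite x.2)).subset fun u hu => ?_
        by_contra h
        simp only [Set.mem_union, Set.mem_ofPred_eq, not_or, not_not] at h
        exact hu (Prod.ext h.1 h.2)
      sum := fun x => by
        have hX := X.unitary.finite x.1
        have hY := Y.unitary.finite x.2
        have h1 : ∀ u, (X.e u).prodMap (Y.e u) x
            = LinearMap.inl k X Y (X.e u x.1) + LinearMap.inr k X Y (Y.e u x.2) := fun u => by
          simp
        rw [finsum_congr h1, finsum_add_distrib
          (hX.subset fun u hu => fun h => hu (by simp [h]))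
          (hY.subset fun u hu => fun h => hu (by simp [h]))]
        have h2 := (LinearMap.inl k X Y).toAddMonoidHom.map_finsum (f := fun u => X.e u x.1) hX
        have h3 := (LinearMap.inr k X Y).toAddMonoidHom.map_finsum (f := fun u => Y.e u x.2) hY
        rw [X.unitary.sum] at h2
        rw [Y.unitary.sum] at h3
        simp only [LinearMap.toAddMonoidHom_coe] at h2 h3
        rw [← h2, ← h3]
        simp }
  finite_support := by
    refine (X.finite_support.union Y.finite_support).subset fun u hu => ?_
    by_contra h
    simp only [Set.mem_union, Set.mem_ofPred_eq, not_or, not_not] at h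
    exact hu (by rw [h.1, h.2]; rfl)

/-- The inclusion of the first summand. -/
def FSMod.inl (X Y : FSMod.{w} k P) : FSMod.Hom X (X.prod Y) where
  map := LinearMap.inl k X Y
  map_e u _ := Prod.ext rfl (map_zero (Y.e u)).symm

/-- The projection onto the second summand. -/
def FSMod.snd (X Y : FSMod.{w} k P) : FSMod.Hom (X.prod Y) Y where
  map := LinearMap.snd k X Y
  map_e _ _ := rfl

end Modules

/-! ## The operations of `ad(Z)`

`Pre Z X Y = Hom_k(X,Y) ⊗ Z` contains
`ad(Z)(X,Y) = ⨁_{u,v} Hom_k(X e_u, Y e_v) ⊗ e_v Z e_u` as a subspace. A tensor product of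
composable morphisms is recorded by its image in `Hom_k(X,Y) ⊗ T(Z)`, with `T(Z)` the tensor
algebra over `k`; there `(f_n ⊗ a_n) ⊗ ⋯ ⊗ (f_1 ⊗ a_1)` becomes
`f_n ⋯ f_1 ⊗ (a_n ⊗ ⋯ ⊗ a_1)`. -/

section Ad

variable {k : Type uk} [Field k] {P : Type uP} (Z : Type uZ) [AddCommGroup Z] [Module k Z]

/-- `Hom_k(X,Y) ⊗ Z`. -/
abbrev Pre (X Y : FSMod.{w} k P) := (X →ₗ[k] Y) ⊗[k] Z

/-- `Hom_k(X,Y) ⊗ T(Z)`. -/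
abbrev Word (X Y : FSMod.{w} k P) := (X →ₗ[k] Y) ⊗[k] TensorAlgebra k Z

variable {Z}

/-- `f ⊗ a ↦ f ⊗ a`, words of length one. -/
def toWord (X Y : FSMod.{w} k P) : Pre Z X Y →ₗ[k] Word Z X Y :=
  LinearMap.lTensor _ (TensorAlgebra.ι k)

/-- `(g ⊗ y)(f ⊗ x) = gf ⊗ yx`. -/
def wcomp (X Y W : FSMod.{w} k P) : Word Z Y W →ₗ[k] Word Z X Y →ₗ[k] Word Z X W :=
  TensorProduct.map₂ (LinearMap.llcomp k X Y W) (LinearMap.mul k (TensorAlgebra k Z))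

theorem wcomp_tmul {X Y W : FSMod.{w} k P} (g : Y →ₗ[k] W) (f : X →ₗ[k] Y)
    (y x : TensorAlgebra k Z) :
    wcomp X Y W (g ⊗ₜ y) (f ⊗ₜ x) = (g ∘ₗ f) ⊗ₜ[k] (y * x) := rfl

/-- The word `δ^{⊗n}`. -/
def wpow {X : FSMod.{w} k P} (δ : Pre Z X X) : ℕ → Word Z X X
  | 0 => LinearMap.id ⊗ₜ 1
  | n + 1 => wcomp X X X (toWord X X δ) (wpow δ n)

/-- `∑_{i ≥ 0} δ^{⊗i}`, a finite sum when `δ` lowers a finite filtration of `X`. -/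
def geom {X : FSMod.{w} k P} (δ : Pre Z X X) : Word Z X X := ∑ᶠ n, wpow δ n

/-- All the `b_n` together: the linear map `T(Z) → Z` which is `b_n` on the `n`-th tensor power. -/
def bBar (A : BAlgebra k P Z) : TensorAlgebra k Z →ₗ[k] Z :=
  DirectSum.toModule k ℕ Z (fun n => PiTensorProduct.lift (A.b n)) ∘ₗ
    (TensorAlgebra.equivDirectSum (R := k) (M := Z)).toLinearMap

theorem bBar_tprod (A : BAlgebra k P Z) (n : ℕ) (a : Fin n → Z) :
    bBar A (TensorAlgebra.tprod k Z n a) = A.b n a := by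
  have h : TensorAlgebra.equivDirectSum (TensorAlgebra.tprod k Z n a) =
      DirectSum.of (fun n => ⨂[k]^n Z) n (PiTensorProduct.tprod k a) :=
    TensorAlgebra.toDirectSum_tensorPower_tprod a
  have h' := DirectSum.toModule_lof k (φ := fun n => PiTensorProduct.lift (A.b n)) n
    (PiTensorProduct.tprod k a)
  rw [PiTensorProduct.lift.tprod] at h'
  exact (congrArg _ h).trans h'

/-- On the word of `t_n ⊗ ⋯ ⊗ t_1` this is `b^{ad}_n(t_n ⊗ ⋯ ⊗ t_1)`: it sends
`f_n ⋯ f_1 ⊗ (a_n ⊗ ⋯ ⊗ a_1)` to `f_n ⋯ f_1 ⊗ b_n(a_n ⊗ ⋯ ⊗ a_1)`. -/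
def bAd (A : BAlgebra k P Z) (X Y : FSMod.{w} k P) : Word Z X Y →ₗ[k] Pre Z X Y :=
  LinearMap.lTensor _ (bBar A)

theorem bAd_tmul_tprod (A : BAlgebra k P Z) {X Y : FSMod.{w} k P} (f : X →ₗ[k] Y) (n : ℕ)
    (a : Fin n → Z) :
    bAd A X Y (f ⊗ₜ TensorAlgebra.tprod k Z n a) = f ⊗ₜ[k] A.b n a := by
  rw [bAd, LinearMap.lTensor_tmul, bBar_tprod]

/-- `g ∘ f = b^{ad}_2(g ⊗ f)`. -/
def circ (A : BAlgebra k P Z) {X Y W : FSMod.{w} k P} (g : Pre Z Y W) (f : Pre Z X Y) :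
    Pre Z X W :=
  bAd A X W (wcomp X Y W (toWord Y W g) (toWord X Y f))

/-- The homogeneous component `ad(Z)(X,Y)_d`, spanned by the `f ⊗ a` with
`f ∈ Hom_k(X e_u, Y e_v)` and `a ∈ e_v Z e_u` of degree `d`. -/
def adDeg (A : GradedBimodule k P Z) (X Y : FSMod.{w} k P) (d : ℤ) : Submodule k (Pre Z X Y) :=
  Submodule.span k {t | ∃ (u v : P) (f : X →ₗ[k] Y) (a : Z),
    Y.e v ∘ₗ f ∘ₗ X.e u = f ∧ A.Directed v u a ∧ a ∈ A.gr d ∧ t = f ⊗ₜ a}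

end Ad

/-! ## Twisted modules -/

section Tw

variable {k : Type uk} [Field k] {P : Type uP} (Z : Type uZ) [AddCommGroup Z] [Module k Z]

/-- A pair `(X, δ_X)`, not yet subject to the conditions of a twisted module. -/
structure TwPair (k : Type uk) [Field k] (P : Type uP) (Z : Type uZ) [AddCommGroup Z]
    [Module k Z] where
  X : FSMod.{w} k P
  δ : Pre Z X X

variable {Z}

/-- The endomorphisms `f` of `X` with `f(F_{r+1}) ⊆ F_r` for all `r < n`. -/
def lowering {X : FSMod.{w} k P} (F : ℕ → Submodule k X) (n : ℕ) : Submodule k (X →ₗ[k] X) where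
  carrier := {f | ∀ r < n, ∀ x ∈ F (r + 1), f x ∈ F r}
  add_mem' hf hg r hr x hx := (F r).add_mem (hf r hr x hx) (hg r hr x hx)
  zero_mem' r _ _ _ := (F r).zero_mem
  smul_mem' c _ hf r hr x hx := (F r).smul_mem c (hf r hr x hx)

/-- An element lies in the image of `N ⊗ Z` if and only if all its coefficients with respect to a
basis of `Z` lie in `N`. -/
theorem mem_range_iff_coeff {H : Type*} [AddCommGroup H] [Module k H] (N : Submodule k H)
    {I : Type*} [DecidableEq I] (B : Module.Basis I k Z) (t : H ⊗[k] Z) :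
    t ∈ LinearMap.range (LinearMap.rTensor Z N.subtype) ↔
      ∀ i, TensorProduct.equivFinsuppOfBasisRight B t i ∈ N := by
  constructor
  · rintro ⟨s, rfl⟩ i
    induction s with
    | zero => simp
    | add x y hx hy => rw [map_add, map_add]; exact N.add_mem hx hy
    | tmul n z =>
      simp only [LinearMap.rTensor_tmul, Submodule.subtype_apply,
        TensorProduct.equivFinsuppOfBasisRight_apply_tmul_apply]
      exact N.smul_mem _ n.2
  · intro h
    rw [← (TensorProduct.equivFinsuppOfBasisRight B).symm_apply_apply t,
      TensorProduct.equivFinsuppOfBasisRight_symm_apply]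
    refine Submodule.sum_mem _ fun i _ => ?_
    exact ⟨⟨_, h i⟩ ⊗ₜ B i, by simp⟩

/-- `(X, δ_X)` is an object of `tw(Z)`: `δ_X` is homogeneous of degree `0`; there is a finite
filtration of `X` by submodules such that the coefficients of `δ_X` (in any basis of `Z`) map
each step into the previous one; and `∑_{s ≥ 1} b^{ad}_s(δ_X^{⊗s}) = 0`. -/
def IsTw (A : BAlgebra k P Z) (E : TwPair.{w} k P Z) : Prop :=
  E.δ ∈ adDeg A.toGradedBimodule E.X E.X 0 ∧
  (∃ (n : ℕ) (F : ℕ → Submodule k E.X), F 0 = ⊥ ∧ F n = ⊤ ∧ Monotone F ∧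
    (∀ r u, ∀ x ∈ F r, E.X.e u x ∈ F r) ∧
    E.δ ∈ LinearMap.range (LinearMap.rTensor Z (lowering F n).subtype)) ∧
  bAd A E.X E.X (geom E.δ) = 0

/-- `b^{tw}_1(f) = ∑_{i_0,i_1} b^{ad}_{i_0+i_1+1}(δ_Y^{⊗i_1} ⊗ f ⊗ δ_X^{⊗i_0})`. -/
def bTw1 (A : BAlgebra k P Z) (X Y : TwPair.{w} k P Z) : Pre Z X.X Y.X →ₗ[k] Pre Z X.X Y.X :=
  bAd A X.X Y.X ∘ₗ wcomp X.X Y.X Y.X (geom Y.δ) ∘ₗ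
    (wcomp X.X X.X Y.X).flip (geom X.δ) ∘ₗ toWord X.X Y.X

/-- `g ⋆ f = b^{tw}_2(g ⊗ f)
= ∑_{i_0,i_1,i_2} b^{ad}_{i_0+i_1+i_2+2}(δ_W^{⊗i_2} ⊗ g ⊗ δ_Y^{⊗i_1} ⊗ f ⊗ δ_X^{⊗i_0})`. -/
def star (A : BAlgebra k P Z) (X Y W : TwPair.{w} k P Z) (g : Pre Z Y.X W.X)
    (f : Pre Z X.X Y.X) : Pre Z X.X W.X :=
  bAd A X.X W.X
    (wcomp X.X W.X W.X (geom W.δ)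
      (wcomp X.X Y.X W.X (toWord Y.X W.X g)
        (wcomp X.X Y.X Y.X (geom Y.δ)
          (wcomp X.X X.X Y.X (toWord X.X Y.X f) (geom X.δ)))))

/-- The morphisms `X → Y` of the precategory of cycles: homogeneous of degree `-1` and
annihilated by `b^{tw}_1`. -/
def ZHom (A : BAlgebra k P Z) (X Y : TwPair.{w} k P Z) : Submodule k (Pre Z X.X Y.X) :=
  adDeg A.toGradedBimodule X.X Y.X (-1) ⊓ LinearMap.ker (bTw1 A X Y)

/-- The ideal `b^{tw}_1[tw(Z)(X,Y)_{-2}]`. -/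
def IHom (A : BAlgebra k P Z) (X Y : TwPair.{w} k P Z) : Submodule k (Pre Z X.X Y.X) :=
  (adDeg A.toGradedBimodule X.X Y.X (-2)).map (bTw1 A X Y)

/-- Two cycles are identified when their difference lies in `IHom`. -/
def homologySetoid (A : BAlgebra k P Z) (X Y : TwPair.{w} k P Z) : Setoid (ZHom A X Y) where
  r f g := f.1 - g.1 ∈ IHom A X Y
  iseqv :=
    { refl := fun f => by rw [sub_self]; exact (IHom A X Y).zero_mem
      symm := fun {f g} h => by rw [← neg_sub]; exact (IHom A X Y).neg_mem h
      trans := fun {f g e} h h' => by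
        rw [← sub_add_sub_cancel f.1 g.1 e.1]; exact (IHom A X Y).add_mem h h' }

/-- The morphisms `X → Y` of the cohomology category: the quotient of `ZHom` by the ideal. -/
abbrev HHom (A : BAlgebra k P Z) (X Y : TwPair.{w} k P Z) := Quotient (homologySetoid A X Y)

end Tw

/-! ## Special conflations -/

section Conflations

variable {k : Type uk} [Field k] {P : Type uP} {Z : Type uZ} [AddCommGroup Z] [Module k Z]
  (A : UnitaryBNuAlgebra k P Z)

/-- The special morphism `∑_u φ_u ⊗ 𝔢_u`. -/
def special {X Y : FSMod.{w} k P} (φ : FSMod.Hom X Y) : Pre Z X Y :=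
  ∑ᶠ u, (φ.map ∘ₗ X.e u) ⊗ₜ[k] A.unit u

/-- `𝕀_X = ∑_u id_{X e_u} ⊗ 𝔢_u`. -/
def idn (X : FSMod.{w} k P) : Pre Z X X := special A (FSMod.Hom.id X)

/-- `h : X → Y` is an isomorphism of the precategory of cycles. -/
def IsZIso (X Y : TwPair.{w} k P Z) (h : Pre Z X.X Y.X) : Prop :=
  h ∈ ZHom A.toBAlgebra X Y ∧ ∃ h' ∈ ZHom A.toBAlgebra Y X,
    star A.toBAlgebra X Y X h' h = idn A X.X ∧ star A.toBAlgebra Y X Y h h' = idn A Y.X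

/-- A composable pair `X → E → Y`. -/
structure ConfData (X Y : TwPair.{w} k P Z) where
  E : TwPair.{w} k P Z
  f : Pre Z X.X E.X
  g : Pre Z E.X Y.X

variable {X Y : TwPair.{w} k P Z}

/-- The pair `ξ` is a special conflation: `E` is a twisted module, `f` and `g` are special
morphisms and cycles, and `0 → X e_u → E e_u → Y e_u → 0` is exact for all `u`. -/
def IsSpecialConflation (ξ : ConfData X Y) : Prop :=
  IsTw A.toBAlgebra ξ.E ∧
  ξ.f ∈ ZHom A.toBAlgebra X ξ.E ∧
  ξ.g ∈ ZHom A.toBAlgebra ξ.E Y ∧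
  ∃ (φ : FSMod.Hom X.X ξ.E.X) (ψ : FSMod.Hom ξ.E.X Y.X),
    ξ.f = special A φ ∧ ξ.g = special A ψ ∧
    ∀ u, Function.Injective (φ.res u) ∧ Function.Exact (φ.res u) (ψ.res u) ∧
      Function.Surjective (ψ.res u)

variable (X Y) in
/-- The special conflations from `X` to `Y`. -/
abbrev SpecialConflation := {ξ : ConfData X Y // IsSpecialConflation A ξ}

/-- The relation on special conflations given by an isomorphism `h` of the middle terms with
`h ⋆ f = f' ⋆ 𝕀_X` and `g' ⋆ h = 𝕀_Y ⋆ g`. -/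
def ConfRel (ξ ξ' : SpecialConflation A X Y) : Prop :=
  ∃ h : Pre Z ξ.1.E.X ξ'.1.E.X, IsZIso A ξ.1.E ξ'.1.E h ∧
    star A.toBAlgebra X ξ.1.E ξ'.1.E h ξ.1.f =
      star A.toBAlgebra X X ξ'.1.E ξ'.1.f (idn A X.X) ∧
    star A.toBAlgebra ξ.1.E ξ'.1.E Y ξ'.1.g h =
      star A.toBAlgebra ξ.1.E Y Y (idn A Y.X) ξ.1.g

variable (X Y) in
/-- `Ext(Y, X)`: the special conflations from `X` to `Y` modulo `ConfRel`. -/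
abbrev Ext := Quot (ConfRel A (X := X) (Y := Y))

end Conflations

/-! ## Translation and the conflation attached to a morphism -/

section Shift

variable {k : Type uk} [Field k] {P : Type uP} {Z : Type uZ} [AddCommGroup Z] [Module k Z]

theorem BNuAlgebra.exists_layer (A : BNuAlgebra k P Z) (u : P) :
    ∃ s : ℤ, u ∈ layer A.ν A.P₀ s := by
  obtain ⟨p, ⟨hp, s, hs⟩, -⟩ := A.P₀_spec u
  exact ⟨s, p, hp, hs⟩

/-- The unique integer `s` with `u ∈ P_s`, equivalently `𝔢_u ∈ Z_{s,s}`. -/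
def BNuAlgebra.level (A : BNuAlgebra k P Z) (u : P) : ℤ := (A.exists_layer u).choose

theorem BNuAlgebra.level_eq_iff (A : BNuAlgebra k P Z) (u : P) (s : ℤ) :
    A.level u = s ↔ u ∈ layer A.ν A.P₀ s := by
  constructor
  · rintro rfl
    exact (A.exists_layer u).choose_spec
  · rintro ⟨p, hp, hs⟩
    obtain ⟨q, hq, ht⟩ := (A.exists_layer u).choose_spec
    change (A.ν ^ A.level u) q = u at ht
    have hpq : p = q := (A.P₀_spec u).unique ⟨hp, s, hs⟩ ⟨hq, _, ht⟩
    subst hpq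
    by_contra hne
    refine A.ν_free p (A.level u - s) (sub_ne_zero.mpr hne) ?_
    rw [sub_eq_neg_add, zpow_add, Equiv.Perm.mul_apply, ht, ← hs, ← Equiv.Perm.mul_apply,
      ← zpow_add, neg_add_cancel, zpow_zero, Equiv.Perm.one_apply]

/-- `f[1] = ∑_a φ(Y) f_a φ(X)⁻¹ ⊗ a[1]`, where `a[1] = ν a ν⁻¹`. -/
def shiftHom (A : BNuAlgebra k P Z) {X Y : FSMod.{w} k P} (f : Pre Z X Y) :
    Pre Z (X.shift A.ν) (Y.shift A.ν) :=
  TensorProduct.map (LinearEquiv.arrowCongr (X.phi A.ν) (Y.phi A.ν)).toLinearMap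
    (A.νR.symm.trans A.νL).toLinearMap f

/-- `(X, δ_X)[1] = (X[1], δ_X[1])`. -/
def TwPair.shift (A : BNuAlgebra k P Z) (X : TwPair.{w} k P Z) : TwPair.{w} k P Z :=
  ⟨X.X.shift A.ν, shiftHom A X.δ⟩

variable (A : UnitaryBNuAlgebra k P Z)

/-- `τ(𝔢_u) = (-1)^s 𝔢_u ν⁻¹` for `𝔢_u ∈ Z_{s,s}`. -/
def tauUnit (u : P) : Z := (A.level u).negOnePow • A.νR.symm (A.unit u)

/-- `τ_X = ∑_u φ(X)_u⁻¹ ⊗ τ(𝔢_u) : X[1] → X`. -/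
def tau (X : FSMod.{w} k P) : Pre Z (X.shift A.ν) X :=
  ∑ᶠ u, (X.e u ∘ₗ (X.phi A.ν).symm.toLinearMap) ⊗ₜ[k] tauUnit A u

/-- `∑_a f_a ⊗ a ↦ ∑_a g f_a h ⊗ a`. -/
def sandwich {X Y X' Y' : FSMod.{w} k P} (g : Y →ₗ[k] Y') (h : X' →ₗ[k] X) :
    Pre Z X Y →ₗ[k] Pre Z X' Y' :=
  LinearMap.rTensor Z (LinearMap.llcomp k X' Y Y' g ∘ₗ LinearMap.lcomp k Y h)

/-- The pair `(X ⊕ Y, δ)` with `δ` the matrix with rows `(δ_X, γ)` and `(0, δ_Y)`. -/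
def twistedSum (X Y : TwPair.{w} k P Z) (γ : Pre Z Y.X X.X) : TwPair.{w} k P Z where
  X := X.X.prod Y.X
  δ :=
    sandwich (Y' := X.X.prod Y.X) (X' := X.X.prod Y.X)
        (LinearMap.inl k X.X Y.X) (LinearMap.fst k X.X Y.X) X.δ
      + sandwich (Y' := X.X.prod Y.X) (X' := X.X.prod Y.X)
        (LinearMap.inl k X.X Y.X) (LinearMap.snd k X.X Y.X) γ
      + sandwich (Y' := X.X.prod Y.X) (X' := X.X.prod Y.X)
        (LinearMap.inr k X.X Y.X) (LinearMap.snd k X.X Y.X) Y.δ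

/-- The pair `ξ_h`: middle term `X ⊕ Y` with upper right entry `-τ_X ∘ h`, `f = (𝕀_X, 0)^t`,
`g = (0, 𝕀_Y)`. -/
def xi (X Y : TwPair.{w} k P Z) (h : Pre Z Y.X (X.shift A.toBNuAlgebra).X) : ConfData X Y where
  E := twistedSum X Y (-(circ A.toBAlgebra (tau A X.X) h))
  f := special A (FSMod.inl X.X Y.X)
  g := special A (FSMod.snd X.X Y.X)

end Shift

end BNu

end

/-!
The set `Ext(Y, X)` is computed by splitting. A special conflation `X → E → Y` is componentwise
exact, so `E = X ⊕ Y` as a module, and because its two maps are special cycles the matrix of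
`δ_E` in such a splitting is upper triangular with diagonal `δ_X, δ_Y` and one further entry `γ` of
degree `0` (`IsSpecialConflation.exists_splitting`). Put `G = ∑ δ^{⊗i}`. As `G` is inverse to
`1 - δ` in a category of words, `G_E` has the off-diagonal entry `G_X γ G_Y`
(`Splitting.geom_eq`), so that the equation for `E` to be twisted reads `b^{tw}_1(γ) = 0`.

Strictness of the units makes `⋆` and `b^{tw}_1` elementary on special morphisms
(`star_special`, `special_star`, `bTw1_special`). Hence a morphism `h` of middle terms satisfies
`h ⋆ f = f' ⋆ 𝕀` and `g' ⋆ h = 𝕀 ⋆ g` exactly when it is unipotent, with one entry `η` of degree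
`-1`; it is a cycle exactly when `b^{tw}_1(η) = γ' - γ`, and then the unipotent morphism with entry
`-η` is an inverse, since the product of two off-diagonal parts is zero. This is `confRel_iff`:
the classes of special conflations are the cycles `γ` of degree `0` modulo the boundaries
`b^{tw}_1(η)`. In particular the relation is an equivalence, although `⋆` is not associative.

It remains to compare the morphisms `Y → X[1]` with the morphisms `Y → X`. Composition with `τ_X`
is `f ⊗ a ↦ (-1)^t f ⊗ ν⁻¹a`, where `t` is the layer of the right idempotent of `a`
(`circ_tau`); this is bijective of degree `1`. The translation rule for the operations gives
`b_tr`, an explicit sign for moving powers of `ν` between neighbouring factors, and two of its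
consequences are used: conjugation by `ν` commutes with all `b_n` (`BNuAlgebra.b_conj`, whence
`X[1]` is twisted), and composition with `τ_X` anticommutes with `b^{tw}_1` (`bTw1_Theta`). So it
identifies cycles with cycles and boundaries with boundaries.

All identities between operations are checked on directed homogeneous elements and extended by
multilinearity, the operations being zero on sequences of directed elements which are not
composable (`BAlgebra.b_eq_zero_of_not_composable`).
-/

noncomputable section

namespace BNu

/-! ### The category of words -/

section Words

variable {k : Type uk} [Field k] {P : Type uP} {Z : Type uZ} [AddCommGroup Z] [Module k Z]
variable {X Y W V X' Y' X'' Y'' : FSMod.{w} k P}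

/-- Composition of words, written from left to right in the order of the product in `T(Z)`. -/
local infixr:75 " ⋄ " => wcomp _ _ _

/-- A linear map as a word of length zero. -/
def hat (g : X →ₗ[k] Y) : Word Z X Y := g ⊗ₜ 1

theorem wcomp_assoc (c : Word Z W V) (b : Word Z Y W) (a : Word Z X Y) :
    (c ⋄ b) ⋄ a = c ⋄ b ⋄ a := by
  induction a using TensorProduct.induction_on with
  | zero => simp
  | add a a' h h' => simp only [map_add, h, h']
  | tmul f x =>
    induction b using TensorProduct.induction_on with
    | zero => simp
    | add b b' h h' => simp only [map_add, LinearMap.add_apply, h, h']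
    | tmul g y =>
      induction c using TensorProduct.induction_on with
      | zero => simp
      | add c c' h h' => simp only [map_add, LinearMap.add_apply, h, h']
      | tmul e z => simp only [wcomp_tmul, mul_assoc, LinearMap.comp_assoc]

@[simp] theorem hat_id_wcomp (a : Word Z X Y) : hat (LinearMap.id : Y →ₗ[k] Y) ⋄ a = a := by
  induction a using TensorProduct.induction_on with
  | zero => simp
  | add a a' h h' => simp only [map_add, h, h']
  | tmul f x => simp only [hat, wcomp_tmul, one_mul, LinearMap.id_comp]

@[simp] theorem wcomp_hat_id (a : Word Z X Y) : a ⋄ hat (LinearMap.id : X →ₗ[k] X) = a := by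
  induction a using TensorProduct.induction_on with
  | zero => simp
  | add a a' h h' => simp only [map_add, LinearMap.add_apply, h, h']
  | tmul f x => simp only [hat, wcomp_tmul, mul_one, LinearMap.comp_id]

theorem hat_wcomp_hat (g : Y →ₗ[k] W) (f : X →ₗ[k] Y) :
    (hat g ⋄ hat f : Word Z X W) = hat (g ∘ₗ f) := by
  simp only [hat, wcomp_tmul, mul_one]

theorem hat_add (g g' : X →ₗ[k] Y) : (hat (g + g') : Word Z X Y) = hat g + hat g' :=
  TensorProduct.add_tmul _ _ _

@[simp] theorem hat_zero : (hat (0 : X →ₗ[k] Y) : Word Z X Y) = 0 :=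
  TensorProduct.zero_tmul _ _

theorem sandwich_tmul (g : Y →ₗ[k] Y') (h : X' →ₗ[k] X) (f : X →ₗ[k] Y) (a : Z) :
    sandwich g h (f ⊗ₜ[k] a) = (g ∘ₗ f ∘ₗ h) ⊗ₜ[k] a := rfl

theorem sandwich_sandwich (g' : Y' →ₗ[k] Y'') (h' : X'' →ₗ[k] X') (g : Y →ₗ[k] Y')
    (h : X' →ₗ[k] X) (t : Pre Z X Y) :
    sandwich g' h' (sandwich g h t) = sandwich (g' ∘ₗ g) (h ∘ₗ h') t := by
  induction t using TensorProduct.induction_on with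
  | zero => simp
  | add a a' h h' => simp only [map_add, h, h']
  | tmul f x => simp only [sandwich_tmul, LinearMap.comp_assoc]

@[simp] theorem sandwich_id_id (t : Pre Z X Y) :
    sandwich (LinearMap.id : Y →ₗ[k] Y) (LinearMap.id : X →ₗ[k] X) t = t := by
  induction t using TensorProduct.induction_on with
  | zero => simp
  | add a a' h h' => simp only [map_add, h, h']
  | tmul f x => simp only [sandwich_tmul, LinearMap.comp_id, LinearMap.id_comp]

theorem sandwich_add_left (g g' : Y →ₗ[k] Y') (h : X' →ₗ[k] X) (t : Pre Z X Y) :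
    sandwich (g + g') h t = sandwich g h t + sandwich g' h t := by
  induction t using TensorProduct.induction_on with
  | zero => simp
  | add a a' h h' => simp only [map_add, h, h']; abel
  | tmul f x => simp only [sandwich_tmul, LinearMap.add_comp, TensorProduct.add_tmul]

theorem sandwich_add_right (g : Y →ₗ[k] Y') (h h' : X' →ₗ[k] X) (t : Pre Z X Y) :
    sandwich g (h + h') t = sandwich g h t + sandwich g h' t := by
  induction t using TensorProduct.induction_on with
  | zero => simp
  | add a a' h h' => simp only [map_add, h, h']; abel
  | tmul f x => simp only [sandwich_tmul, LinearMap.comp_add, TensorProduct.add_tmul]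

@[simp] theorem sandwich_zero_left (h : X' →ₗ[k] X) (t : Pre Z X Y) :
    sandwich (0 : Y →ₗ[k] Y') h t = 0 := by
  have := sandwich_add_left (0 : Y →ₗ[k] Y') 0 h t
  rw [add_zero] at this
  exact left_eq_add.mp this

@[simp] theorem sandwich_zero_right (g : Y →ₗ[k] Y') (t : Pre Z X Y) :
    sandwich g (0 : X' →ₗ[k] X) t = 0 := by
  have := sandwich_add_right g (0 : X' →ₗ[k] X) 0 t
  rw [add_zero] at this
  exact left_eq_add.mp this

/-- Composition with linear maps, expressed through words of length zero. -/
theorem toWord_sandwich (g : Y →ₗ[k] Y') (h : X' →ₗ[k] X) (t : Pre Z X Y) :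
    toWord X' Y' (sandwich g h t) = hat g ⋄ toWord X Y t ⋄ hat h := by
  induction t using TensorProduct.induction_on with
  | zero => simp
  | add a a' h h' => simp only [map_add, LinearMap.add_apply, h, h']
  | tmul f x =>
    simp only [sandwich_tmul, toWord, LinearMap.lTensor_tmul, hat, wcomp_tmul, mul_one, one_mul]

theorem bAd_tmul (A : BAlgebra k P Z) (f : X →ₗ[k] Y) (x : TensorAlgebra k Z) :
    bAd A X Y (f ⊗ₜ x) = f ⊗ₜ bBar A x := rfl

theorem bAd_hat_hat (A : BAlgebra k P Z) (g : Y →ₗ[k] Y') (h : X' →ₗ[k] X) (t : Word Z X Y) :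
    bAd A X' Y' (hat g ⋄ t ⋄ hat h) = sandwich g h (bAd A X Y t) := by
  induction t using TensorProduct.induction_on with
  | zero => simp
  | add a a' h h' => simp only [map_add, LinearMap.add_apply, h, h']
  | tmul f x =>
    simp only [bAd_tmul, sandwich_tmul, hat, wcomp_tmul, mul_one, one_mul]

/-! ### The geometric series of a twisting element -/

/-- The recursion for `δ^{⊗n}` with the new factor on the right. -/
theorem wpow_succ_right (δ : Pre Z X X) (n : ℕ) :
    wpow δ (n + 1) = wpow δ n ⋄ toWord X X δ := by
  induction n with
  | zero =>
    change toWord X X δ ⋄ hat LinearMap.id = hat LinearMap.id ⋄ toWord X X δ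
    rw [hat_id_wcomp, wcomp_hat_id]
  | succ n ih =>
    calc toWord X X δ ⋄ wpow δ (n + 1) = toWord X X δ ⋄ wpow δ n ⋄ toWord X X δ := by rw [ih]
      _ = (toWord X X δ ⋄ wpow δ n) ⋄ toWord X X δ := (wcomp_assoc _ _ _).symm

/-- `δ` is nilpotent in the category of words, so that `geom δ` is a finite sum. -/
def IsNil (δ : Pre Z X X) : Prop := ∃ N, wpow δ N = 0

theorem wpow_eq_zero_of_le (δ : Pre Z X X) {m n : ℕ} (h : wpow δ m = 0) (hmn : m ≤ n) :
    wpow δ n = 0 := by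
  induction n, hmn using Nat.le_induction with
  | base => exact h
  | succ n _ ih =>
    change toWord X X δ ⋄ wpow δ n = 0
    rw [ih, map_zero]

theorem geom_eq_sum (δ : Pre Z X X) {N : ℕ} (h : wpow δ N = 0) :
    geom δ = ∑ n ∈ Finset.range N, wpow δ n := by
  refine finsum_eq_sum_of_support_subset _ fun n hn => ?_
  rw [Finset.coe_range, Set.mem_Iio]
  by_contra hlt
  exact hn (wpow_eq_zero_of_le δ h (not_lt.mp hlt))

/-- With `geom_eq_right`: the geometric series is a two-sided inverse of `1 - δ`. -/
theorem geom_eq_left {δ : Pre Z X X} (h : IsNil δ) :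
    geom δ = hat LinearMap.id + toWord X X δ ⋄ geom δ := by
  obtain ⟨N, hN⟩ := h
  have h1 := geom_eq_sum δ (wpow_eq_zero_of_le δ hN N.le_succ)
  rw [Finset.sum_range_succ'] at h1
  nth_rewrite 2 [geom_eq_sum δ hN]
  rw [h1, add_comm, map_sum]
  rfl

theorem geom_eq_right {δ : Pre Z X X} (h : IsNil δ) :
    geom δ = hat LinearMap.id + geom δ ⋄ toWord X X δ := by
  obtain ⟨N, hN⟩ := h
  have h1 := geom_eq_sum δ (wpow_eq_zero_of_le δ hN N.le_succ)
  rw [Finset.sum_range_succ'] at h1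
  nth_rewrite 2 [geom_eq_sum δ hN]
  rw [h1, add_comm, map_sum, LinearMap.sum_apply]
  refine congrArg₂ _ rfl (Finset.sum_congr rfl fun n _ => wpow_succ_right δ n)

/-- The geometric series intertwines every linear map which intertwines the twisting elements. -/
theorem geom_wcomp_hat {δ : Pre Z X X} {δ' : Pre Z Y Y} (h : IsNil δ) (h' : IsNil δ')
    (g : X →ₗ[k] Y) (hg : sandwich LinearMap.id g δ' = sandwich g LinearMap.id δ) :
    geom δ' ⋄ hat g = hat g ⋄ geom δ := by
  have hw : toWord Y Y δ' ⋄ hat g = hat g ⋄ toWord X X δ := by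
    have := congrArg (toWord X Y) hg
    rwa [toWord_sandwich, toWord_sandwich, wcomp_hat_id, hat_id_wcomp] at this
  obtain ⟨N, hN⟩ := h
  obtain ⟨N', hN'⟩ := h'
  rw [geom_eq_sum δ (wpow_eq_zero_of_le δ hN (le_max_left N N')),
    geom_eq_sum δ' (wpow_eq_zero_of_le δ' hN' (le_max_right N N')), map_sum, map_sum,
    LinearMap.sum_apply]
  refine Finset.sum_congr rfl fun n hn => ?_
  clear hn
  induction n with
  | zero =>
    change hat LinearMap.id ⋄ hat g = hat g ⋄ hat LinearMap.id
    rw [hat_id_wcomp, wcomp_hat_id]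
  | succ n ih =>
    change (toWord Y Y δ' ⋄ wpow δ' n) ⋄ hat g = hat g ⋄ toWord X X δ ⋄ wpow δ n
    rw [wcomp_assoc, ih, ← wcomp_assoc, hw, wcomp_assoc]

/-- A twisting element which lowers a finite filtration is nilpotent. -/
theorem isNil_of_mem_range_lowering {δ : Pre Z X X} {n : ℕ} {F : ℕ → Submodule k X}
    (h0 : F 0 = ⊥) (hn : F n = ⊤)
    (h : δ ∈ LinearMap.range (LinearMap.rTensor Z (lowering F n).subtype)) : IsNil δ := by
  -- the `i`-th power is spanned by words whose linear map sends `F n` into `F (n - i)`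
  have key : ∀ i ≤ n, wpow δ i ∈ Submodule.span k
      {t : Word Z X X | ∃ (f : X →ₗ[k] X) (x : TensorAlgebra k Z),
        (∀ y, f y ∈ F (n - i)) ∧ t = f ⊗ₜ x} := by
    intro i
    induction i with
    | zero =>
      intro _
      exact Submodule.subset_span ⟨LinearMap.id, 1, fun y => by simp [hn], rfl⟩
    | succ i ih =>
      intro hi
      obtain ⟨s, rfl⟩ := h
      change toWord X X _ ⋄ wpow _ i ∈ _
      have hw := ih (by omega)
      generalize wpow ((LinearMap.rTensor Z (lowering F n).subtype) s) i = v at hw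
      induction hw using Submodule.span_induction with
      | zero => rw [map_zero]; exact Submodule.zero_mem _
      | add a b _ _ ha hb => rw [map_add]; exact Submodule.add_mem _ ha hb
      | smul c a _ ha => rw [map_smul]; exact Submodule.smul_mem _ _ ha
      | mem v hv =>
        obtain ⟨f, x, hf, rfl⟩ := hv
        clear ih
        induction s with
        | zero => simp
        | add a b ha hb =>
          rw [map_add, map_add, map_add, LinearMap.add_apply]
          refine Submodule.add_mem _ ?_ ?_ <;> assumption
        | tmul g a =>
          refine Submodule.subset_span ⟨g.1 ∘ₗ f, TensorAlgebra.ι k a * x, fun y => ?_, rfl⟩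
          refine g.2 (n - (i + 1)) (by omega) _ ?_
          have : n - (i + 1) + 1 = n - i := by omega
          rw [this]
          exact hf y
  refine ⟨n, (Submodule.mem_bot k).mp (Submodule.span_le.mpr ?_ (key n le_rfl))⟩
  rintro _ ⟨f, x, hf, rfl⟩
  have : f = 0 := LinearMap.ext fun y => by
    have := hf y
    rw [Nat.sub_self, h0] at this
    exact this
  simp [this]

theorem IsTw.isNil {A : BAlgebra k P Z} {E : TwPair.{w} k P Z} (h : IsTw A E) : IsNil E.δ := by
  obtain ⟨-, ⟨n, F, h0, hn, -, -, h⟩, -⟩ := h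
  exact isNil_of_mem_range_lowering h0 hn h

end Words

/-! ### Multilinear operations on directed elements -/

section Directed

variable {k : Type uk} [Field k] {P : Type uP} {Z : Type uZ} [AddCommGroup Z] [Module k Z]

/-- A multilinear map which vanishes on the tuples from given sets vanishes on the tuples from
their spans. -/
theorem multilinear_eq_zero_of_mem_span {M : Type*} [AddCommGroup M] [Module k M] {n : ℕ}
    (g : MultilinearMap k (fun _ : Fin n => Z) M) (S : Fin n → Set Z)
    (h : ∀ a, (∀ j, a j ∈ S j) → g a = 0) (a : Fin n → Z)
    (ha : ∀ j, a j ∈ Submodule.span k (S j)) : g a = 0 := by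
  have key : ∀ (s : Finset (Fin n)) (a : Fin n → Z), (∀ j ∈ s, a j ∈ Submodule.span k (S j)) →
      (∀ j ∉ s, a j ∈ S j) → g a = 0 := by
    intro s
    induction s using Finset.induction_on with
    | empty => exact fun a _ h' => h a fun j => h' j (Finset.notMem_empty j)
    | insert i s hi ih =>
      intro a h1 h2
      have : ∀ z ∈ Submodule.span k (S i), g (Function.update a i z) = 0 := by
        intro z hz
        induction hz using Submodule.span_induction with
        | zero => exact g.map_update_zero a i
        | add x y _ _ hx hy => rw [g.map_update_add, hx, hy, add_zero]
        | smul c x _ hx => rw [g.map_update_smul, hx, smul_zero]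
        | mem z hz =>
          refine ih _ (fun j hj => ?_) fun j hj => ?_
          · rw [Function.update_of_ne (ne_of_mem_of_not_mem hj hi)]
            exact h1 j (Finset.mem_insert_of_mem hj)
          · rcases eq_or_ne j i with rfl | hne
            · rwa [Function.update_self]
            · rw [Function.update_of_ne hne]
              exact h2 j (by simp [hne, hj])
      have h3 := this (a i) (h1 i (Finset.mem_insert_self i s))
      rwa [Function.update_eq_self] at h3
  exact key Finset.univ a (fun j _ => ha j) fun j hj => absurd (Finset.mem_univ j) hj

/-- An element belongs to a subspace as soon as all its components `e_u x` do. -/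
theorem IsUnitaryAction.mem_of_forall {M : Type*} [AddCommGroup M] [Module k M]
    {e : P → Module.End k M} (he : IsUnitaryAction e) (N : Submodule k M) {x : M}
    (h : ∀ u, e u x ∈ N) : x ∈ N := by
  rw [← he.sum x]
  exact finsum_induction (· ∈ N) N.zero_mem (fun _ _ => N.add_mem) h

theorem GradedBimodule.directed_lact_ract (A : GradedBimodule k P Z) (v u : P) (a : Z) :
    A.Directed v u (A.lact v (A.ract u a)) :=
  ⟨A.lact_unitary.idem v _, by rw [← A.lact_ract, A.ract_unitary.idem]⟩

theorem GradedBimodule.gr_le_span_directed (A : GradedBimodule k P Z) (q : ℤ) :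
    A.gr q ≤ Submodule.span k {a | a ∈ A.gr q ∧ ∃ v u, A.Directed v u a} := fun a ha =>
  A.ract_unitary.mem_of_forall _ fun u => A.lact_unitary.mem_of_forall _ fun v =>
    Submodule.subset_span
      ⟨A.lact_gr v q _ (A.ract_gr u q a ha), v, u, A.directed_lact_ract v u a⟩

theorem GradedBimodule.mem_span_directed (A : GradedBimodule k P Z) (a : Z) :
    a ∈ Submodule.span k {a | ∃ q, a ∈ A.gr q ∧ ∃ v u, A.Directed v u a} := by
  have h : (⊤ : Submodule k Z) ≤
      Submodule.span k {a | ∃ q, a ∈ A.gr q ∧ ∃ v u, A.Directed v u a} :=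
    A.gr_internal.submodule_iSup_eq_top.ge.trans
    (iSup_le fun q => (A.gr_le_span_directed q).trans
      (Submodule.span_mono fun a ha => ⟨q, ha⟩))
  exact h Submodule.mem_top

theorem opList_ofFn (b : ∀ n : ℕ, MultilinearMap k (fun _ : Fin n => Z) Z) {n : ℕ}
    (a : Fin n → Z) : opList b (List.ofFn a) = b n a := by
  have : ∀ (m : ℕ) (h : m = n) (x : Fin m → Z), (∀ i, x i = a (Fin.cast h i)) →
      b m x = b n a := by
    rintro m rfl x hx
    exact congrArg _ (funext hx)
  exact this _ List.length_ofFn _ fun i => by simp [Fin.cast]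

theorem opList_append_zero_cons (b : ∀ n : ℕ, MultilinearMap k (fun _ : Fin n => Z) Z)
    (l l' : List Z) : opList b (l ++ 0 :: l') = 0 :=
  (b _).map_coord_zero ⟨l.length, by simp⟩ (by simp)

/-- The operations vanish on sequences of directed elements which are not composable. -/
theorem BAlgebra.b_eq_zero_of_not_composable (A : BAlgebra k P Z) {n : ℕ} (a : Fin n → Z)
    {i : ℕ} (hi : i + 1 < n) {u v : P} (huv : u ≠ v)
    (hu : A.ract u (a ⟨i, by omega⟩) = a ⟨i, by omega⟩)
    (hv : A.lact v (a ⟨i + 1, hi⟩) = a ⟨i + 1, hi⟩) : A.b n a = 0 := by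
  have hl : List.ofFn a = (List.ofFn a).take i ++
      a ⟨i, by omega⟩ :: a ⟨i + 1, hi⟩ :: (List.ofFn a).drop (i + 2) := by
    conv_lhs => rw [← List.take_append_drop i (List.ofFn a)]
    rw [List.drop_eq_getElem_cons (by simp; omega),
      List.drop_eq_getElem_cons (i := i + 1) (by simp; omega)]
    simp
  rw [← opList_ofFn A.b a, hl, ← hu, A.b_balanced, ← hv, A.lact_unitary.orth u v huv]
  have := opList_append_zero_cons A.b ((List.ofFn a).take i ++ [a ⟨i, by omega⟩])
    ((List.ofFn a).drop (i + 2))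
  rwa [List.append_assoc] at this

/-- A nonempty sequence of directed elements is composable, or there are two neighbours which are
not. -/
theorem GradedBimodule.exists_chain_or (A : GradedBimodule k P Z) {n : ℕ} (hn : n ≠ 0)
    (a : Fin n → Z) (ha : ∀ j, ∃ v u, A.Directed v u (a j)) :
    (∃ x : Fin (n + 1) → P, ∀ j, A.Directed (x j.castSucc) (x j.succ) (a j)) ∨
    ∃ (i : ℕ) (hi : i + 1 < n) (v u v' u' : P), A.Directed v u (a ⟨i, by omega⟩) ∧
      A.Directed v' u' (a ⟨i + 1, hi⟩) ∧ u ≠ v' := by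
  choose v u h using ha
  by_cases hc : ∀ (i : ℕ) (hi : i + 1 < n), u ⟨i, by omega⟩ = v ⟨i + 1, hi⟩
  · left
    obtain ⟨m, rfl⟩ := Nat.exists_eq_succ_of_ne_zero hn
    refine ⟨Fin.cons (v 0) u, fun j => ?_⟩
    have h1 : (Fin.cons (v 0) u : Fin (m + 2) → P) j.castSucc = v j := by
      rcases Fin.eq_zero_or_eq_succ j with rfl | ⟨j, rfl⟩
      · rfl
      · rw [← Fin.succ_castSucc, Fin.cons_succ]
        exact hc j (by omega)
    rw [h1, Fin.cons_succ]
    exact h j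
  · right
    push Not at hc
    obtain ⟨i, hi, hne⟩ := hc
    exact ⟨i, hi, _, _, _, _, h _, h _, hne⟩

/-- A strict unit annihilates all operations except the binary one, on arbitrary arguments. -/
theorem UnitaryBNuAlgebra.b_eq_zero_of_unit (A : UnitaryBNuAlgebra k P Z) {n : ℕ} (hn : n ≠ 2)
    (a : Fin n → Z) (i : Fin n) (u : P) (hi : a i = A.unit u) : A.b n a = 0 := by
  have hdir : A.Directed u u (A.unit u) := by
    have := A.directed_lact_ract u u (A.unit u)
    rwa [A.unit_directed] at this
  refine multilinear_eq_zero_of_mem_span (A.b n)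
    (fun j => {z | (∃ v u, A.Directed v u z) ∧ (j = i → z = A.unit u)}) ?_ a fun j => ?_
  · intro a ha
    rcases A.exists_chain_or (by rintro rfl; exact i.elim0) a (fun j => (ha j).1) with
      ⟨x, hx⟩ | ⟨i, hi, v, u, v', u', h, h', hne⟩
    · exact A.unit_strict u n hn x a hx ⟨i, (ha i).2 rfl⟩
    · exact A.b_eq_zero_of_not_composable a hi hne h.2 h'.1
  · by_cases hj : j = i
    · exact Submodule.subset_span ⟨hj ▸ hi ▸ ⟨u, u, hdir⟩, fun _ => hj ▸ hi⟩
    · refine Submodule.span_mono ?_ (A.mem_span_directed (a j))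
      rintro z ⟨q, -, h⟩
      exact ⟨h, fun h' => absurd h' hj⟩

end Directed

/-! ### Translation of the operations -/

section Translation

variable {k : Type uk} [Field k] {P : Type uP} {Z : Type uZ} [AddCommGroup Z] [Module k Z]

/-- The automorphism `f` of `Z` is homogeneous of degree `q` and semilinear for the actions, with
respect to the permutations `π` (left) and `π'` (right) of the idempotents. -/
structure GradedBimodule.Semilinear (A : GradedBimodule k P Z) (f : Z ≃ₗ[k] Z)
    (π π' : Equiv.Perm P) (q : ℤ) : Prop where
  lact : ∀ u a, f (A.lact u a) = A.lact (π u) (f a)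
  ract : ∀ u a, f (A.ract u a) = A.ract (π' u) (f a)
  gr : ∀ p, ∀ a ∈ A.gr p, f a ∈ A.gr (p + q)

namespace GradedBimodule.Semilinear

variable {A : GradedBimodule k P Z} {f g : Z ≃ₗ[k] Z} {π π' σ σ' : Equiv.Perm P} {q r : ℤ}

theorem one : A.Semilinear 1 1 1 0 :=
  ⟨fun _ _ => rfl, fun _ _ => rfl, fun p a h => by rwa [add_zero]⟩

theorem mul (hf : A.Semilinear f π π' q) (hg : A.Semilinear g σ σ' r) :
    A.Semilinear (f * g) (π * σ) (π' * σ') (q + r) where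
  lact u a := by simp only [LinearEquiv.mul_apply, hg.lact, hf.lact, Equiv.Perm.mul_apply]
  ract u a := by simp only [LinearEquiv.mul_apply, hg.ract, hf.ract, Equiv.Perm.mul_apply]
  gr p a h := by
    have := hf.gr _ _ (hg.gr p a h)
    rwa [add_assoc, add_comm r q] at this

/-- The inverse is homogeneous as well, because `Z` is the direct sum of its components. -/
theorem inv (hf : A.Semilinear f π π' q) : A.Semilinear f⁻¹ π⁻¹ π'⁻¹ (-q) where
  lact u a := by
    apply f.injective
    rw [hf.lact, ← LinearEquiv.mul_apply, ← LinearEquiv.mul_apply, mul_inv_cancel]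
    simp
  ract u a := by
    apply f.injective
    rw [hf.ract, ← LinearEquiv.mul_apply, ← LinearEquiv.mul_apply, mul_inv_cancel]
    simp
  gr p a h := by
    -- the components of `f⁻¹ a` in the other degrees have image zero by independence
    obtain ⟨b, rfl⟩ := f.surjective a
    rw [← LinearEquiv.mul_apply, inv_mul_cancel]
    change b ∈ _
    have htop : A.gr (p + -q) ⊔ ⨆ (r) (_ : r ≠ p + -q), A.gr r = ⊤ := by
      rw [← A.gr_internal.submodule_iSup_eq_top]
      exact le_antisymm (sup_le (le_iSup _ _) (iSup₂_le fun r _ => le_iSup _ r))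
        (iSup_le fun r => by
          by_cases hr : r = p + -q
          · exact hr ▸ le_sup_left
          · exact (le_iSup₂ (f := fun r (_ : r ≠ p + -q) => A.gr r) r hr).trans le_sup_right)
    obtain ⟨b₁, hb₁, c, hc, rfl⟩ := Submodule.mem_sup.mp (htop.ge (Submodule.mem_top (x := b)))
    have h1 : f b₁ ∈ A.gr p := by
      have := hf.gr _ _ hb₁
      rwa [neg_add_cancel_right] at this
    have h2 : f c ∈ A.gr p := by
      have := (A.gr p).sub_mem h h1
      rwa [map_add, add_sub_cancel_left] at this
    have h3 : (⨆ (r) (_ : r ≠ p + -q), A.gr r) ≤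
        (⨆ (r) (_ : r ≠ p), A.gr r).comap f.toLinearMap :=
      iSup₂_le fun r hr a ha => by
        refine (le_iSup₂ (f := fun r (_ : r ≠ p) => A.gr r) (r + q) ?_) (hf.gr r a ha)
        exact fun h => hr (by omega)
    have h4 : f c = 0 :=
      Submodule.disjoint_def.mp (A.gr_internal.submodule_iSupIndep p) _ h2 (h3 hc)
    rw [(LinearEquiv.map_eq_zero_iff f).mp h4, add_zero]
    exact hb₁

theorem zpow (hf : A.Semilinear f π π' q) (n : ℤ) :
    A.Semilinear (f ^ n) (π ^ n) (π' ^ n) (n * q) := by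
  induction n using Int.induction_on with
  | zero => simpa using one
  | succ n ih =>
    have := ih.mul hf
    rwa [← zpow_add_one, ← zpow_add_one, ← zpow_add_one, ← add_one_mul] at this
  | pred n ih =>
    have := ih.mul hf.inv
    rwa [← zpow_sub_one, ← zpow_sub_one, ← zpow_sub_one, ← sub_eq_add_neg, ← sub_one_mul] at this

theorem directed (hf : A.Semilinear f π π' q) {v u : P} {a : Z} (h : A.Directed v u a) :
    A.Directed (π v) (π' u) (f a) :=
  ⟨by rw [← hf.lact, h.1], by rw [← hf.ract, h.2]⟩

end GradedBimodule.Semilinear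

namespace BNuAlgebra

variable (A : BNuAlgebra k P Z)

/-- The map `a ↦ ν^{-s} a ν^t`. -/
abbrev tr (s t : ℤ) : Z ≃ₗ[k] Z := rho A.νL A.νR s t

theorem tr_eq (s t : ℤ) : A.tr s t = A.νL ^ (-s) * A.νR ^ t := rfl

theorem semilinear_tr (s t : ℤ) :
    A.Semilinear (A.tr s t) (A.ν ^ (-s)) (A.ν ^ (-t)) (s - t) := by
  have hL : A.Semilinear A.νL A.ν 1 (-1) := ⟨A.νL_lact, A.νL_ract, A.νL_gr⟩
  have hR : A.Semilinear A.νR 1 A.ν⁻¹ (-1) := ⟨A.νR_lact, A.νR_ract, A.νR_gr⟩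
  have := (hL.zpow (-s)).mul (hR.zpow t)
  simp only [one_zpow, mul_one, one_mul] at this
  rw [inv_zpow'] at this
  rwa [show -s * -1 + t * -1 = s - t by ring] at this

theorem tr_tr (s t s' t' : ℤ) (a : Z) : A.tr s t (A.tr s' t' a) = A.tr (s + s') (t + t') a := by
  have hc : Commute A.νL A.νR := LinearEquiv.ext fun a => (A.νL_νR a).symm
  rw [← LinearEquiv.mul_apply]
  refine LinearEquiv.congr_fun (?_ : A.tr s t * A.tr s' t' = A.tr (s + s') (t + t')) a
  rw [tr_eq, tr_eq, tr_eq, mul_assoc, ← mul_assoc (A.νR ^ t),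
    ← (hc.zpow_zpow (-s') t).eq, neg_add, zpow_add, zpow_add]
  simp only [mul_assoc]

@[simp] theorem tr_zero (a : Z) : A.tr 0 0 a = a := rfl

theorem tr_symm (s t : ℤ) (a : Z) : (A.tr s t).symm a = A.tr (-s) (-t) a := by
  rw [LinearEquiv.symm_apply_eq, tr_tr, add_neg_cancel, add_neg_cancel, tr_zero]

theorem mem_layer_level (u : P) : u ∈ layer A.ν A.P₀ (A.level u) :=
  (A.level_eq_iff u _).mp rfl

theorem level_zpow (n : ℤ) (u : P) : A.level ((A.ν ^ n) u) = n + A.level u := by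
  obtain ⟨p, hp, h⟩ := A.mem_layer_level u
  refine (A.level_eq_iff _ _).mpr ⟨p, hp, ?_⟩
  rw [zpow_add, Equiv.Perm.mul_apply, h]

theorem mem_block {v u : P} {a : Z} (h : A.Directed v u a) :
    a ∈ A.block A.ν A.P₀ (A.level v) (A.level u) := by
  refine Submodule.mem_iSup_of_mem v (Submodule.mem_iSup_of_mem (A.mem_layer_level v)
    (Submodule.mem_iSup_of_mem u (Submodule.mem_iSup_of_mem (A.mem_layer_level u) ⟨a, ?_⟩)))
  rw [LinearMap.comp_apply, h.2, h.1]

/-- The operations on composable homogeneous sequences commute up to an explicit sign with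
`a_i ↦ ν^{-c_{i-1}} a_i ν^{c_i}`. Both sides are reduced by the translation rule to the value on
elements between idempotents in `P₀`. -/
theorem b_tr {n : ℕ} (c : Fin (n + 1) → ℤ) (x : Fin (n + 1) → P) (d : Fin n → ℤ) (a : Fin n → Z)
    (hx : ∀ i, A.Directed (x i.castSucc) (x i.succ) (a i)) (hd : ∀ i, a i ∈ A.gr (d i)) :
    A.b n (fun i => A.tr (c i.castSucc) (c i.succ) (a i)) =
      (c 0 - c (Fin.last n) +
        ∑ i, ((A.level (x i.succ) - A.level (x (Fin.last n))) * d i +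
          (A.level (x i.succ) - A.level (x (Fin.last n)) - (c i.succ - c (Fin.last n))) *
            (d i + c i.castSucc - c i.succ))).negOnePow •
        A.tr (c 0) (c (Fin.last n)) (A.b n a) := by
  have h1 := A.b_translation n (fun i => A.level (x i)) d a (fun i => A.mem_block (hx i)) hd
  have h2 := A.b_translation n (fun i => A.level (x i) - c i)
    (fun i => d i + c i.castSucc - c i.succ)
    (fun i => A.tr (c i.castSucc) (c i.succ) (a i))
    (fun i => by
      have := A.mem_block ((A.semilinear_tr (c i.castSucc) (c i.succ)).directed (hx i))
      rwa [level_zpow, level_zpow, neg_add_eq_sub, neg_add_eq_sub] at this)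
    (fun i => by
      have := (A.semilinear_tr (c i.castSucc) (c i.succ)).gr _ _ (hd i)
      rwa [← add_sub_assoc] at this)
  have h3 : (fun i : Fin n => rho A.νL A.νR (A.level (x i.castSucc) - c i.castSucc)
      (A.level (x i.succ) - c i.succ) (A.tr (c i.castSucc) (c i.succ) (a i))) =
      fun i => A.tr (A.level (x i.castSucc)) (A.level (x i.succ)) (a i) := by
    funext i
    rw [tr_tr, sub_add_cancel, sub_add_cancel]
  rw [h3] at h2
  rw [h1, h2, tr_symm, tr_symm]
  rw [Units.smul_def, Units.smul_def, Units.smul_def, map_zsmul, tr_tr, smul_smul]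
  rw [← Units.val_mul, ← Int.negOnePow_add]
  refine congrArg₂ (fun (e : ℤˣ) (z : Z) => (e : ℤ) • z) ((Int.negOnePow_eq_iff _ _).mpr ?_) ?_
  · refine even_iff_two_dvd.mpr ⟨-(c 0 - c (Fin.last n)) -
      ∑ i : Fin n, (A.level (x i.succ) - A.level (x (Fin.last n))) * d i, ?_⟩
    rw [Finset.sum_add_distrib]
    have : ∀ i : Fin n, A.level (x i.succ) - c i.succ - (A.level (x (Fin.last n)) -
        c (Fin.last n)) = A.level (x i.succ) - A.level (x (Fin.last n)) -
        (c i.succ - c (Fin.last n)) := fun i => by ring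
    simp only [this]
    ring
  · rw [neg_sub, neg_sub, ← sub_eq_add_neg, ← sub_eq_add_neg]

end BNuAlgebra

end Translation

/-! ### Conjugation by `ν` and the left translation with signs -/

section Theta

variable {k : Type uk} [Field k] {P : Type uP} {Z : Type uZ} [AddCommGroup Z] [Module k Z]

/-- The right idempotent of a value of `b_n` is that of the last argument. -/
theorem BAlgebra.ract_b (A : BAlgebra k P Z) {n : ℕ} (a : Fin (n + 1) → Z) {u : P}
    (h : A.ract u (a (Fin.last n)) = a (Fin.last n)) : A.ract u (A.b (n + 1) a) = A.b (n + 1) a := by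
  rw [← opList_ofFn A.b a, List.ofFn_succ_last, ← A.b_right, h]

namespace BNuAlgebra

variable (A : BNuAlgebra k P Z)

/-- The conjugation `a ↦ ν a ν⁻¹` commutes with all operations, on arbitrary arguments: it moves
all layers by one, which does not change the sign. -/
theorem b_conj (n : ℕ) (a : Fin n → Z) :
    A.b n (fun i => A.tr (-1) (-1) (a i)) = A.tr (-1) (-1) (A.b n a) := by
  rcases eq_or_ne n 0 with rfl | hn
  · rw [A.b_zero]; simp
  have key := multilinear_eq_zero_of_mem_span
    ((A.b n).compLinearMap (fun _ => (A.tr (-1) (-1)).toLinearMap) -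
      (A.tr (-1) (-1)).toLinearMap.compMultilinearMap (A.b n))
    (fun _ => {a | ∃ q, a ∈ A.gr q ∧ ∃ v u, A.Directed v u a}) ?_ a
    (fun j => A.mem_span_directed (a j))
  · exact sub_eq_zero.mp key
  intro a ha
  refine sub_eq_zero.mpr ?_
  change A.b n (fun i => A.tr (-1) (-1) (a i)) = A.tr (-1) (-1) (A.b n a)
  choose d hd hdir using ha
  rcases A.exists_chain_or hn a hdir with ⟨x, hx⟩ | ⟨i, hi, v, u, v', u', h, h', hne⟩
  · rw [A.b_tr (fun _ => -1) x d a hx hd, Int.negOnePow_even, one_smul]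
    refine ⟨∑ i : Fin n, (A.level (x i.succ) - A.level (x (Fin.last n))) * d i, ?_⟩
    rw [sub_self, zero_add, ← Finset.sum_add_distrib]
    exact Finset.sum_congr rfl fun i _ => by ring
  · have hs := A.semilinear_tr (-1) (-1)
    rw [A.b_eq_zero_of_not_composable a hi hne h.2 h'.1, map_zero,
      A.b_eq_zero_of_not_composable _ hi ((A.ν ^ (- -1 : ℤ)).injective.ne hne)
        (hs.directed h).2 (hs.directed h').1]

/-- The involution `a ↦ ∑_v (-1)^{s(v)} a e_v`, where `v ∈ P_{s(v)}`. -/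
def eps : Z →ₗ[k] Z where
  toFun a := ∑ᶠ v, (A.level v).negOnePow • A.ract v a
  map_add' a b := by
    simp only [map_add, smul_add]
    refine finsum_add_distrib ((A.ract_unitary.finite a).subset ?_)
      ((A.ract_unitary.finite b).subset ?_) <;>
    · intro v hv h
      exact hv (by simp [h])
  map_smul' c a := by
    simp only [map_smul, RingHom.id_apply]
    rw [smul_finsum]
    exact finsum_congr fun v => smul_comm _ _ _

theorem eps_apply {u : P} {a : Z} (h : A.ract u a = a) :
    A.eps a = (A.level u).negOnePow • a := by
  change ∑ᶠ v, (A.level v).negOnePow • A.ract v a = _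
  rw [finsum_eq_single _ u, h]
  intro v hv
  rw [← h, A.ract_unitary.orth v u hv, smul_zero]

theorem negOnePow_smul_self (n : ℤ) (a : Z) : n.negOnePow • n.negOnePow • a = a := by
  rw [smul_smul, ← Int.negOnePow_add, Int.negOnePow_even _ ⟨n, rfl⟩, one_smul]

theorem eps_eps (a : Z) : A.eps (A.eps a) = a := by
  have h := A.mem_span_directed a
  induction h using Submodule.span_induction with
  | zero => simp
  | add x y _ _ hx hy => rw [map_add, map_add, hx, hy]
  | smul c x _ hx => rw [map_smul, map_smul, hx]
  | mem a h =>
    obtain ⟨q, -, v, u, h⟩ := h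
    rw [A.eps_apply h.2, Units.smul_def, map_zsmul, A.eps_apply h.2, ← Units.smul_def,
      negOnePow_smul_self]

/-- The map `a ↦ ∑_v (-1)^{s(v)} ν⁻¹ a e_v`, where `v ∈ P_{s(v)}`; it describes the composition
with `τ_X`. -/
def theta : Z ≃ₗ[k] Z :=
  (LinearEquiv.ofInvolutive A.eps A.eps_eps).trans A.νL.symm

theorem theta_apply {u : P} {a : Z} (h : A.ract u a = a) :
    A.theta a = (A.level u).negOnePow • A.tr 1 0 a := by
  change A.νL.symm (A.eps a) = _
  rw [A.eps_apply h, Units.smul_def, map_zsmul]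
  rfl

theorem theta_symm_apply {u : P} {a : Z} (h : A.ract u a = a) :
    A.theta.symm a = (A.level u).negOnePow • A.tr (-1) 0 a := by
  have h1 := ((A.semilinear_tr (-1) 0).ract u a).symm
  rw [h] at h1
  rw [LinearEquiv.symm_apply_eq, Units.smul_def, map_zsmul, A.theta_apply h1, tr_tr]
  exact (negOnePow_smul_self (A.level u) a).symm

theorem theta_directed {v u : P} {a : Z} {q : ℤ} (h : A.Directed v u a) (hq : a ∈ A.gr q) :
    A.Directed (A.ν⁻¹ v) u (A.theta a) ∧ A.theta a ∈ A.gr (q + 1) := by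
  have hs := A.semilinear_tr 1 0
  rw [A.theta_apply h.2, Units.smul_def]
  have h1 := hs.directed h
  refine ⟨⟨?_, ?_⟩, zsmul_mem (hs.gr q a hq) _⟩
  · rw [map_zsmul, ← zpow_neg_one]
    exact congrArg _ h1.1
  · rw [map_zsmul]
    exact congrArg _ h1.2

theorem theta_symm_directed {v u : P} {a : Z} {q : ℤ} (h : A.Directed v u a)
    (hq : a ∈ A.gr q) :
    A.Directed (A.ν v) u (A.theta.symm a) ∧ A.theta.symm a ∈ A.gr (q - 1) := by
  have hs := A.semilinear_tr (-1) 0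
  rw [A.theta_symm_apply h.2, Units.smul_def]
  have h1 := hs.directed h
  refine ⟨⟨?_, ?_⟩, zsmul_mem (hs.gr q a hq) _⟩
  · rw [map_zsmul]
    exact congrArg _ h1.1
  · rw [map_zsmul]
    exact congrArg _ h1.2

/-- The operation `theta` anticommutes with the operations if the letters to the left of its argument are
conjugated by `ν` and all other letters have degree zero. -/
theorem b_theta {n : ℕ} (i : Fin n) (a : Fin n → Z) (ha : ∀ j, j ≠ i → a j ∈ A.gr 0) :
    A.b n (fun j => if j = i then A.theta (a j) else a j) =
      -A.theta (A.b n fun j => if j < i then A.tr (-1) (-1) (a j) else a j) := by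
  obtain ⟨m, rfl⟩ : ∃ m, n = m + 1 :=
    Nat.exists_eq_succ_of_ne_zero (by rintro rfl; exact i.elim0)
  have e1 : ∀ a : Fin (m + 1) → Z, (fun j => if j = i then A.theta (a j) else a j) =
      fun j => (if j = i then A.theta.toLinearMap else LinearMap.id) (a j) := fun a => by
    funext j; split_ifs <;> rfl
  have e2 : ∀ a : Fin (m + 1) → Z, (fun j => if j < i then A.tr (-1) (-1) (a j) else a j) =
      fun j => (if j < i then (A.tr (-1) (-1)).toLinearMap else LinearMap.id) (a j) := fun a => by
    funext j; split_ifs <;> rfl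
  have key := multilinear_eq_zero_of_mem_span
    ((A.b (m + 1)).compLinearMap
      (fun j => if j = i then A.theta.toLinearMap else LinearMap.id) +
      A.theta.toLinearMap.compMultilinearMap ((A.b (m + 1)).compLinearMap
        (fun j => if j < i then (A.tr (-1) (-1)).toLinearMap else LinearMap.id)))
    (fun j => {a | ∃ q, a ∈ A.gr q ∧ (∃ v u, A.Directed v u a) ∧ (j ≠ i → q = 0)}) ?_ a
    (fun j => ?_)
  · rw [e1, e2]
    exact eq_neg_of_add_eq_zero_left key
  · intro a ha
    refine (?_ : A.b (m + 1) (fun j => _) + A.theta (A.b (m + 1) fun j => _) = 0)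
    rw [← e1, ← e2]
    choose d hd hdir h0 using ha
    -- with `a' = (a_1, …, ν⁻¹ a_i, …, a_n)` both sides are signed translates of `b_n(a')`
    set a' : Fin (m + 1) → Z := Function.update a i (A.tr 1 0 (a i)) with ha'
    have hdir' : ∀ j, ∃ v u, A.Directed v u (a' j) := by
      intro j
      rcases eq_or_ne j i with rfl | hj
      · obtain ⟨v, u, h⟩ := hdir j
        rw [ha', Function.update_self]
        exact ⟨_, _, (A.semilinear_tr 1 0).directed h⟩
      · rw [ha', Function.update_of_ne hj]
        exact hdir j
    set c : Fin (m + 2) → ℤ := fun j => if (j : ℕ) ≤ i then -1 else 0 with hc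
    have hca : (fun j => if j < i then A.tr (-1) (-1) (a j) else a j) =
        fun j => A.tr (c j.castSucc) (c j.succ) (a' j) := by
      funext j
      rcases lt_trichotomy j i with hj | rfl | hj
      · have h1 : (j : ℕ) < i := hj
        have h2 : c j.castSucc = -1 := if_pos h1.le
        have h3 : c j.succ = -1 := if_pos h1
        rw [if_pos hj, h2, h3, ha', Function.update_of_ne hj.ne]
      · have h2 : c j.castSucc = -1 := if_pos le_rfl
        have h3 : c j.succ = 0 := if_neg (by simp)
        rw [if_neg (lt_irrefl j), h2, h3, ha', Function.update_self, tr_tr]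
        rfl
      · have h1 : (i : ℕ) < j := hj
        have h2 : c j.castSucc = 0 := if_neg (not_le.mpr h1)
        have h3 : c j.succ = 0 := if_neg (not_le.mpr (Nat.lt_succ_of_lt h1))
        rw [if_neg hj.not_gt, h2, h3, ha', Function.update_of_ne hj.ne', tr_zero]
    have hlhs : ∀ u, A.ract u (a i) = a i →
        A.b (m + 1) (fun j => if j = i then A.theta (a j) else a j) =
        (A.level u).negOnePow • A.b (m + 1) a' := by
      intro u hu
      have hth : (fun j => if j = i then A.theta (a j) else a j) =
          Function.update a' i (((A.level u).negOnePow : ℤ) • a' i) := by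
        funext j
        rcases eq_or_ne j i with rfl | hj
        · rw [if_pos rfl, Function.update_self, ha', Function.update_self, A.theta_apply hu]
          rfl
        · rw [if_neg hj, Function.update_of_ne hj, ha', Function.update_of_ne hj]
      rw [hth, ← Int.cast_smul_eq_zsmul k, MultilinearMap.map_update_smul,
        Function.update_eq_self, Int.cast_smul_eq_zsmul]
      rfl
    rw [hca]
    rcases A.exists_chain_or (Nat.succ_ne_zero m) a' hdir' with
      ⟨x, hx⟩ | ⟨l, hl, v₁, u₁, v₂, u₂, h₁, h₂, hne⟩
    · have hu : A.ract (x i.succ) (a i) = a i := by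
        apply (A.tr 1 0).injective
        have := (hx i).2
        rw [ha', Function.update_self] at this
        rw [(A.semilinear_tr 1 0).ract]
        exact this
      have hd' : ∀ j, a' j ∈ A.gr (if j = i then d j + 1 else 0) := by
        intro j
        rcases eq_or_ne j i with rfl | hj
        · rw [if_pos rfl, ha', Function.update_self]
          exact (A.semilinear_tr 1 0).gr _ _ (hd j)
        · rw [if_neg hj, ha', Function.update_of_ne hj, ← h0 j hj]
          exact hd j
      have hc0 : c 0 = -1 := if_pos (Nat.zero_le _)
      have hcn : c (Fin.last (m + 1)) = 0 := if_neg (not_le.mpr i.2)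
      have hw : A.ract (x (Fin.last (m + 1))) (A.b (m + 1) a') = A.b (m + 1) a' :=
        A.ract_b a' (hx (Fin.last m)).2
      have hw' : A.ract (x (Fin.last (m + 1))) (A.tr (-1) 0 (A.b (m + 1) a')) =
          A.tr (-1) 0 (A.b (m + 1) a') := by
        have := (A.semilinear_tr (-1) 0).ract (x (Fin.last (m + 1))) (A.b (m + 1) a')
        rw [hw] at this
        exact this.symm
      rw [hlhs _ hu, A.b_tr c x _ a' hx hd', hc0, hcn, Units.smul_def, Units.smul_def, map_zsmul,
        A.theta_apply hw', tr_tr, Units.smul_def, smul_smul, ← Units.val_mul, ← Int.negOnePow_add,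
        add_neg_cancel, add_zero, tr_zero, ← add_smul, Finset.sum_eq_single i]
      · have hci : c i.castSucc = -1 := if_pos le_rfl
        have hci' : c i.succ = 0 := if_neg (not_le.mpr (Nat.lt_succ_self _))
        rw [hci, hci', if_pos rfl]
        have : ∀ L K e : ℤ, (L.negOnePow : ℤ) +
            ((-1 - 0 + ((L - K) * (e + 1) + (L - K - (0 - 0)) * (e + 1 + -1 - 0)) + K).negOnePow :
              ℤ) = 0 := fun L K e => by
          rw [show -1 - 0 + ((L - K) * (e + 1) + (L - K - (0 - 0)) * (e + 1 + -1 - 0)) + K =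
              (L + 1) + (((L - K) * e - 1) + ((L - K) * e - 1)) by ring, Int.negOnePow_add,
            Int.negOnePow_even _ ⟨_, rfl⟩, mul_one, Int.negOnePow_succ, Units.val_neg,
            add_neg_cancel]
        rw [this, zero_smul]
      · intro j _ hj
        have : c j.castSucc = c j.succ := by
          have h1 : (j : ℕ) ≠ i := fun h => hj (Fin.ext h)
          refine if_congr ?_ rfl rfl
          rw [Fin.val_castSucc, Fin.val_succ]
          omega
        rw [if_neg hj, this]
        ring
      · exact fun h => absurd (Finset.mem_univ i) h
    · obtain ⟨v, u, hvu⟩ := hdir i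
      have h1 := (A.semilinear_tr (c ⟨l, by omega⟩) (c ⟨l + 1, by omega⟩)).directed h₁
      have h2 := (A.semilinear_tr (c ⟨l + 1, by omega⟩) (c ⟨l + 2, by omega⟩)).directed h₂
      rw [hlhs u hvu.2, A.b_eq_zero_of_not_composable a' hl hne h₁.2 h₂.1, smul_zero, zero_add,
        A.b_eq_zero_of_not_composable _ hl ((A.ν ^ (-_ : ℤ)).injective.ne hne) h1.2 h2.1,
        map_zero]
  · by_cases hj : j = i
    · refine Submodule.span_mono ?_ (A.mem_span_directed (a j))
      rintro z ⟨q, hq, h⟩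
      exact ⟨q, hq, h, fun h' => absurd hj h'⟩
    · refine Submodule.span_mono ?_ (A.gr_le_span_directed 0 (ha j hj))
      rintro z ⟨hq, h⟩
      exact ⟨0, hq, h, fun _ => rfl⟩

end BNuAlgebra

end Theta

/-! ### Words with prescribed letters -/

section WordSpan

variable {k : Type uk} [Field k] {P : Type uP} {Z : Type uZ} [AddCommGroup Z] [Module k Z]
variable {X Y W V : FSMod.{w} k P}

local infixr:75 " ⋄ " => wcomp _ _ _

/-- The product of the letters of a list in the tensor algebra. -/
def listProd (l : List Z) : TensorAlgebra k Z := (l.map (TensorAlgebra.ι k)).prod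

theorem bBar_listProd (A : BAlgebra k P Z) (l : List Z) : bBar A (listProd l) = opList A.b l := by
  have := bBar_tprod A l.length l.get
  rw [TensorAlgebra.tprod_apply] at this
  rw [opList, ← this, listProd]
  congr 2
  conv_lhs => rw [← List.ofFn_get l]
  rw [List.map_ofFn]
  rfl

/-- The tensor algebra is spanned by the products of letters. -/
theorem span_listProd :
    Submodule.span k (Set.range (listProd : List Z → TensorAlgebra k Z)) = ⊤ := by
  rw [eq_top_iff, ← Algebra.top_toSubmodule, ← TensorAlgebra.adjoin_range_ι,
    Algebra.adjoin_eq_span]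
  refine Submodule.span_mono fun x hx => ?_
  induction hx using Submonoid.closure_induction with
  | mem x hx =>
    obtain ⟨a, rfl⟩ := hx
    exact ⟨[a], by simp [listProd]⟩
  | one => exact ⟨[], rfl⟩
  | mul x y _ _ hx hy =>
    obtain ⟨l, rfl⟩ := hx
    obtain ⟨l', rfl⟩ := hy
    exact ⟨l ++ l', by simp [listProd]⟩

variable (X Y) in
/-- The span of the words of length at least `p` with letters in `N`. -/
def wordSpan (N : Submodule k Z) (p : ℕ) : Submodule k (Word Z X Y) :=
  Submodule.span k {t | ∃ (f : X →ₗ[k] Y) (l : List Z), (∀ a ∈ l, a ∈ N) ∧ p ≤ l.length ∧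
    t = f ⊗ₜ listProd l}

theorem wordSpan_top (t : Word Z X Y) : t ∈ wordSpan X Y (⊤ : Submodule k Z) 0 := by
  induction t using TensorProduct.induction_on with
  | zero => exact Submodule.zero_mem _
  | add a b ha hb => exact Submodule.add_mem _ ha hb
  | tmul f x =>
    have hx : x ∈ Submodule.span k (Set.range (listProd : List Z → TensorAlgebra k Z)) := by
      rw [span_listProd]; trivial
    induction hx using Submodule.span_induction with
    | zero => rw [TensorProduct.tmul_zero]; exact Submodule.zero_mem _
    | add a b _ _ ha hb => rw [TensorProduct.tmul_add]; exact Submodule.add_mem _ ha hb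
    | smul c a _ ha => rw [TensorProduct.tmul_smul]; exact Submodule.smul_mem _ _ ha
    | mem x hx =>
      obtain ⟨l, rfl⟩ := hx
      exact Submodule.subset_span ⟨f, l, fun _ _ => trivial, Nat.zero_le _, rfl⟩

theorem wcomp_mem_wordSpan {N : Submodule k Z} {p q : ℕ} {b : Word Z Y W} {a : Word Z X Y}
    (hb : b ∈ wordSpan Y W N p) (ha : a ∈ wordSpan X Y N q) :
    b ⋄ a ∈ wordSpan X W N (p + q) := by
  induction ha using Submodule.span_induction with
  | zero => rw [map_zero]; exact Submodule.zero_mem _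
  | add x y _ _ hx hy => rw [map_add]; exact Submodule.add_mem _ hx hy
  | smul c x _ hx => rw [map_smul]; exact Submodule.smul_mem _ _ hx
  | mem a ha =>
    obtain ⟨f, l, hl, hl', rfl⟩ := ha
    induction hb using Submodule.span_induction with
    | zero => rw [map_zero]; exact Submodule.zero_mem _
    | add x y _ _ hx hy => rw [map_add]; exact Submodule.add_mem _ hx hy
    | smul c x _ hx => rw [map_smul]; exact Submodule.smul_mem _ _ hx
    | mem b hb =>
      obtain ⟨g, m, hm, hm', rfl⟩ := hb
      refine Submodule.subset_span ⟨g ∘ₗ f, m ++ l, ?_, ?_, ?_⟩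
      · intro a ha
        rcases List.mem_append.mp ha with h | h
        · exact hm a h
        · exact hl a h
      · rw [List.length_append]; omega
      · rw [wcomp_tmul]
        simp [listProd]

theorem toWord_mem_wordSpan {N : Submodule k Z} {t : Pre Z X Y}
    (ht : t ∈ Submodule.span k {t : Pre Z X Y | ∃ f, ∃ a ∈ N, t = f ⊗ₜ a}) :
    toWord X Y t ∈ wordSpan X Y N 1 := by
  induction ht using Submodule.span_induction with
  | zero => rw [map_zero]; exact Submodule.zero_mem _
  | add x y _ _ hx hy => rw [map_add]; exact Submodule.add_mem _ hx hy
  | smul c x _ hx => rw [map_smul]; exact Submodule.smul_mem _ _ hx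
  | mem a ha =>
    obtain ⟨f, a, ha, rfl⟩ := ha
    exact Submodule.subset_span ⟨f, [a], by simpa using ha, le_rfl, by simp [toWord, listProd]⟩

theorem toWord_mem_wordSpan_top (t : Pre Z X Y) : toWord X Y t ∈ wordSpan X Y ⊤ 1 := by
  refine toWord_mem_wordSpan ?_
  induction t using TensorProduct.induction_on with
  | zero => exact Submodule.zero_mem _
  | add a b ha hb => exact Submodule.add_mem _ ha hb
  | tmul f x => exact Submodule.subset_span ⟨f, x, trivial, rfl⟩

theorem toWord_mem_wordSpan_gr {A : GradedBimodule k P Z} {d : ℤ} {t : Pre Z X Y}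
    (ht : t ∈ adDeg A X Y d) : toWord X Y t ∈ wordSpan X Y (A.gr d) 1 := by
  refine toWord_mem_wordSpan (Submodule.span_mono ?_ ht)
  rintro _ ⟨u, v, f, a, -, -, ha, rfl⟩
  exact ⟨f, a, ha, rfl⟩

/-- The letters of the geometric series of a twisting element have degree zero; this keeps the
Koszul signs under control. -/
theorem geom_mem_wordSpan {A : GradedBimodule k P Z} {δ : Pre Z X X}
    (h : δ ∈ adDeg A X X 0) : geom δ ∈ wordSpan X X (A.gr 0) 0 := by
  refine finsum_induction (· ∈ wordSpan X X (A.gr 0) 0) (Submodule.zero_mem _)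
    (fun _ _ => Submodule.add_mem _) fun n => ?_
  induction n with
  | zero => exact Submodule.subset_span ⟨LinearMap.id, [], by simp, Nat.zero_le _, rfl⟩
  | succ n ih =>
    have := wcomp_mem_wordSpan (toWord_mem_wordSpan_gr h) ih
    refine Submodule.span_mono ?_ this
    rintro _ ⟨f, l, hl, -, rfl⟩
    exact ⟨f, l, hl, Nat.zero_le _, rfl⟩

end WordSpan

/-! ### Translation of modules and twisted modules -/

section Shift

variable {k : Type uk} [Field k] {P : Type uP} {Z : Type uZ} [AddCommGroup Z] [Module k Z]
  (A : BNuAlgebra k P Z)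
variable {X Y W V : FSMod.{w} k P}

local infixr:75 " ⋄ " => wcomp _ _ _

/-- The endomorphism of the tensor algebra induced by an endomorphism of `Z`. -/
def tensorMap (f : Z →ₗ[k] Z) : TensorAlgebra k Z →ₐ[k] TensorAlgebra k Z :=
  TensorAlgebra.lift k (TensorAlgebra.ι k ∘ₗ f)

theorem tensorMap_ι (f : Z →ₗ[k] Z) (a : Z) :
    tensorMap f (TensorAlgebra.ι k a) = TensorAlgebra.ι k (f a) :=
  TensorAlgebra.lift_ι_apply _ _

variable (X Y) in
/-- The translation of words, letter by letter. -/
def shiftWord : Word Z X Y →ₗ[k] Word Z (X.shift A.ν) (Y.shift A.ν) :=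
  TensorProduct.map (LinearEquiv.arrowCongr (X.phi A.ν) (Y.phi A.ν)).toLinearMap
    (tensorMap (A.tr (-1) (-1)).toLinearMap).toLinearMap

variable (X Y) in
/-- The translation `f ↦ f[1]` as a linear map. -/
def shiftHomₗ : Pre Z X Y →ₗ[k] Pre Z (X.shift A.ν) (Y.shift A.ν) :=
  TensorProduct.map (LinearEquiv.arrowCongr (X.phi A.ν) (Y.phi A.ν)).toLinearMap
    (A.tr (-1) (-1)).toLinearMap

theorem shiftWord_tmul (f : X →ₗ[k] Y) (x : TensorAlgebra k Z) : shiftWord A X Y (f ⊗ₜ x) =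
    (LinearEquiv.arrowCongr (X.phi A.ν) (Y.phi A.ν) f) ⊗ₜ
      tensorMap (A.tr (-1) (-1)).toLinearMap x := rfl

theorem shiftWord_toWord (t : Pre Z X Y) :
    shiftWord A X Y (toWord X Y t) = toWord _ _ (shiftHomₗ A X Y t) := by
  induction t using TensorProduct.induction_on with
  | zero => simp
  | add a b ha hb => simp only [map_add, ha, hb]
  | tmul f x =>
    simp only [toWord, LinearMap.lTensor_tmul, shiftWord_tmul, tensorMap_ι]
    rfl

theorem shiftWord_wcomp (b : Word Z Y W) (a : Word Z X Y) :
    shiftWord A X W (b ⋄ a) = shiftWord A Y W b ⋄ shiftWord A X Y a := by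
  induction a using TensorProduct.induction_on with
  | zero => simp
  | add a a' h h' => simp only [map_add, h, h']
  | tmul f x =>
    induction b using TensorProduct.induction_on with
    | zero => simp
    | add a a' h h' => simp only [map_add, LinearMap.add_apply, h, h']
    | tmul g y =>
      simp only [wcomp_tmul, shiftWord_tmul, map_mul]
      rfl

theorem shiftWord_wpow (δ : Pre Z X X) (n : ℕ) :
    shiftWord A X X (wpow δ n) = wpow (shiftHomₗ A X X δ) n := by
  induction n with
  | zero =>
    change shiftWord A X X (LinearMap.id ⊗ₜ 1) = _
    rw [shiftWord_tmul, map_one]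
    rfl
  | succ n ih =>
    change shiftWord A X X (toWord X X δ ⋄ wpow δ n) = _
    rw [shiftWord_wcomp, ih, shiftWord_toWord]
    rfl

theorem shiftWord_geom {δ : Pre Z X X} (h : IsNil δ) :
    shiftWord A X X (geom δ) = geom (shiftHomₗ A X X δ) := by
  obtain ⟨N, hN⟩ := h
  have hN' : wpow (shiftHomₗ A X X δ) N = 0 := by rw [← shiftWord_wpow, hN, map_zero]
  rw [geom_eq_sum _ hN, geom_eq_sum _ hN', map_sum]
  exact Finset.sum_congr rfl fun n _ => shiftWord_wpow A δ n

theorem tensorMap_listProd (f : Z →ₗ[k] Z) (l : List Z) :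
    tensorMap f (listProd l) = listProd (l.map f) := by
  simp [listProd, map_list_prod, Function.comp_def, tensorMap_ι]

theorem opList_map_tr (l : List Z) :
    opList A.b (l.map (A.tr (-1) (-1))) = A.tr (-1) (-1) (opList A.b l) := by
  conv_lhs => rw [← List.ofFn_get l, List.map_ofFn, opList_ofFn]
  exact A.b_conj l.length l.get

/-- The operations commute with the translation of words. -/
theorem bAd_shiftWord (t : Word Z X Y) : bAd A.toBAlgebra _ _ (shiftWord A X Y t) =
    shiftHomₗ A X Y (bAd A.toBAlgebra X Y t) := by
  have ht := wordSpan_top t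
  induction ht using Submodule.span_induction with
  | zero => simp
  | add x y _ _ hx hy => simp only [map_add, hx, hy]
  | smul c x _ hx => simp only [map_smul, hx]
  | mem t h =>
    obtain ⟨f, l, -, -, rfl⟩ := h
    rw [shiftWord_tmul, tensorMap_listProd, bAd_tmul, bAd_tmul, bBar_listProd, bBar_listProd]
    refine (congrArg _ (opList_map_tr A l)).trans ?_
    rfl

theorem inv_perm_apply_self (π : Equiv.Perm P) (u : P) : π⁻¹ (π u) = u :=
  π.symm_apply_apply u

theorem shiftHomₗ_mem {t : Pre Z X Y} {d : ℤ} (h : t ∈ adDeg A.toGradedBimodule X Y d) :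
    shiftHomₗ A X Y t ∈ adDeg A.toGradedBimodule (X.shift A.ν) (Y.shift A.ν) d := by
  induction h using Submodule.span_induction with
  | zero => rw [map_zero]; exact Submodule.zero_mem _
  | add x y _ _ hx hy => rw [map_add]; exact Submodule.add_mem _ hx hy
  | smul c x _ hx => rw [map_smul]; exact Submodule.smul_mem _ _ hx
  | mem t h =>
    obtain ⟨u, v, f, a, hf, ha, hd, rfl⟩ := h
    have hs := A.semilinear_tr (-1) (-1)
    refine Submodule.subset_span ⟨A.ν u, A.ν v, f, A.tr (-1) (-1) a, ?_, hs.directed ha, ?_, rfl⟩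
    · change Y.e (A.ν⁻¹ (A.ν v)) ∘ₗ f ∘ₗ X.e (A.ν⁻¹ (A.ν u)) = f
      rw [inv_perm_apply_self, inv_perm_apply_self, hf]
    · have := hs.gr _ _ hd
      rwa [sub_self, add_zero] at this

/-- The translation of a twisted module is twisted: the same filtration works, and the equation
is transported by `bAd_shiftWord`. -/
theorem IsTw.shift {A : BNuAlgebra k P Z} {X : TwPair.{w} k P Z} (h : IsTw A.toBAlgebra X) :
    IsTw A.toBAlgebra (X.shift A) := by
  have hn := h.isNil
  obtain ⟨hd, ⟨n, F, h0, h1, hm, he, hF⟩, hb⟩ := h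
  refine ⟨shiftHomₗ_mem A hd, ⟨n, F, h0, h1, hm, fun r u x hx => he r _ x hx, ?_⟩, ?_⟩
  · obtain ⟨s, hs⟩ := hF
    have hs' : (X.shift A).δ = shiftHomₗ A X.X X.X X.δ := rfl
    rw [hs', ← hs]
    clear hs hs'
    induction s with
    | zero => rw [map_zero, map_zero]; exact Submodule.zero_mem _
    | add a b ha hb => rw [map_add, map_add]; exact Submodule.add_mem _ ha hb
    | tmul f a => exact ⟨f ⊗ₜ A.tr (-1) (-1) a, rfl⟩
  · change bAd A.toBAlgebra _ _ (geom (shiftHomₗ A X.X X.X X.δ)) = 0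
    rw [← shiftWord_geom A hn, bAd_shiftWord, hb, map_zero]

/-- The map `f ⊗ a ↦ f ⊗ θ(a)`; on `ad(Y, X[1])` it is `h ↦ τ_X ∘ h`. It is defined, and bijective,
on all of `Hom_k(Y, X[1]) ⊗ Z`. -/
def Theta (Y X : FSMod.{w} k P) : Pre Z Y (X.shift A.ν) ≃ₗ[k] Pre Z Y X :=
  TensorProduct.congr (LinearEquiv.arrowCongr (LinearEquiv.refl k Y) (X.phi A.ν).symm) A.theta

theorem Theta_tmul (f : Y →ₗ[k] X.shift A.ν) (a : Z) :
    Theta A Y X (f ⊗ₜ a) = ((X.phi A.ν).symm.toLinearMap ∘ₗ f) ⊗ₜ A.theta a := rfl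

theorem Theta_mem {t : Pre Z Y (X.shift A.ν)} {d : ℤ}
    (h : t ∈ adDeg A.toGradedBimodule Y (X.shift A.ν) d) :
    Theta A Y X t ∈ adDeg A.toGradedBimodule Y X (d + 1) := by
  induction h using Submodule.span_induction with
  | zero => rw [map_zero]; exact Submodule.zero_mem _
  | add x y _ _ hx hy => rw [map_add]; exact Submodule.add_mem _ hx hy
  | smul c x _ hx => rw [map_smul]; exact Submodule.smul_mem _ _ hx
  | mem t h =>
    obtain ⟨u, v, f, a, hf, ha, hd, rfl⟩ := h
    have hs := A.theta_directed ha hd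
    exact Submodule.subset_span ⟨u, A.ν⁻¹ v, f, A.theta a, hf, hs.1, hs.2, rfl⟩

theorem Theta_symm_mem {t : Pre Z Y X} {d : ℤ} (h : t ∈ adDeg A.toGradedBimodule Y X d) :
    (Theta A Y X).symm t ∈ adDeg A.toGradedBimodule Y (X.shift A.ν) (d - 1) := by
  induction h using Submodule.span_induction with
  | zero => rw [map_zero]; exact Submodule.zero_mem _
  | add x y _ _ hx hy => rw [map_add]; exact Submodule.add_mem _ hx hy
  | smul c x _ hx => rw [map_smul]; exact Submodule.smul_mem _ _ hx
  | mem t h =>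
    obtain ⟨u, v, f, a, hf, ha, hd, rfl⟩ := h
    have hs := A.theta_symm_directed ha hd
    refine Submodule.subset_span ⟨u, A.ν v, f, A.theta.symm a, ?_, hs.1, hs.2, rfl⟩
    change X.e (A.ν⁻¹ (A.ν v)) ∘ₗ f ∘ₗ Y.e u = f
    rw [inv_perm_apply_self, hf]

/-- The anticommutation rule `BNuAlgebra.b_theta` for lists. -/
theorem opList_theta (l l' : List Z) (a : Z) (hl : ∀ x ∈ l, x ∈ A.gr 0)
    (hl' : ∀ x ∈ l', x ∈ A.gr 0) : opList A.b (l ++ A.theta a :: l') =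
      -A.theta (opList A.b (l.map (A.tr (-1) (-1)) ++ a :: l')) := by
  have hlen : l.length < (l ++ a :: l').length := by simp
  have key := A.b_theta ⟨l.length, hlen⟩ (l ++ a :: l').get (fun j hj => by
    have hj' : (j : ℕ) ≠ l.length := fun h => hj (Fin.ext h)
    rw [List.get_eq_getElem, List.getElem_append]
    split_ifs with h
    · exact hl _ (List.getElem_mem _)
    · obtain ⟨i, hi⟩ : ∃ i, (j : ℕ) - l.length = i + 1 := ⟨j - l.length - 1, by omega⟩
      simp only [hi, List.getElem_cons_succ]
      exact hl' _ (List.getElem_mem _))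
  rw [← opList_ofFn, ← opList_ofFn] at key
  convert key using 2
  · refine List.ext_getElem (by simp [add_assoc]) fun i h1 h2 => ?_
    simp only [List.getElem_append, List.getElem_ofFn, List.get_eq_getElem, Fin.mk.injEq]
    rcases lt_trichotomy i l.length with h | rfl | h
    · simp [h, h.ne]
    · simp
    · obtain ⟨j, rfl⟩ := Nat.exists_eq_add_of_lt h
      simp [show l.length + j + 1 - l.length = j + 1 by omega, h.not_gt, h.ne']
  · congr 1
    refine congrArg _ (List.ext_getElem (by simp [add_assoc]) fun i h1 h2 => ?_)
    simp only [List.getElem_append, List.getElem_ofFn, List.get_eq_getElem, Fin.mk_lt_mk,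
      List.length_map, List.getElem_map]
    split_ifs <;> rfl

/-- The anticommutation rule for words with letters of degree zero on both sides. -/
theorem bAd_Theta {b : Word Z X X} {c : Word Z Y Y} (hb : b ∈ wordSpan X X (A.gr 0) 0)
    (hc : c ∈ wordSpan Y Y (A.gr 0) 0) (h : Pre Z Y (X.shift A.ν)) :
    bAd A.toBAlgebra Y X (b ⋄ toWord _ _ (Theta A Y X h) ⋄ c) =
      -Theta A Y X (bAd A.toBAlgebra _ _ (shiftWord A X X b ⋄ toWord _ _ h ⋄ c)) := by
  induction hb using Submodule.span_induction with
  | zero => simp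
  | add x y _ _ hx hy => simp only [map_add, LinearMap.add_apply, hx, hy, neg_add]
  | smul r x _ hx => simp only [map_smul, LinearMap.smul_apply, hx, smul_neg]
  | mem b hb =>
  induction hc using Submodule.span_induction with
  | zero => simp
  | add x y _ _ hx hy => simp only [map_add, hx, hy, neg_add]
  | smul r x _ hx => simp only [map_smul, hx, smul_neg]
  | mem c hc =>
  induction h using TensorProduct.induction_on with
  | zero => simp
  | add x y hx hy => simp only [map_add, LinearMap.add_apply, hx, hy, neg_add]
  | tmul f a =>
    obtain ⟨g, l, hl, -, rfl⟩ := hb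
    obtain ⟨g', l', hl', -, rfl⟩ := hc
    rw [Theta_tmul, shiftWord_tmul, tensorMap_listProd]
    simp only [toWord, LinearMap.lTensor_tmul, wcomp_tmul, bAd_tmul]
    have e1 : ∀ (m : List Z) (z : Z), (listProd m * (TensorAlgebra.ι k z * listProd l') :
        TensorAlgebra k Z) = listProd (m ++ z :: l') := fun m z => by simp [listProd]
    rw [e1, e1, bBar_listProd, bBar_listProd, opList_theta A l l' a hl hl', TensorProduct.tmul_neg]
    rfl

/-- The differential anticommutes with composition with `τ_X`. -/
theorem bTw1_Theta {A : BNuAlgebra k P Z} {X Y : TwPair.{w} k P Z} (hX : IsTw A.toBAlgebra X)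
    (hY : IsTw A.toBAlgebra Y) (h : Pre Z Y.X (X.shift A).X) :
    bTw1 A.toBAlgebra Y X (Theta A Y.X X.X h) =
      -Theta A Y.X X.X (bTw1 A.toBAlgebra Y (X.shift A) h) := by
  have hG : geom (X.shift A).δ = shiftWord A X.X X.X (geom X.δ) :=
    (shiftWord_geom A hX.isNil).symm
  refine (bAd_Theta A (geom_mem_wordSpan hX.1) (geom_mem_wordSpan hY.1) h).trans ?_
  rw [← hG]
  rfl

end Shift

/-! ### Special morphisms -/

section Special

variable {k : Type uk} [Field k] {P : Type uP} {Z : Type uZ} [AddCommGroup Z] [Module k Z]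
variable {X Y W V X' Y' : FSMod.{w} k P}

local infixr:75 " ⋄ " => wcomp _ _ _

/-- Composition of morphisms of right modules. -/
def FSMod.Hom.comp (ψ : FSMod.Hom Y W) (φ : FSMod.Hom X Y) : FSMod.Hom X W :=
  ⟨ψ.map ∘ₗ φ.map, fun u x => by simp [φ.map_e, ψ.map_e]⟩

theorem FSMod.Hom.map_comp_e (φ : FSMod.Hom X Y) (u : P) : φ.map ∘ₗ X.e u = Y.e u ∘ₗ φ.map :=
  LinearMap.ext (φ.map_e u)

theorem FSMod.e_comp_e (X : FSMod.{w} k P) (u : P) : X.e u ∘ₗ X.e u = X.e u :=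
  LinearMap.ext (X.unitary.idem u)

/-- A relation `e_v f e_u = f` gives `e_v f = f` and `f e_u = f`. -/
theorem FSMod.corner {f : X →ₗ[k] Y} {u v : P} (hf : Y.e v ∘ₗ f ∘ₗ X.e u = f) :
    Y.e v ∘ₗ f = f ∧ f ∘ₗ X.e u = f := by
  constructor
  · conv_lhs => rw [← hf]
    rw [← LinearMap.comp_assoc, Y.e_comp_e, hf]
  · conv_lhs => rw [← hf]
    rw [LinearMap.comp_assoc, LinearMap.comp_assoc, X.e_comp_e, hf]

theorem sandwich_mem {A : GradedBimodule k P Z} (g : FSMod.Hom Y Y') (h : FSMod.Hom X' X)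
    {t : Pre Z X Y} {d : ℤ} (ht : t ∈ adDeg A X Y d) :
    sandwich g.map h.map t ∈ adDeg A X' Y' d := by
  induction ht using Submodule.span_induction with
  | zero => rw [map_zero]; exact Submodule.zero_mem _
  | add x y _ _ hx hy => rw [map_add]; exact Submodule.add_mem _ hx hy
  | smul c x _ hx => rw [map_smul]; exact Submodule.smul_mem _ _ hx
  | mem t ht =>
    obtain ⟨u, v, f, a, hf, ha, hd, rfl⟩ := ht
    refine Submodule.subset_span ⟨u, v, g.map ∘ₗ f ∘ₗ h.map, a, ?_, ha, hd, rfl⟩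
    rw [LinearMap.comp_assoc, LinearMap.comp_assoc, h.map_comp_e, ← LinearMap.comp_assoc,
      ← g.map_comp_e, LinearMap.comp_assoc, ← LinearMap.comp_assoc h.map, ← LinearMap.comp_assoc,
      (FSMod.corner hf).2, ← LinearMap.comp_assoc, ← LinearMap.comp_assoc,
      LinearMap.comp_assoc f, (FSMod.corner hf).1, LinearMap.comp_assoc]

variable (A : UnitaryBNuAlgebra k P Z)

/-- The sums defining `special` and `tau` are finite. -/
theorem finite_special_support (φ : X →ₗ[k] Y) (a : P → Z) :
    (Function.support fun u => (φ ∘ₗ X.e u) ⊗ₜ[k] a u).Finite := by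
  refine X.finite_support.subset fun u hu h => hu ?_
  change (φ ∘ₗ X.e u) ⊗ₜ[k] a u = 0
  rw [h, LinearMap.comp_zero, TensorProduct.zero_tmul]

theorem map_special {M : Type*} [AddCommGroup M] [Module k M] (L : Pre Z X Y →ₗ[k] M)
    (φ : FSMod.Hom X Y) :
    L (special A φ) = ∑ᶠ u, L ((φ.map ∘ₗ X.e u) ⊗ₜ[k] A.unit u) :=
  L.toAddMonoidHom.map_finsum (finite_special_support φ.map A.unit)

theorem special_congr {φ ψ : FSMod.Hom X Y} (h : φ.map = ψ.map) : special A φ = special A ψ := by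
  rw [special, special, h]

theorem special_add {χ φ ψ : FSMod.Hom X Y} (h : χ.map = φ.map + ψ.map) :
    special A χ = special A φ + special A ψ := by
  rw [special, h, special, special, ← finsum_add_distrib (finite_special_support φ.map A.unit)
    (finite_special_support ψ.map A.unit)]
  exact finsum_congr fun u => by rw [LinearMap.add_comp, TensorProduct.add_tmul]

theorem sandwich_special (g : FSMod.Hom Y Y') (φ : FSMod.Hom X Y) (h : FSMod.Hom X' X) :
    sandwich g.map h.map (special A φ) = special A (g.comp (φ.comp h)) := by
  rw [map_special]
  refine finsum_congr fun u => ?_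
  rw [sandwich_tmul, LinearMap.comp_assoc, ← h.map_comp_e]
  rfl

theorem special_mem (φ : FSMod.Hom X Y) :
    special A φ ∈ adDeg A.toGradedBimodule X Y (-1) := by
  refine finsum_induction (· ∈ adDeg A.toGradedBimodule X Y (-1)) (Submodule.zero_mem _)
    (fun _ _ => Submodule.add_mem _) fun u => ?_
  refine Submodule.subset_span ⟨u, u, _, _, ?_, ?_, A.unit_gr u, rfl⟩
  · rw [LinearMap.comp_assoc, X.e_comp_e, φ.map_comp_e, ← LinearMap.comp_assoc, Y.e_comp_e]
  · have := A.directed_lact_ract u u (A.unit u)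
    rwa [A.unit_directed] at this

theorem opList_unit (l l' : List Z) (h : l.length + l'.length ≠ 1) (u : P) :
    opList A.b (l ++ A.unit u :: l') = 0 := by
  refine A.b_eq_zero_of_unit (by simp; omega) _ ⟨l.length, by simp⟩ u (by simp)

/-- Strictness for words: only binary products with a special morphism are nonzero. -/
theorem bAd_special_eq_zero (φ : FSMod.Hom X Y) {b : Word Z Y W} {c : Word Z V X} {p q : ℕ}
    (hb : b ∈ wordSpan Y W ⊤ p) (hc : c ∈ wordSpan V X ⊤ q) (hpq : 2 ≤ p + q) :
    bAd A.toBAlgebra V W (b ⋄ toWord X Y (special A φ) ⋄ c) = 0 := by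
  induction hb using Submodule.span_induction with
  | zero => simp
  | add x y _ _ hx hy => simp only [map_add, LinearMap.add_apply, hx, hy, add_zero]
  | smul r x _ hx => simp only [map_smul, LinearMap.smul_apply, hx, smul_zero]
  | mem b hb =>
  induction hc using Submodule.span_induction with
  | zero => simp
  | add x y _ _ hx hy => simp only [map_add, hx, hy, add_zero]
  | smul r x _ hx => simp only [map_smul, hx, smul_zero]
  | mem c hc =>
  obtain ⟨f, l, -, hl, rfl⟩ := hb
  obtain ⟨f', l', -, hl', rfl⟩ := hc
  have := map_special A (bAd A.toBAlgebra V W ∘ₗ wcomp V Y W (f ⊗ₜ listProd l) ∘ₗ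
    (wcomp V X Y).flip (f' ⊗ₜ listProd l') ∘ₗ toWord X Y) φ
  refine this.trans ((finsum_congr fun u => ?_).trans finsum_zero)
  simp only [LinearMap.comp_apply, LinearMap.flip_apply, toWord, LinearMap.lTensor_tmul,
    wcomp_tmul, bAd_tmul]
  have e1 : (listProd l * (TensorAlgebra.ι k (A.unit u) * listProd l') :
      TensorAlgebra k Z) = listProd (l ++ A.unit u :: l') := by simp [listProd]
  rw [e1, bBar_listProd, opList_unit A l l' (by omega), TensorProduct.tmul_zero]

theorem bAd_toWord_special (φ : FSMod.Hom X Y) :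
    bAd A.toBAlgebra X Y (toWord X Y (special A φ)) = 0 := by
  refine (map_special A (bAd A.toBAlgebra X Y ∘ₗ toWord X Y) φ).trans
    ((finsum_congr fun u => ?_).trans finsum_zero)
  simp only [LinearMap.comp_apply, toWord, LinearMap.lTensor_tmul, bAd_tmul]
  have e1 : (TensorAlgebra.ι k (A.unit u) : TensorAlgebra k Z) = listProd ([] ++ [A.unit u]) := by
    simp [listProd]
  rw [e1, bBar_listProd, opList_unit A [] [] (by simp), TensorProduct.tmul_zero]

theorem circ_tmul (A : BAlgebra k P Z) (g : Y →ₗ[k] W) (y : Z) (f : X →ₗ[k] Y) (x : Z) :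
    circ A (g ⊗ₜ[k] y) (f ⊗ₜ[k] x) = (g ∘ₗ f) ⊗ₜ[k] A.b 2 ![y, x] := by
  have e1 : (TensorAlgebra.ι k y * TensorAlgebra.ι k x : TensorAlgebra k Z) = listProd [y, x] := by
    simp [listProd]
  simp only [circ, toWord, LinearMap.lTensor_tmul, wcomp_tmul, bAd_tmul, e1, bBar_listProd]
  rw [← opList_ofFn]
  simp

/-- The composition `g ∘ f` as a bilinear map. -/
def circₗ (A : BAlgebra k P Z) (X Y W : FSMod.{w} k P) :
    Pre Z Y W →ₗ[k] Pre Z X Y →ₗ[k] Pre Z X W :=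
  ((wcomp X Y W).compl₁₂ (toWord Y W) (toWord X Y)).compr₂ (bAd A X W)

theorem circ_eq (A : BAlgebra k P Z) (g : Pre Z Y W) (f : Pre Z X Y) :
    circ A g f = circₗ A X Y W g f := rfl

/-- On the right, special morphisms act by composition up to the sign of the right unit law. -/
theorem circ_special {h : Pre Z Y W} {d : ℤ} (hh : h ∈ adDeg A.toGradedBimodule Y W d)
    (φ : FSMod.Hom X Y) : circ A.toBAlgebra h (special A φ) =
      (d + 1).negOnePow • sandwich LinearMap.id φ.map h := by
  rw [circ_eq]
  induction hh using Submodule.span_induction with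
  | zero => simp
  | add x y _ _ hx hy => simp only [map_add, LinearMap.add_apply, hx, hy, smul_add]
  | smul r x _ hx =>
    simp only [map_smul, LinearMap.smul_apply, hx]
    exact smul_comm _ _ _
  | mem t ht =>
    obtain ⟨u, v, f, a, hf, ha, hd, rfl⟩ := ht
    have key : ∀ w, circₗ A.toBAlgebra X Y W (f ⊗ₜ a) ((φ.map ∘ₗ X.e w) ⊗ₜ A.unit w) =
        (f ∘ₗ φ.map ∘ₗ X.e w) ⊗ₜ[k] ((d + 1).negOnePow • A.ract w a) := fun w => by
      rw [← circ_eq, circ_tmul, A.unit_right w d a hd]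
    rw [map_special, finsum_eq_single _ u]
    · rw [key, ha.2, φ.map_comp_e, ← LinearMap.comp_assoc, (FSMod.corner hf).2, sandwich_tmul,
        Units.smul_def, Units.smul_def, ← Int.cast_smul_eq_zsmul k, ← Int.cast_smul_eq_zsmul k,
        TensorProduct.tmul_smul]
      rfl
    · intro w hw
      rw [key, ← ha.2, A.ract_unitary.orth w u hw, smul_zero, TensorProduct.tmul_zero]

/-- On the left, special morphisms act by composition. -/
theorem special_circ {h : Pre Z X Y} {d : ℤ} (hh : h ∈ adDeg A.toGradedBimodule X Y d)
    (ψ : FSMod.Hom Y W) : circ A.toBAlgebra (special A ψ) h = sandwich ψ.map LinearMap.id h := by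
  rw [circ_eq]
  induction hh using Submodule.span_induction with
  | zero => simp
  | add x y _ _ hx hy => simp only [map_add, hx, hy]
  | smul r x _ hx => simp only [map_smul, hx]
  | mem t ht =>
    obtain ⟨u, v, f, a, hf, ha, hd, rfl⟩ := ht
    have key : ∀ w, (circₗ A.toBAlgebra X Y W).flip (f ⊗ₜ a) ((ψ.map ∘ₗ Y.e w) ⊗ₜ A.unit w) =
        ((ψ.map ∘ₗ Y.e w) ∘ₗ f) ⊗ₜ[k] (A.lact w a) := fun w => by
      rw [LinearMap.flip_apply, ← circ_eq, circ_tmul, A.unit_left w d a hd]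
    rw [← LinearMap.flip_apply, map_special, finsum_eq_single _ v]
    · rw [key, ha.1, LinearMap.comp_assoc, (FSMod.corner hf).1]
      rfl
    · intro w hw
      rw [key, ← ha.1, A.lact_unitary.orth w v hw, TensorProduct.tmul_zero]

theorem wcomp_mem_wordSpan_of_eq {b : Word Z Y W} {a : Word Z X Y} (p q : ℕ) {r : ℕ}
    (hr : p + q = r) (hb : b ∈ wordSpan Y W ⊤ p) (ha : a ∈ wordSpan X Y ⊤ q) :
    b ⋄ a ∈ wordSpan X W ⊤ r :=
  hr ▸ wcomp_mem_wordSpan hb ha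

theorem geom_sub_mem {δ : Pre Z X X} (h : IsNil δ) :
    geom δ - hat LinearMap.id ∈ wordSpan X X ⊤ 1 := by
  rw [geom_eq_left h, add_sub_cancel_left]
  exact wcomp_mem_wordSpan_of_eq 1 0 rfl (toWord_mem_wordSpan_top δ) (wordSpan_top _)

theorem geom_sub_sub_mem {δ : Pre Z X X} (h : IsNil δ) :
    geom δ - hat LinearMap.id - toWord X X δ ∈ wordSpan X X ⊤ 2 := by
  have : geom δ - hat LinearMap.id - toWord X X δ =
      toWord X X δ ⋄ (geom δ - hat LinearMap.id) := by
    rw [map_sub, wcomp_hat_id]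
    nth_rewrite 1 [geom_eq_left h]
    abel
  rw [this]
  exact wcomp_mem_wordSpan_of_eq 1 1 rfl (toWord_mem_wordSpan_top δ) (geom_sub_mem h)

theorem wcomp_toWord_wcomp_sub_mem {δ : Pre Z X X} {δ' : Pre Z Y Y} (h : IsNil δ)
    (h' : IsNil δ') (f : Pre Z X Y) :
    geom δ' ⋄ toWord X Y f ⋄ geom δ - toWord X Y f ∈ wordSpan X Y ⊤ 2 := by
  have : geom δ' ⋄ toWord X Y f ⋄ geom δ - toWord X Y f =
      (geom δ' - hat LinearMap.id) ⋄ toWord X Y f ⋄ geom δ +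
        toWord X Y f ⋄ (geom δ - hat LinearMap.id) := by
    rw [map_sub, map_sub, LinearMap.sub_apply, hat_id_wcomp, wcomp_hat_id]
    abel
  rw [this]
  exact Submodule.add_mem _
    (wcomp_mem_wordSpan_of_eq 1 1 rfl (geom_sub_mem h')
      (wcomp_mem_wordSpan_of_eq 1 0 rfl (toWord_mem_wordSpan_top f) (wordSpan_top _)))
    (wcomp_mem_wordSpan_of_eq 1 1 rfl (toWord_mem_wordSpan_top f) (geom_sub_mem h))

end Special

section SpecialTw

variable {k : Type uk} [Field k] {P : Type uP} {Z : Type uZ} [AddCommGroup Z] [Module k Z]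
variable {X Y W : TwPair.{w} k P Z}

local infixr:75 " ⋄ " => wcomp _ _ _

variable (A : UnitaryBNuAlgebra k P Z)

/-- By strictness only the binary term of `h ⋆ special φ` survives, and the sign is trivial in
degree `-1`. -/
theorem star_special (hX : IsNil X.δ) (hY : IsNil Y.δ) (hW : IsNil W.δ) {h : Pre Z Y.X W.X}
    (hh : h ∈ adDeg A.toGradedBimodule Y.X W.X (-1)) (φ : FSMod.Hom X.X Y.X) :
    star A.toBAlgebra X Y W h (special A φ) = sandwich LinearMap.id φ.map h := by
  have key : geom W.δ ⋄ toWord _ _ h ⋄ geom Y.δ ⋄ toWord _ _ (special A φ) ⋄ geom X.δ =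
      (geom W.δ ⋄ toWord _ _ h ⋄ geom Y.δ - toWord _ _ h) ⋄ toWord _ _ (special A φ) ⋄ geom X.δ +
      toWord _ _ h ⋄ toWord _ _ (special A φ) ⋄ (geom X.δ - hat LinearMap.id) +
      toWord _ _ h ⋄ toWord _ _ (special A φ) := by
    simp only [map_sub, LinearMap.sub_apply, wcomp_hat_id, wcomp_assoc]
    abel
  have hc := circ_special A hh φ
  rw [neg_add_cancel, Int.negOnePow_zero, one_smul] at hc
  rw [star, key, map_add, map_add,
    bAd_special_eq_zero A φ (wcomp_toWord_wcomp_sub_mem hY hW h) (wordSpan_top _) le_rfl,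
    bAd_special_eq_zero A φ (toWord_mem_wordSpan_top h) (geom_sub_mem hX) le_rfl,
    zero_add, zero_add, ← hc]
  rfl

/-- By strictness only the binary term of `special ψ ⋆ h` survives. -/
theorem special_star (hX : IsNil X.δ) (hY : IsNil Y.δ) (hW : IsNil W.δ) {h : Pre Z X.X Y.X}
    {d : ℤ} (hh : h ∈ adDeg A.toGradedBimodule X.X Y.X d) (ψ : FSMod.Hom Y.X W.X) :
    star A.toBAlgebra X Y W (special A ψ) h = sandwich ψ.map LinearMap.id h := by
  have key : geom W.δ ⋄ toWord _ _ (special A ψ) ⋄ geom Y.δ ⋄ toWord _ _ h ⋄ geom X.δ =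
      geom W.δ ⋄ toWord _ _ (special A ψ) ⋄ (geom Y.δ ⋄ toWord _ _ h ⋄ geom X.δ - toWord _ _ h) +
      (geom W.δ - hat LinearMap.id) ⋄ toWord _ _ (special A ψ) ⋄ toWord _ _ h +
      toWord _ _ (special A ψ) ⋄ toWord _ _ h := by
    simp only [map_sub, LinearMap.sub_apply, hat_id_wcomp]
    abel
  rw [star, key, map_add, map_add,
    bAd_special_eq_zero A ψ (wordSpan_top _) (wcomp_toWord_wcomp_sub_mem hX hY h) le_rfl,
    bAd_special_eq_zero A ψ (geom_sub_mem hW) (toWord_mem_wordSpan_top h) le_rfl,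
    zero_add, zero_add, ← special_circ A hh ψ]
  rfl

/-- A special morphism is a cycle if and only if it commutes with the twisting elements. -/
theorem bTw1_special (hX : IsNil X.δ) (hY : IsNil Y.δ)
    (hX' : X.δ ∈ adDeg A.toGradedBimodule X.X X.X 0)
    (hY' : Y.δ ∈ adDeg A.toGradedBimodule Y.X Y.X 0) (φ : FSMod.Hom X.X Y.X) :
    bTw1 A.toBAlgebra X Y (special A φ) =
      sandwich φ.map LinearMap.id X.δ - sandwich LinearMap.id φ.map Y.δ := by
  set s := toWord _ _ (special A φ) with hs
  have key : geom Y.δ ⋄ s ⋄ geom X.δ =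
      (geom Y.δ - hat LinearMap.id - toWord _ _ Y.δ) ⋄ s ⋄ geom X.δ +
      (hat LinearMap.id : Word Z Y.X Y.X) ⋄ s ⋄ (geom X.δ - hat LinearMap.id - toWord _ _ X.δ) +
      toWord _ _ Y.δ ⋄ s ⋄ (geom X.δ - hat LinearMap.id) +
      (s + s ⋄ toWord _ _ X.δ + toWord _ _ Y.δ ⋄ s) := by
    simp only [map_sub, LinearMap.sub_apply, hat_id_wcomp, wcomp_hat_id]
    abel
  -- in degree zero the right unit law carries the sign `-1`
  have hc := circ_special A hY' φ
  rw [zero_add, Int.negOnePow_one, Units.neg_smul, one_smul] at hc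
  change bAd A.toBAlgebra _ _ (geom Y.δ ⋄ s ⋄ geom X.δ) = _
  rw [key, map_add, map_add, map_add, map_add, map_add, hs,
    bAd_special_eq_zero A φ (geom_sub_sub_mem hY) (wordSpan_top _) le_rfl,
    bAd_special_eq_zero A φ (wordSpan_top _) (geom_sub_sub_mem hX) le_rfl,
    bAd_special_eq_zero A φ (toWord_mem_wordSpan_top _) (geom_sub_mem hX) le_rfl,
    bAd_toWord_special, zero_add, zero_add, zero_add, zero_add, ← special_circ A hX' φ,
    sub_eq_add_neg, ← hc]
  rfl

end SpecialTw

/-! ### Split extensions of twisted modules -/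

section Splitting

variable {k : Type uk} [Field k] {P : Type uP} {Z : Type uZ} [AddCommGroup Z] [Module k Z]

local infixr:75 " ⋄ " => wcomp _ _ _

/-- A splitting `E = X ⊕ Y` of right modules for which `X → E` and `E → Y` commute with the
twisting elements. -/
structure Splitting (X E Y : TwPair.{w} k P Z) where
  φ : FSMod.Hom X.X E.X
  ψ : FSMod.Hom E.X Y.X
  ρ : FSMod.Hom E.X X.X
  σ : FSMod.Hom Y.X E.X
  ρφ : ρ.map ∘ₗ φ.map = LinearMap.id
  ψσ : ψ.map ∘ₗ σ.map = LinearMap.id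
  ψφ : ψ.map ∘ₗ φ.map = 0
  ρσ : ρ.map ∘ₗ σ.map = 0
  sum : φ.map ∘ₗ ρ.map + σ.map ∘ₗ ψ.map = LinearMap.id
  δφ : sandwich LinearMap.id φ.map E.δ = sandwich φ.map LinearMap.id X.δ
  ψδ : sandwich ψ.map LinearMap.id E.δ = sandwich LinearMap.id ψ.map Y.δ

namespace Splitting

variable {X E E' Y : TwPair.{w} k P Z} (S : Splitting X E Y) (S' : Splitting X E' Y)

/-- The upper right entry of the matrix of `δ_E`. -/
def γ : Pre Z Y.X X.X := sandwich S.ρ.map S.σ.map E.δ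

theorem γ_mem {A : GradedBimodule k P Z} (h : E.δ ∈ adDeg A E.X E.X 0) :
    S.γ ∈ adDeg A Y.X X.X 0 :=
  sandwich_mem S.ρ S.σ h

/-- The second column of the matrix of `δ_E`. -/
theorem δσ : sandwich LinearMap.id S.σ.map E.δ =
    sandwich S.φ.map LinearMap.id S.γ + sandwich S.σ.map LinearMap.id Y.δ := by
  conv_lhs => rw [← S.sum]
  rw [sandwich_add_left, γ, sandwich_sandwich, LinearMap.comp_id]
  have := congrArg (sandwich (X' := Y.X) (Y' := E.X) S.σ.map S.σ.map) S.ψδ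
  rw [sandwich_sandwich, sandwich_sandwich, LinearMap.id_comp, LinearMap.comp_id, S.ψσ] at this
  rw [this]

/-- The matrix of `δ_E` is upper triangular. -/
theorem δ_eq : E.δ = sandwich S.φ.map S.ρ.map X.δ + sandwich S.φ.map S.ψ.map S.γ +
    sandwich S.σ.map S.ψ.map Y.δ := by
  have h1 := congrArg (sandwich (X' := E.X) (Y' := E.X) LinearMap.id S.ψ.map) S.δσ
  have h2 := congrArg (sandwich (X' := E.X) (Y' := E.X) LinearMap.id S.ρ.map) S.δφ
  rw [map_add] at h1
  simp only [sandwich_sandwich, LinearMap.id_comp, LinearMap.comp_id] at h1 h2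
  rw [add_assoc, ← h1, ← h2, ← sandwich_add_right, S.sum, sandwich_id_id]

theorem geom_wcomp_φ (hX : IsNil X.δ) (hE : IsNil E.δ) :
    geom E.δ ⋄ hat S.φ.map = hat S.φ.map ⋄ geom X.δ :=
  geom_wcomp_hat hX hE S.φ.map S.δφ

theorem ψ_wcomp_geom (hE : IsNil E.δ) (hY : IsNil Y.δ) :
    hat S.ψ.map ⋄ geom E.δ = geom Y.δ ⋄ hat S.ψ.map :=
  (geom_wcomp_hat hE hY S.ψ.map S.ψδ.symm).symm

/-- The second column of the matrix of `∑ δ_E^{⊗i}`. The recursion `G_E = 1 + G_E δ_E` gives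
`G_E σ (1 - δ_Y) = σ + φ G_X γ`, and `G_Y` is inverse to `1 - δ_Y`. -/
theorem geom_wcomp_σ (hX : IsNil X.δ) (hE : IsNil E.δ) (hY : IsNil Y.δ) :
    geom E.δ ⋄ hat S.σ.map =
      hat S.φ.map ⋄ geom X.δ ⋄ toWord _ _ S.γ ⋄ geom Y.δ + hat S.σ.map ⋄ geom Y.δ := by
  have h1 := congrArg (toWord Y.X E.X) S.δσ
  rw [map_add, toWord_sandwich, toWord_sandwich, toWord_sandwich, wcomp_hat_id, wcomp_hat_id,
    hat_id_wcomp] at h1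
  have h2 : geom E.δ ⋄ hat S.σ.map = hat S.σ.map + (hat S.φ.map ⋄ geom X.δ ⋄ toWord _ _ S.γ +
      geom E.δ ⋄ hat S.σ.map ⋄ toWord _ _ Y.δ) := by
    rw [← wcomp_assoc (hat S.φ.map), ← S.geom_wcomp_φ hX hE, wcomp_assoc, ← map_add, ← h1]
    nth_rewrite 1 [geom_eq_right hE]
    rw [map_add, LinearMap.add_apply, hat_id_wcomp, wcomp_assoc]
  have h3 : (hat LinearMap.id : Word Z Y.X Y.X) = geom Y.δ - toWord _ _ Y.δ ⋄ geom Y.δ :=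
    eq_sub_of_add_eq (geom_eq_left hY).symm
  calc geom E.δ ⋄ hat S.σ.map = (geom E.δ ⋄ hat S.σ.map) ⋄ hat LinearMap.id :=
        (wcomp_hat_id _).symm
    _ = (geom E.δ ⋄ hat S.σ.map) ⋄ geom Y.δ -
        (geom E.δ ⋄ hat S.σ.map ⋄ toWord _ _ Y.δ) ⋄ geom Y.δ := by
      rw [h3, map_sub]
      simp only [wcomp_assoc]
    _ = _ := by
      rw [h2]
      simp only [map_add, LinearMap.add_apply, wcomp_assoc]
      abel

/-- The matrix of `∑ δ_E^{⊗i}` is upper triangular with entry `G_X γ G_Y`. -/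
theorem geom_eq (hX : IsNil X.δ) (hE : IsNil E.δ) (hY : IsNil Y.δ) :
    geom E.δ = hat S.φ.map ⋄ geom X.δ ⋄ hat S.ρ.map +
      hat S.φ.map ⋄ (geom X.δ ⋄ toWord _ _ S.γ ⋄ geom Y.δ) ⋄ hat S.ψ.map +
      hat S.σ.map ⋄ geom Y.δ ⋄ hat S.ψ.map := by
  rw [← wcomp_hat_id (geom E.δ), ← S.sum, hat_add, map_add, ← hat_wcomp_hat, ← hat_wcomp_hat,
    ← wcomp_assoc, ← wcomp_assoc, S.geom_wcomp_φ hX hE, S.geom_wcomp_σ hX hE hY]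
  simp only [map_add, LinearMap.add_apply, wcomp_assoc, add_assoc]

/-- The left side of the equation for `E` to be twisted, in matrix form. -/
theorem bAd_geom (A : BAlgebra k P Z) (hX : IsNil X.δ) (hE : IsNil E.δ) (hY : IsNil Y.δ) :
    bAd A _ _ (geom E.δ) = sandwich S.φ.map S.ρ.map (bAd A _ _ (geom X.δ)) +
      sandwich S.φ.map S.ψ.map (bTw1 A Y X S.γ) +
      sandwich S.σ.map S.ψ.map (bAd A _ _ (geom Y.δ)) := by
  rw [S.geom_eq hX hE hY, map_add, map_add, bAd_hat_hat, bAd_hat_hat, bAd_hat_hat]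
  rfl

/-- The upper right entry of a twisting element is a cycle. -/
theorem bTw1_γ {A : BAlgebra k P Z} (hX : IsTw A X) (hE : IsTw A E) (hY : IsTw A Y) :
    bTw1 A Y X S.γ = 0 := by
  have h := S.bAd_geom A hX.isNil hE.isNil hY.isNil
  rw [hX.2.2, hY.2.2, hE.2.2, map_zero, map_zero, zero_add, add_zero] at h
  have := congrArg (sandwich (X' := Y.X) (Y' := X.X) S.ρ.map S.σ.map) h
  rwa [map_zero, sandwich_sandwich, S.ρφ, S.ψσ, sandwich_id_id, eq_comm] at this

/-- The comparison `φ' ρ + σ' ψ` of the middle terms of two split extensions. -/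
def cmp : FSMod.Hom E.X E'.X where
  map := S'.φ.map ∘ₗ S.ρ.map + S'.σ.map ∘ₗ S.ψ.map
  map_e u x := by
    simp only [LinearMap.add_apply, LinearMap.comp_apply, FSMod.Hom.map_e, map_add]

theorem cmp_map : (S.cmp S').map = S'.φ.map ∘ₗ S.ρ.map + S'.σ.map ∘ₗ S.ψ.map := rfl

theorem cmp_φ : (S.cmp S').map ∘ₗ S.φ.map = S'.φ.map := by
  rw [cmp_map, LinearMap.add_comp, LinearMap.comp_assoc, LinearMap.comp_assoc, S.ρφ, S.ψφ,
    LinearMap.comp_id, LinearMap.comp_zero, add_zero]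

theorem cmp_σ : (S.cmp S').map ∘ₗ S.σ.map = S'.σ.map := by
  rw [cmp_map, LinearMap.add_comp, LinearMap.comp_assoc, LinearMap.comp_assoc, S.ρσ, S.ψσ,
    LinearMap.comp_id, LinearMap.comp_zero, zero_add]

theorem ρ_cmp : S'.ρ.map ∘ₗ (S.cmp S').map = S.ρ.map := by
  rw [cmp_map, LinearMap.comp_add, ← LinearMap.comp_assoc, ← LinearMap.comp_assoc, S'.ρφ, S'.ρσ,
    LinearMap.id_comp, LinearMap.zero_comp, add_zero]

theorem ψ_cmp : S'.ψ.map ∘ₗ (S.cmp S').map = S.ψ.map := by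
  rw [cmp_map, LinearMap.comp_add, ← LinearMap.comp_assoc, ← LinearMap.comp_assoc, S'.ψφ, S'.ψσ,
    LinearMap.id_comp, LinearMap.zero_comp, zero_add]

theorem cmp_cmp : (S'.cmp S).map ∘ₗ (S.cmp S').map = LinearMap.id := by
  rw [cmp_map S', LinearMap.add_comp, LinearMap.comp_assoc, LinearMap.comp_assoc, ρ_cmp, ψ_cmp,
    S.sum]

variable (A : UnitaryBNuAlgebra k P Z)

/-- The morphism with matrix `(𝕀, η; 0, 𝕀)` with respect to two splittings. -/
def unipotent (η : Pre Z Y.X X.X) : Pre Z E.X E'.X :=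
  special A (S.cmp S') + sandwich S'.φ.map S.ψ.map η

theorem unipotent_mem {η : Pre Z Y.X X.X} (h : η ∈ adDeg A.toGradedBimodule Y.X X.X (-1)) :
    S.unipotent S' A η ∈ adDeg A.toGradedBimodule E.X E'.X (-1) :=
  Submodule.add_mem _ (special_mem A _) (sandwich_mem S'.φ S.ψ h)

/-- The differential of a morphism whose only entry is the upper right one. -/
theorem bTw1_sandwich (A : BAlgebra k P Z) (hX : IsNil X.δ) (hE : IsNil E.δ) (hE' : IsNil E'.δ)
    (hY : IsNil Y.δ) (η : Pre Z Y.X X.X) :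
    bTw1 A E E' (sandwich S'.φ.map S.ψ.map η) = sandwich S'.φ.map S.ψ.map (bTw1 A Y X η) := by
  change bAd A _ _ (geom E'.δ ⋄ toWord _ _ _ ⋄ geom E.δ) =
    sandwich _ _ (bAd A _ _ (geom X.δ ⋄ toWord _ _ η ⋄ geom Y.δ))
  rw [← bAd_hat_hat, toWord_sandwich, wcomp_assoc, wcomp_assoc, S.ψ_wcomp_geom hE hY,
    ← wcomp_assoc, S'.geom_wcomp_φ hX hE']
  simp only [wcomp_assoc]

/-- The differential of a unipotent morphism; it vanishes if and only if
`b^{tw}_1(η) = γ' - γ`. -/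
theorem bTw1_unipotent (hX : IsNil X.δ) (hE : IsTw A.toBAlgebra E) (hE' : IsTw A.toBAlgebra E')
    (hY : IsNil Y.δ) (η : Pre Z Y.X X.X) : bTw1 A.toBAlgebra E E' (S.unipotent S' A η) =
      sandwich S'.φ.map S.ψ.map (S.γ - S'.γ + bTw1 A.toBAlgebra Y X η) := by
  rw [unipotent, map_add, S.bTw1_sandwich S' _ hX hE.isNil hE'.isNil hY,
    bTw1_special A hE.isNil hE'.isNil hE.1 hE'.1, map_add, map_sub]
  congr 1
  conv_lhs => rw [S.δ_eq, S'.δ_eq]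
  simp only [map_add, sandwich_sandwich, LinearMap.id_comp, LinearMap.comp_id, cmp_φ, cmp_σ,
    ρ_cmp, ψ_cmp]
  abel

theorem star_add_left (A : BAlgebra k P Z) {X Y W : TwPair.{w} k P Z} (g g' : Pre Z Y.X W.X)
    (f : Pre Z X.X Y.X) : star A X Y W (g + g') f = star A X Y W g f + star A X Y W g' f := by
  simp only [star, map_add, LinearMap.add_apply]

theorem star_add_right (A : BAlgebra k P Z) {X Y W : TwPair.{w} k P Z} (g : Pre Z Y.X W.X)
    (f f' : Pre Z X.X Y.X) : star A X Y W g (f + f') = star A X Y W g f + star A X Y W g f' := by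
  simp only [star, map_add, LinearMap.add_apply]

/-- Unipotent morphisms with opposite entries are mutually inverse. The product of the two
off-diagonal parts vanishes because `ψ' (∑ δ^{⊗i}) φ' = ψ' φ' (∑ δ_X^{⊗i}) = 0`. -/
theorem unipotent_star_unipotent (hX : IsNil X.δ) (hE : IsNil E.δ) (hE' : IsNil E'.δ)
    {η : Pre Z Y.X X.X} (h : η ∈ adDeg A.toGradedBimodule Y.X X.X (-1)) :
    star A.toBAlgebra E E' E (S'.unipotent S A (-η)) (S.unipotent S' A η) = idn A E.X := by
  have h0 : star A.toBAlgebra E E' E (sandwich S.φ.map S'.ψ.map (-η))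
      (sandwich S'.φ.map S.ψ.map η) = 0 := by
    rw [star, toWord_sandwich, toWord_sandwich]
    have : (hat S'.ψ.map ⋄ geom E'.δ ⋄ (hat S'.φ.map ⋄ toWord Y.X X.X η ⋄ hat S.ψ.map) ⋄
        geom E.δ : Word Z E.X Y.X) = 0 := by
      rw [wcomp_assoc (hat S'.φ.map), ← wcomp_assoc (geom E'.δ), S'.geom_wcomp_φ hX hE',
        wcomp_assoc, ← wcomp_assoc (hat S'.ψ.map), hat_wcomp_hat, S'.ψφ, hat_zero, map_zero,
        LinearMap.zero_apply]
    rw [wcomp_assoc (hat S.φ.map), wcomp_assoc _ (hat S'.ψ.map), this]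
    simp only [map_zero]
  have h1 : sandwich S.φ.map S'.ψ.map (-η) ∈ adDeg A.toGradedBimodule E'.X E.X (-1) :=
    sandwich_mem S.φ S'.ψ (Submodule.neg_mem _ h)
  nth_rewrite 1 [unipotent]
  rw [star_add_left, special_star A hE hE' hE (S.unipotent_mem S' A h) (S'.cmp S), unipotent,
    star_add_right, h0, add_zero, star_special A hE hE' hE h1, map_add, sandwich_sandwich,
    sandwich_sandwich, cmp_φ, LinearMap.comp_id, LinearMap.id_comp, ψ_cmp, map_neg,
    add_neg_cancel_right]
  refine (sandwich_special A (S'.cmp S) (S.cmp S') (FSMod.Hom.id _)).trans (special_congr A ?_)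
  exact S.cmp_cmp S'

/-- A morphism of middle terms compatible with the inclusions of `X` and the projections to `Y` is
unipotent. -/
theorem eq_unipotent {h : Pre Z E.X E'.X}
    (h1 : sandwich LinearMap.id S.φ.map h = special A S'.φ)
    (h2 : sandwich S'.ψ.map LinearMap.id h = special A S.ψ) :
    h = S.unipotent S' A (sandwich S'.ρ.map S.σ.map h) := by
  have e1 : sandwich (S'.φ.map ∘ₗ S'.ρ.map) (S.φ.map ∘ₗ S.ρ.map) h =
      special A (S'.φ.comp S.ρ) := by
    have := congrArg (sandwich (X' := E.X) (Y' := E'.X) (S'.φ.comp S'.ρ).map S.ρ.map) h1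
    rw [sandwich_sandwich, sandwich_special, LinearMap.comp_id] at this
    refine this.trans (special_congr A ?_)
    change (S'.φ.map ∘ₗ S'.ρ.map) ∘ₗ S'.φ.map ∘ₗ S.ρ.map = S'.φ.map ∘ₗ S.ρ.map
    rw [LinearMap.comp_assoc, ← LinearMap.comp_assoc S.ρ.map, S'.ρφ, LinearMap.id_comp]
  have e2 : sandwich (S'.σ.map ∘ₗ S'.ψ.map) LinearMap.id h = special A (S'.σ.comp S.ψ) := by
    have : sandwich (Y' := E'.X) S'.σ.map LinearMap.id (sandwich S'.ψ.map LinearMap.id h) =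
        special A (S'.σ.comp S.ψ) := by
      rw [h2]
      exact (sandwich_special A S'.σ S.ψ (FSMod.Hom.id _)).trans (special_congr A rfl)
    rwa [sandwich_sandwich, LinearMap.comp_id] at this
  rw [unipotent, special_add A (χ := S.cmp S') (φ := S'.φ.comp S.ρ)
    (ψ := S'.σ.comp S.ψ) rfl, ← e1, ← e2, sandwich_sandwich, add_right_comm,
    ← sandwich_add_right, S.sum, ← sandwich_add_left, S'.sum, sandwich_id_id]

end Splitting

variable {X Y : TwPair.{w} k P Z} (A : UnitaryBNuAlgebra k P Z)

/-- Two special conflations are equivalent if and only if the upper right entries of their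
twisting elements differ by a boundary. -/
theorem confRel_iff (hX : IsTw A.toBAlgebra X) (hY : IsTw A.toBAlgebra Y)
    {ξ ξ' : SpecialConflation A X Y} (S : Splitting X ξ.1.E Y) (S' : Splitting X ξ'.1.E Y)
    (hf : ξ.1.f = special A S.φ) (hg : ξ.1.g = special A S.ψ)
    (hf' : ξ'.1.f = special A S'.φ) (hg' : ξ'.1.g = special A S'.ψ) :
    ConfRel A ξ ξ' ↔ ∃ η ∈ adDeg A.toGradedBimodule Y.X X.X (-1),
      bTw1 A.toBAlgebra Y X η = S'.γ - S.γ := by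
  have hE := ξ.2.1
  have hE' := ξ'.2.1
  have nX := hX.isNil
  have nY := hY.isNil
  have nE := hE.isNil
  have nE' := hE'.isNil
  have r1 : star A.toBAlgebra X X ξ'.1.E ξ'.1.f (idn A X.X) = special A S'.φ := by
    rw [hf']
    exact (star_special A nX nX nE' (special_mem A _) (FSMod.Hom.id _)).trans (sandwich_id_id _)
  have r2 : star A.toBAlgebra ξ.1.E Y Y (idn A Y.X) ξ.1.g = special A S.ψ := by
    rw [hg]
    exact (special_star A nE nY nY (special_mem A _) (FSMod.Hom.id _)).trans (sandwich_id_id _)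
  constructor
  · rintro ⟨h, ⟨hz, -⟩, h1, h2⟩
    rw [r1, hf, star_special A nX nE nE' hz.1] at h1
    rw [r2, hg', special_star A nE nE' nY hz.1] at h2
    refine ⟨sandwich S'.ρ.map S.σ.map h, sandwich_mem S'.ρ S.σ hz.1, ?_⟩
    have hh := S.eq_unipotent S' A h1 h2
    have h3 := S.bTw1_unipotent S' A nX hE hE' nY (sandwich S'.ρ.map S.σ.map h)
    rw [← hh, LinearMap.mem_ker.mp hz.2] at h3
    have h4 := congrArg (sandwich (X' := Y.X) (Y' := X.X) S'.ρ.map S.σ.map) h3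
    rw [map_zero, sandwich_sandwich, S'.ρφ, S.ψσ, sandwich_id_id] at h4
    rw [eq_neg_of_add_eq_zero_right h4.symm, neg_sub]
  · rintro ⟨η, hη, h⟩
    have hη' := Submodule.neg_mem _ hη
    have hz : S.unipotent S' A η ∈ ZHom A.toBAlgebra ξ.1.E ξ'.1.E := by
      refine ⟨S.unipotent_mem S' A hη, LinearMap.mem_ker.mpr ?_⟩
      rw [S.bTw1_unipotent S' A nX hE hE' nY, h, sub_add_sub_cancel, sub_self, map_zero]
    have hz' : S'.unipotent S A (-η) ∈ ZHom A.toBAlgebra ξ'.1.E ξ.1.E := by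
      refine ⟨S'.unipotent_mem S A hη', LinearMap.mem_ker.mpr ?_⟩
      rw [S'.bTw1_unipotent S A nX hE' hE nY, map_neg, h, neg_sub, sub_add_sub_cancel, sub_self,
        map_zero]
    refine ⟨_, ⟨hz, _, hz', S.unipotent_star_unipotent S' A nX nE nE' hη, ?_⟩, ?_, ?_⟩
    · have := S'.unipotent_star_unipotent S A nX nE' nE hη'
      rwa [neg_neg] at this
    · rw [r1, hf, star_special A nX nE nE' hz.1, Splitting.unipotent, map_add, sandwich_sandwich,
        S.ψφ, sandwich_zero_right, add_zero]
      refine (sandwich_special A (FSMod.Hom.id _) (S.cmp S') S.φ).trans (special_congr A ?_)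
      exact S.cmp_φ S'
    · rw [r2, hg', special_star A nE nE' nY hz.1, Splitting.unipotent, map_add, sandwich_sandwich,
        S'.ψφ, sandwich_zero_left, add_zero]
      refine (sandwich_special A S'.ψ (S.cmp S') (FSMod.Hom.id _)).trans (special_congr A ?_)
      exact S.ψ_cmp S'

end Splitting

/-! ### Splittings of special conflations -/

section Existence

variable {k : Type uk} [Field k] {P : Type uP} {Z : Type uZ} [AddCommGroup Z] [Module k Z]

theorem FSMod.sum_e (X : FSMod.{w} k P) (x : X) :
    ∑ u ∈ X.finite_support.toFinset, X.e u x = x := by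
  conv_rhs => rw [← X.unitary.sum x]
  refine (finsum_eq_sum_of_support_subset _ fun u hu => ?_).symm
  rw [Set.Finite.coe_toFinset]
  exact fun h => hu (by simp [h])

/-- The block diagonal part `∑_u e_u s e_u` of a linear map, as a morphism of right modules. -/
def FSMod.diagPart {X Y : FSMod.{w} k P} (s : X →ₗ[k] Y) : FSMod.Hom X Y where
  map := ∑ u ∈ X.finite_support.toFinset, Y.e u ∘ₗ s ∘ₗ X.e u
  map_e v x := by
    have h0 : v ∉ X.finite_support.toFinset → X.e v = 0 := fun h => by
      rw [Set.Finite.mem_toFinset] at h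
      exact not_not.mp h
    simp only [LinearMap.sum_apply, LinearMap.comp_apply, map_sum]
    rw [Finset.sum_eq_single v, Finset.sum_eq_single v, X.unitary.idem, Y.unitary.idem]
    · exact fun u _ hu => Y.unitary.orth _ _ hu.symm _
    · exact fun h => by rw [h0 h]; simp
    · exact fun u _ hu => by rw [X.unitary.orth _ _ hu]; simp
    · exact fun h => by rw [h0 h]; simp

theorem FSMod.diagPart_apply {X Y : FSMod.{w} k P} (s : X →ₗ[k] Y) (x : X) :
    (diagPart s).map x = ∑ u ∈ X.finite_support.toFinset, Y.e u (s (X.e u x)) := by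
  simp [diagPart]

/-- Componentwise exact sequences of right modules split. -/
theorem FSMod.exists_splitting {X E Y : FSMod.{w} k P} (φ : FSMod.Hom X E) (ψ : FSMod.Hom E Y)
    (h : ∀ u, Function.Injective (φ.res u) ∧ Function.Exact (φ.res u) (ψ.res u) ∧
      Function.Surjective (ψ.res u)) :
    ∃ (ρ : FSMod.Hom E X) (σ : FSMod.Hom Y E), ρ.map ∘ₗ φ.map = LinearMap.id ∧
      ψ.map ∘ₗ σ.map = LinearMap.id ∧ ψ.map ∘ₗ φ.map = 0 ∧ ρ.map ∘ₗ σ.map = 0 ∧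
      φ.map ∘ₗ ρ.map + σ.map ∘ₗ ψ.map = LinearMap.id := by
  have hinj : Function.Injective φ.map := by
    refine (injective_iff_map_eq_zero φ.map).mpr fun x hx => ?_
    refine (Submodule.mem_bot k).mp (X.unitary.mem_of_forall ⊥ fun u => ?_)
    have h1 : φ.res u ⟨X.e u x, x, rfl⟩ = 0 :=
      Subtype.ext ((φ.map_e u x).trans (by rw [hx, map_zero]; rfl))
    have h2 := (h u).1 (h1.trans (map_zero _).symm)
    exact congrArg Subtype.val h2
  have hψφ : ψ.map ∘ₗ φ.map = 0 := by
    refine LinearMap.ext fun x => ?_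
    refine X.unitary.mem_of_forall (LinearMap.ker (ψ.map ∘ₗ φ.map)) fun u => ?_
    exact congrArg Subtype.val ((h u).2.1.apply_apply_eq_zero ⟨X.e u x, x, rfl⟩)
  have hsurj : Function.Surjective ψ.map := fun y => by
    refine Y.unitary.mem_of_forall (LinearMap.range ψ.map) fun u => ?_
    obtain ⟨e, he⟩ := (h u).2.2 ⟨Y.e u y, y, rfl⟩
    exact ⟨e, congrArg Subtype.val he⟩
  have hker : ∀ e, ψ.map e = 0 → e ∈ LinearMap.range φ.map := fun e he => by
    refine E.unitary.mem_of_forall _ fun u => ?_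
    have h1 : ψ.res u ⟨E.e u e, e, rfl⟩ = 0 :=
      Subtype.ext ((ψ.map_e u e).trans (by rw [he, map_zero]; rfl))
    obtain ⟨x, hx⟩ := ((h u).2.1 _).mp h1
    exact ⟨x, congrArg Subtype.val hx⟩
  obtain ⟨s, hs⟩ := LinearMap.exists_rightInverse_of_surjective ψ.map
    (LinearMap.range_eq_top.mpr hsurj)
  have hψσ : ψ.map ∘ₗ (diagPart s).map = LinearMap.id := by
    refine LinearMap.ext fun y => ?_
    rw [LinearMap.comp_apply, diagPart_apply, map_sum]
    conv_rhs => rw [LinearMap.id_apply, ← Y.sum_e y]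
    refine Finset.sum_congr rfl fun u _ => ?_
    have := LinearMap.congr_fun hs (Y.e u y)
    rw [LinearMap.comp_apply, LinearMap.id_apply] at this
    rw [ψ.map_e, this, Y.unitary.idem]
  generalize diagPart s = σ at hψσ
  have hr : ∀ e, (LinearMap.id - σ.map ∘ₗ ψ.map : E →ₗ[k] E) e ∈ LinearMap.range φ.map := fun e => by
    refine hker _ ?_
    have := LinearMap.congr_fun hψσ (ψ.map e)
    rw [LinearMap.comp_apply, LinearMap.id_apply] at this
    rw [LinearMap.sub_apply, map_sub, LinearMap.id_apply, LinearMap.comp_apply, this, sub_self]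
  have hρ : ∀ e, φ.map ((LinearEquiv.ofInjective φ.map hinj).symm ⟨_, hr e⟩) =
      e - σ.map (ψ.map e) := fun e =>
    congrArg Subtype.val ((LinearEquiv.ofInjective φ.map hinj).apply_symm_apply ⟨_, hr e⟩)
  refine ⟨⟨(LinearEquiv.ofInjective φ.map hinj).symm.toLinearMap ∘ₗ
    LinearMap.codRestrict _ _ hr, fun u e => hinj ?_⟩, σ, ?_, hψσ, hψφ, ?_, ?_⟩
  · refine (hρ _).trans ?_
    rw [φ.map_e, ψ.map_e, σ.map_e, ← map_sub]
    exact congrArg _ (hρ e).symm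
  · refine LinearMap.ext fun x => hinj ((hρ _).trans ?_)
    have := LinearMap.congr_fun hψφ x
    rw [LinearMap.comp_apply, LinearMap.zero_apply] at this
    rw [this, map_zero, sub_zero]
    rfl
  · refine LinearMap.ext fun y => hinj ((hρ _).trans ?_)
    have := LinearMap.congr_fun hψσ y
    rw [LinearMap.comp_apply, LinearMap.id_apply] at this
    rw [this, sub_self, LinearMap.zero_apply, map_zero]
  · refine LinearMap.ext fun e => ?_
    refine (congrArg (· + σ.map (ψ.map e)) (hρ e)).trans ?_
    exact sub_add_cancel _ _

/-- A special conflation splits as a sequence of modules, and its maps commute with the twisting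
elements because they are cycles. -/
theorem IsSpecialConflation.exists_splitting {A : UnitaryBNuAlgebra k P Z}
    {X Y : TwPair.{w} k P Z} (hX : IsTw A.toBAlgebra X) (hY : IsTw A.toBAlgebra Y)
    {ξ : ConfData X Y} (h : IsSpecialConflation A ξ) :
    ∃ S : Splitting X ξ.E Y, ξ.f = special A S.φ ∧ ξ.g = special A S.ψ := by
  obtain ⟨hE, hf, hg, φ, ψ, hf', hg', hex⟩ := h
  obtain ⟨ρ, σ, h1, h2, h3, h4, h5⟩ := FSMod.exists_splitting φ ψ hex
  have h6 := bTw1_special A hX.isNil hE.isNil hX.1 hE.1 φ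
  have h7 := bTw1_special A hE.isNil hY.isNil hE.1 hY.1 ψ
  rw [← hf', LinearMap.mem_ker.mp hf.2] at h6
  rw [← hg', LinearMap.mem_ker.mp hg.2] at h7
  exact ⟨⟨φ, ψ, ρ, σ, h1, h2, h3, h4, h5, (sub_eq_zero.mp h6.symm).symm,
    sub_eq_zero.mp h7.symm⟩, hf', hg'⟩

/-- By `confRel_iff` the relation is congruence of the entries `γ` modulo boundaries, hence an
equivalence; transitivity is not clear from the definition as `⋆` is not associative. -/
theorem confRel_equivalence {A : UnitaryBNuAlgebra k P Z} {X Y : TwPair.{w} k P Z}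
    (hX : IsTw A.toBAlgebra X) (hY : IsTw A.toBAlgebra Y) :
    Equivalence (ConfRel A (X := X) (Y := Y)) := by
  have hex : ∀ ξ : SpecialConflation A X Y, ∃ S : Splitting X ξ.1.E Y,
      ξ.1.f = special A S.φ ∧ ξ.1.g = special A S.ψ := fun ξ => ξ.2.exists_splitting hX hY
  choose S hf hg using hex
  have hiff := fun ξ ξ' : SpecialConflation A X Y =>
    confRel_iff A hX hY (S ξ) (S ξ') (hf ξ) (hg ξ) (hf ξ') (hg ξ')
  refine ⟨fun ξ => ?_, fun {ξ ξ'} h => ?_, fun {ξ ξ' ξ''} h h' => ?_⟩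
  · exact (hiff ξ ξ).mpr ⟨0, Submodule.zero_mem _, by rw [map_zero, sub_self]⟩
  · obtain ⟨η, hη, h⟩ := (hiff ξ ξ').mp h
    exact (hiff ξ' ξ).mpr ⟨-η, Submodule.neg_mem _ hη, by rw [map_neg, h, neg_sub]⟩
  · obtain ⟨η, hη, h⟩ := (hiff ξ ξ').mp h
    obtain ⟨η', hη', h'⟩ := (hiff ξ' ξ'').mp h'
    exact (hiff ξ ξ'').mpr ⟨η' + η, Submodule.add_mem _ hη' hη, by
      rw [map_add, h, h', sub_add_sub_cancel]⟩

end Existence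

/-! ### Direct sums with an upper triangular twisting element -/

section TwistedSum

variable {k : Type uk} [Field k] {P : Type uP} {Z : Type uZ} [AddCommGroup Z] [Module k Z]

/-- The projection onto the first summand. -/
def FSMod.fst (X Y : FSMod.{w} k P) : FSMod.Hom (X.prod Y) X where
  map := LinearMap.fst k X Y
  map_e _ _ := rfl

/-- The inclusion of the second summand. -/
def FSMod.inr (X Y : FSMod.{w} k P) : FSMod.Hom Y (X.prod Y) where
  map := LinearMap.inr k X Y
  map_e u _ := Prod.ext (map_zero (X.e u)).symm rfl

theorem FSMod.fst_inl (X Y : FSMod.{w} k P) :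
    (X.fst Y).map ∘ₗ (X.inl Y).map = LinearMap.id := rfl

theorem FSMod.snd_inr (X Y : FSMod.{w} k P) :
    (X.snd Y).map ∘ₗ (X.inr Y).map = LinearMap.id := rfl

theorem FSMod.snd_inl (X Y : FSMod.{w} k P) :
    (X.snd Y).map ∘ₗ (X.inl Y).map = 0 := rfl

theorem FSMod.fst_inr (X Y : FSMod.{w} k P) :
    (X.fst Y).map ∘ₗ (X.inr Y).map = 0 := rfl

/-- The matrix with rows `(a, b)` and `(0, c)`. -/
def upperTriangular {X Y : FSMod.{w} k P} (a : Pre Z X X) (b : Pre Z Y X) (c : Pre Z Y Y) :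
    Pre Z (X.prod Y) (X.prod Y) :=
  sandwich (X.inl Y).map (X.fst Y).map a + sandwich (X.inl Y).map (X.snd Y).map b +
    sandwich (X.inr Y).map (X.snd Y).map c

section UpperTriangular

variable {X Y : FSMod.{w} k P} (a : Pre Z X X) (b : Pre Z Y X) (c : Pre Z Y Y)

theorem upperTriangular_inl : sandwich LinearMap.id (X.inl Y).map (upperTriangular a b c) =
    sandwich (X.inl Y).map LinearMap.id a := by
  simp only [upperTriangular, map_add, sandwich_sandwich, FSMod.fst_inl, FSMod.snd_inl,
    sandwich_zero_right, add_zero, LinearMap.id_comp]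

theorem snd_upperTriangular : sandwich (X.snd Y).map LinearMap.id (upperTriangular a b c) =
    sandwich LinearMap.id (X.snd Y).map c := by
  simp only [upperTriangular, map_add, sandwich_sandwich, FSMod.snd_inr, FSMod.snd_inl,
    sandwich_zero_left, zero_add, LinearMap.comp_id]

theorem fst_upperTriangular_inr :
    sandwich (X.fst Y).map (X.inr Y).map (upperTriangular a b c) = b := by
  simp only [upperTriangular, map_add, sandwich_sandwich, FSMod.fst_inl, FSMod.fst_inr,
    FSMod.snd_inr, sandwich_zero_left, sandwich_zero_right, zero_add, add_zero, sandwich_id_id]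

end UpperTriangular

variable (X Y : TwPair.{w} k P Z) (γ : Pre Z Y.X X.X)

/-- The canonical splitting of `X ⊕ Y`. -/
def sumSplitting : Splitting X (twistedSum X Y γ) Y where
  φ := X.X.inl Y.X
  ψ := X.X.snd Y.X
  ρ := X.X.fst Y.X
  σ := X.X.inr Y.X
  ρφ := rfl
  ψσ := rfl
  ψφ := rfl
  ρσ := rfl
  sum := LinearMap.ext fun x => Prod.ext (add_zero x.1) (zero_add x.2)
  δφ := upperTriangular_inl X.δ γ Y.δ
  ψδ := snd_upperTriangular X.δ γ Y.δ

theorem sumSplitting_γ : (sumSplitting X Y γ).γ = γ :=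
  fst_upperTriangular_inr X.δ γ Y.δ

/-- Composition with linear maps, for elements with coefficients in a subspace. -/
theorem sandwich_mem_range {X Y X' Y' : FSMod.{w} k P} {N : Submodule k (X →ₗ[k] Y)}
    {N' : Submodule k (X' →ₗ[k] Y')} (g : Y →ₗ[k] Y') (h : X' →ₗ[k] X)
    (hN : ∀ f ∈ N, g ∘ₗ f ∘ₗ h ∈ N') {t : Pre Z X Y}
    (ht : t ∈ LinearMap.range (LinearMap.rTensor Z N.subtype)) :
    sandwich g h t ∈ LinearMap.range (LinearMap.rTensor Z N'.subtype) := by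
  obtain ⟨s, rfl⟩ := ht
  induction s with
  | zero => rw [map_zero, map_zero]; exact Submodule.zero_mem _
  | add a b ha hb => rw [map_add, map_add]; exact Submodule.add_mem _ ha hb
  | tmul f a => exact ⟨⟨_, hN f.1 f.2⟩ ⊗ₜ a, rfl⟩

variable {X Y γ}

/-- A cycle `γ` of degree zero makes `X ⊕ Y` a twisted module. -/
theorem isTw_twistedSum {A : BAlgebra k P Z} (hX : IsTw A X) (hY : IsTw A Y)
    (hγ : γ ∈ adDeg A.toGradedBimodule Y.X X.X 0) (h : bTw1 A Y X γ = 0) :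
    IsTw A (twistedSum X Y γ) := by
  have hd : (twistedSum X Y γ).δ ∈
      adDeg A.toGradedBimodule (twistedSum X Y γ).X (twistedSum X Y γ).X 0 :=
    Submodule.add_mem _ (Submodule.add_mem _
      (sandwich_mem (X.X.inl Y.X) (X.X.fst Y.X) hX.1)
      (sandwich_mem (X.X.inl Y.X) (X.X.snd Y.X) hγ))
      (sandwich_mem (X.X.inr Y.X) (X.X.snd Y.X) hY.1)
  obtain ⟨m, F, F0, Fm, Fmono, Fe, hF⟩ := hX.2.1
  obtain ⟨n, G, G0, Gn, Gmono, Ge, hG⟩ := hY.2.1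
  have Ftop : ∀ r, m ≤ r → F r = ⊤ := fun r hr => top_le_iff.mp (Fm ▸ Fmono hr)
  -- first the filtration of `X`, then that of `Y`; truncated subtraction gives `G 0 = ⊥` at first
  have hfil : ∃ (n : ℕ) (F : ℕ → Submodule k (twistedSum X Y γ).X), F 0 = ⊥ ∧ F n = ⊤ ∧
      Monotone F ∧ (∀ r u, ∀ x ∈ F r, (twistedSum X Y γ).X.e u x ∈ F r) ∧
      (twistedSum X Y γ).δ ∈ LinearMap.range (LinearMap.rTensor Z (lowering F n).subtype) := by
    refine ⟨m + n, fun r => (F r).prod (G (r - m)), ?_, ?_, ?_, ?_, ?_⟩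
    · simp only [F0, Nat.zero_sub, G0]
      exact Submodule.prod_bot
    · simp only [Ftop _ (Nat.le_add_right m n), Nat.add_sub_cancel_left, Gn]
      exact Submodule.prod_top
    · exact fun r s hrs => Submodule.prod_mono (Fmono hrs) (Gmono (Nat.sub_le_sub_right hrs m))
    · exact fun r u x hx => ⟨Fe r u x.1 hx.1, Ge _ u x.2 hx.2⟩
    · refine Submodule.add_mem _ (Submodule.add_mem _ ?_ ?_) ?_
      · refine sandwich_mem_range (N := lowering F m) (X.X.inl Y.X).map (X.X.fst Y.X).map ?_ hF
        intro f hf r hr x hx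
        refine ⟨?_, Submodule.zero_mem _⟩
        change f x.1 ∈ F r
        by_cases hrm : r < m
        · exact hf r hrm x.1 hx.1
        · rw [Ftop r (not_lt.mp hrm)]; trivial
      · refine sandwich_mem_range (N := ⊤) (X.X.inl Y.X).map (X.X.snd Y.X).map ?_ ?_
        · intro f _ r hr x hx
          refine ⟨?_, Submodule.zero_mem _⟩
          change f x.2 ∈ F r
          by_cases hrm : r < m
          · have h1 : x.2 ∈ G (r + 1 - m) := hx.2
            rw [Nat.sub_eq_zero_of_le hrm, G0, Submodule.mem_bot] at h1
            rw [h1, map_zero]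
            exact Submodule.zero_mem _
          · rw [Ftop r (not_lt.mp hrm)]; trivial
        · clear hγ h hd
          induction γ using TensorProduct.induction_on with
          | zero => exact Submodule.zero_mem _
          | add a b ha hb => exact Submodule.add_mem _ ha hb
          | tmul f a => exact ⟨⟨f, trivial⟩ ⊗ₜ a, rfl⟩
      · refine sandwich_mem_range (N := lowering G n) (X.X.inr Y.X).map (X.X.snd Y.X).map ?_ hG
        intro f hf r hr x hx
        refine ⟨Submodule.zero_mem _, ?_⟩
        change f x.2 ∈ G (r - m)
        have h1 : x.2 ∈ G (r + 1 - m) := hx.2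
        by_cases hrm : r < m
        · rw [Nat.sub_eq_zero_of_le hrm, G0, Submodule.mem_bot] at h1
          rw [h1, map_zero]
          exact Submodule.zero_mem _
        · rw [Nat.sub_add_comm (not_lt.mp hrm)] at h1
          exact hf (r - m) (by omega) x.2 h1
  refine ⟨hd, hfil, ?_⟩
  obtain ⟨l, H, H0, Hl, -, -, hH⟩ := hfil
  rw [(sumSplitting X Y γ).bAd_geom A hX.isNil (isNil_of_mem_range_lowering H0 Hl hH) hY.isNil,
    sumSplitting_γ, hX.2.2, hY.2.2, h, map_zero, map_zero, map_zero, add_zero, add_zero]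

/-- The pair `X → X ⊕ Y → Y` with upper right entry `γ`; the conflation `ξ_h` is the case
`γ = -τ_X ∘ h`. -/
def sumConf (A : UnitaryBNuAlgebra k P Z) (X Y : TwPair.{w} k P Z) (γ : Pre Z Y.X X.X) :
    ConfData X Y :=
  ⟨twistedSum X Y γ, special A (X.X.inl Y.X), special A (X.X.snd Y.X)⟩

theorem isSpecialConflation_sumConf {A : UnitaryBNuAlgebra k P Z}
    (hX : IsTw A.toBAlgebra X) (hY : IsTw A.toBAlgebra Y)
    (hγ : γ ∈ adDeg A.toGradedBimodule Y.X X.X 0) (h : bTw1 A.toBAlgebra Y X γ = 0) :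
    IsSpecialConflation A (sumConf A X Y γ) := by
  have hE := isTw_twistedSum hX hY hγ h
  refine ⟨hE, ⟨special_mem A _, LinearMap.mem_ker.mpr ?_⟩,
    ⟨special_mem A _, LinearMap.mem_ker.mpr ?_⟩, X.X.inl Y.X, X.X.snd Y.X, rfl, rfl, fun u => ?_⟩
  · refine (bTw1_special A hX.isNil hE.isNil hX.1 hE.1 _).trans (sub_eq_zero.mpr ?_)
    exact (sumSplitting X Y γ).δφ.symm
  · refine (bTw1_special A hE.isNil hY.isNil hE.1 hY.1 _).trans (sub_eq_zero.mpr ?_)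
    exact (sumSplitting X Y γ).ψδ
  · refine ⟨fun x y hxy => ?_, fun e => ⟨fun he => ?_, ?_⟩, fun y => ?_⟩
    · exact Subtype.ext (congrArg (fun z : (X.X.prod Y.X).comp u => z.1.1) hxy)
    · obtain ⟨e, z, rfl⟩ := e
      have h2 : Y.X.e u z.2 = 0 := congrArg Subtype.val he
      exact ⟨⟨X.X.e u z.1, z.1, rfl⟩, Subtype.ext (Prod.ext rfl h2.symm)⟩
    · rintro ⟨x, rfl⟩
      rfl
    · obtain ⟨y, z, rfl⟩ := y
      exact ⟨⟨(X.X.prod Y.X).e u (0, z), (0, z), rfl⟩, rfl⟩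

/-- The criterion for equivalence when the first conflation is an explicit direct sum. -/
theorem confRel_sumConf_iff {A : UnitaryBNuAlgebra k P Z} (hX : IsTw A.toBAlgebra X)
    (hY : IsTw A.toBAlgebra Y) {ξ ξ' : SpecialConflation A X Y} (e : ξ.1 = sumConf A X Y γ)
    (S' : Splitting X ξ'.1.E Y) (hf' : ξ'.1.f = special A S'.φ) (hg' : ξ'.1.g = special A S'.ψ) :
    ConfRel A ξ ξ' ↔ ∃ η ∈ adDeg A.toGradedBimodule Y.X X.X (-1),
      bTw1 A.toBAlgebra Y X η = S'.γ - γ := by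
  obtain ⟨ξ, hξ⟩ := ξ
  obtain rfl : ξ = _ := e
  refine (confRel_iff A hX hY (ξ := ⟨sumConf A X Y γ, hξ⟩) (sumSplitting X Y γ) S' rfl rfl hf'
    hg').trans ?_
  change (∃ η ∈ _, _ = S'.γ - (sumSplitting X Y γ).γ) ↔ _
  rw [sumSplitting_γ]

/-- Two explicit direct sums are equivalent if and only if their entries differ by a boundary. -/
theorem confRel_sumConf_sumConf_iff {A : UnitaryBNuAlgebra k P Z} (hX : IsTw A.toBAlgebra X)
    (hY : IsTw A.toBAlgebra Y) {γ' : Pre Z Y.X X.X} {ξ ξ' : SpecialConflation A X Y}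
    (e : ξ.1 = sumConf A X Y γ) (e' : ξ'.1 = sumConf A X Y γ') :
    ConfRel A ξ ξ' ↔ ∃ η ∈ adDeg A.toGradedBimodule Y.X X.X (-1),
      bTw1 A.toBAlgebra Y X η = γ' - γ := by
  obtain ⟨ξ', hξ'⟩ := ξ'
  obtain rfl : ξ' = _ := e'
  refine (confRel_sumConf_iff hX hY (ξ' := ⟨sumConf A X Y γ', hξ'⟩) e (sumSplitting X Y γ') rfl
    rfl).trans ?_
  change (∃ η ∈ _, _ = (sumSplitting X Y γ').γ - _) ↔ _
  rw [sumSplitting_γ]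

end TwistedSum

/-! ### Composition with `τ_X` -/

section Tau

variable {k : Type uk} [Field k] {P : Type uP} {Z : Type uZ} [AddCommGroup Z] [Module k Z]
  (A : UnitaryBNuAlgebra k P Z)

/-- Left multiplication by `τ(𝔢_w)` is `theta`. The pair `(𝔢_w ν⁻¹, a)` is the translate of
`(𝔢_w, ν⁻¹ a)` by `ν⁻¹` on the right of the first and `ν` on the left of the second entry. -/
theorem b_tauUnit {v u : P} {a : Z} {d : ℤ} (ha : A.Directed v u a) (hd : a ∈ A.gr d) :
    A.b 2 ![tauUnit A (A.ν⁻¹ v), a] = A.theta a := by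
  set w := A.ν⁻¹ v with hw
  have hdir : A.Directed w w (A.unit w) := by
    have := A.directed_lact_ract w w (A.unit w)
    rwa [A.unit_directed] at this
  have ha' : A.Directed w u (A.tr 1 0 a) := (A.semilinear_tr 1 0).directed ha
  have hd' := (A.semilinear_tr 1 0).gr d a hd
  have key := A.b_tr ![0, -1, 0] ![w, w, u] ![-1, d + (1 - 0)] ![A.unit w, A.tr 1 0 a]
    (fun i => by fin_cases i; exacts [hdir, ha']) (fun i => by
      fin_cases i; exacts [A.unit_gr w, hd'])
  have e1 : (fun i : Fin 2 => A.tr ((![0, -1, 0] : Fin 3 → ℤ) i.castSucc)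
      ((![0, -1, 0] : Fin 3 → ℤ) i.succ) ((![A.unit w, A.tr 1 0 a] : Fin 2 → Z) i)) =
      ![A.tr 0 (-1) (A.unit w), a] := by
    funext i
    fin_cases i
    · rfl
    · exact A.tr_tr (-1) 0 1 0 a
  have e2 : A.b 2 ![A.unit w, A.tr 1 0 a] = A.tr 1 0 a := by
    rw [A.unit_left w _ _ hd', ha'.1]
  rw [e1, e2] at key
  have e3 : A.b 2 ![tauUnit A w, a] =
      (A.level w).negOnePow • A.b 2 ![A.tr 0 (-1) (A.unit w), a] := by
    have := (A.b 2).map_update_smul ![A.tr 0 (-1) (A.unit w), a] 0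
      (((A.level w).negOnePow : ℤ) : k) (A.tr 0 (-1) (A.unit w))
    rw [Int.cast_smul_eq_zsmul, Int.cast_smul_eq_zsmul] at this
    have hupd : ∀ z, Function.update ![A.tr 0 (-1) (A.unit w), a] 0 z = ![z, a] := fun z => by
      funext i
      fin_cases i <;> rfl
    rw [hupd, hupd] at this
    exact this
  rw [e3, key, A.theta_apply ha.2, smul_smul, ← Int.negOnePow_add]
  refine congrArg₂ (fun (e : ℤˣ) (z : Z) => e • z) ((Int.negOnePow_eq_iff _ _).mpr ?_) rfl
  simp [Fin.sum_univ_two]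

/-- Composition with `τ_X` is the linear map `Theta`. -/
theorem circ_tau {X Y : FSMod.{w} k P} {h : Pre Z Y (X.shift A.ν)} {d : ℤ}
    (hh : h ∈ adDeg A.toGradedBimodule Y (X.shift A.ν) d) :
    circ A.toBAlgebra (tau A X) h = Theta A.toBNuAlgebra Y X h := by
  rw [circ_eq]
  induction hh using Submodule.span_induction with
  | zero => simp
  | add x y _ _ hx hy => simp only [map_add, hx, hy]
  | smul r x _ hx => simp only [map_smul, hx]
  | mem t ht =>
    obtain ⟨u, v, f, a, hf, ha, hd, rfl⟩ := ht
    have hfin : (Function.support fun w => (X.e w ∘ₗ (X.phi A.ν).symm.toLinearMap) ⊗ₜ[k]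
        tauUnit A w).Finite := by
      refine X.finite_support.subset fun u hu h => hu ?_
      change (X.e u ∘ₗ _) ⊗ₜ[k] _ = 0
      rw [h, LinearMap.zero_comp, TensorProduct.zero_tmul]
    have key : ∀ w, (circₗ A.toBAlgebra Y (X.shift A.ν) X).flip (f ⊗ₜ a)
        ((X.e w ∘ₗ (X.phi A.ν).symm.toLinearMap) ⊗ₜ tauUnit A w) =
        ((X.e w ∘ₗ (X.phi A.ν).symm.toLinearMap) ∘ₗ f) ⊗ₜ[k] A.b 2 ![tauUnit A w, a] :=
      fun w => by rw [LinearMap.flip_apply, ← circ_eq, circ_tmul]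
    have hf' : X.e (A.ν⁻¹ v) ∘ₗ (X.phi A.ν).symm.toLinearMap ∘ₗ f =
        (X.phi A.ν).symm.toLinearMap ∘ₗ f := (FSMod.corner hf).1
    rw [← LinearMap.flip_apply]
    refine (((circₗ A.toBAlgebra Y (X.shift A.ν) X).flip (f ⊗ₜ a)).toAddMonoidHom.map_finsum
      hfin).trans ?_
    refine (finsum_eq_single _ (A.ν⁻¹ v) fun w hw => (key w).trans ?_).trans
      ((key _).trans ?_)
    · rw [LinearMap.comp_assoc, ← hf', ← LinearMap.comp_assoc]
      have : X.e w ∘ₗ X.e (A.ν⁻¹ v) = 0 := LinearMap.ext (X.unitary.orth _ _ hw)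
      rw [this, LinearMap.zero_comp, TensorProduct.zero_tmul]
    · rw [LinearMap.comp_assoc, hf', b_tauUnit A ha hd, Theta_tmul]

end Tau

/-! ### The bijection -/

section Bijection

variable {k : Type uk} [Field k] {P : Type uP} {Z : Type uZ} [AddCommGroup Z] [Module k Z]
  {A : UnitaryBNuAlgebra k P Z} {X Y : TwPair.{w} k P Z}

/-- An isomorphism of degree one from the morphisms `Y → X'` to the morphisms `Y → X` which
anticommutes with the differentials. The degree of the image is a separate variable, so that
numerals can be used for both degrees. -/
structure DegreeShift (A : BAlgebra k P Z) (Y X' X : TwPair.{w} k P Z) where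
  equiv : Pre Z Y.X X'.X ≃ₗ[k] Pre Z Y.X X.X
  mem : ∀ {h} (d e : ℤ), e = d + 1 → h ∈ adDeg A.toGradedBimodule Y.X X'.X d →
    equiv h ∈ adDeg A.toGradedBimodule Y.X X.X e
  symm_mem : ∀ {γ} (d e : ℤ), e = d - 1 → γ ∈ adDeg A.toGradedBimodule Y.X X.X d →
    equiv.symm γ ∈ adDeg A.toGradedBimodule Y.X X'.X e
  bTw1_equiv : ∀ h, bTw1 A Y X (equiv h) = -equiv (bTw1 A Y X' h)

namespace DegreeShift

variable {A : BAlgebra k P Z} {X' : TwPair.{w} k P Z} (T : DegreeShift A Y X' X)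

theorem bTw1_symm (γ : Pre Z Y.X X.X) :
    bTw1 A Y X' (T.equiv.symm γ) = -T.equiv.symm (bTw1 A Y X γ) := by
  have := T.bTw1_equiv (T.equiv.symm γ)
  rw [LinearEquiv.apply_symm_apply] at this
  rw [this, map_neg, neg_neg, LinearEquiv.symm_apply_apply]

theorem neg_equiv_mem {h : Pre Z Y.X X'.X} (hh : h ∈ ZHom A Y X') :
    -T.equiv h ∈ adDeg A.toGradedBimodule Y.X X.X 0 :=
  Submodule.neg_mem _ (T.mem (-1) 0 rfl hh.1)

theorem bTw1_neg_equiv {h : Pre Z Y.X X'.X} (hh : h ∈ ZHom A Y X') :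
    bTw1 A Y X (-T.equiv h) = 0 := by
  rw [map_neg, T.bTw1_equiv, LinearMap.mem_ker.mp hh.2, map_zero, neg_zero, neg_zero]

/-- Boundaries correspond to boundaries. -/
theorem exists_boundary_iff (h h' : Pre Z Y.X X'.X) :
    (∃ η ∈ adDeg A.toGradedBimodule Y.X X.X (-1), bTw1 A Y X η = -T.equiv h' - -T.equiv h) ↔
      h - h' ∈ IHom A Y X' := by
  rw [neg_sub_neg, ← map_sub]
  constructor
  · rintro ⟨η, hη, e⟩
    refine ⟨-T.equiv.symm η, Submodule.neg_mem _ (T.symm_mem (-1) (-2) rfl hη), ?_⟩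
    rw [map_neg, T.bTw1_symm, neg_neg, e, LinearEquiv.symm_apply_apply]
  · rintro ⟨η, hη, e⟩
    refine ⟨-T.equiv η, Submodule.neg_mem _ (T.mem (-2) (-1) rfl hη), ?_⟩
    rw [map_neg, T.bTw1_equiv, neg_neg, e]

/-- Every cycle of degree zero comes from a cycle of degree `-1`. -/
theorem exists_cycle {γ : Pre Z Y.X X.X} (hγ : γ ∈ adDeg A.toGradedBimodule Y.X X.X 0)
    (h : bTw1 A Y X γ = 0) : ∃ h ∈ ZHom A Y X', -T.equiv h = γ := by
  refine ⟨-T.equiv.symm γ, ⟨Submodule.neg_mem _ (T.symm_mem 0 (-1) rfl hγ), LinearMap.mem_ker.mpr ?_⟩, ?_⟩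
  · rw [map_neg, T.bTw1_symm, h, map_zero, neg_zero, neg_zero]
  · rw [map_neg, neg_neg, LinearEquiv.apply_symm_apply]

end DegreeShift

/-- Composition with `τ_X` as an isomorphism of degree one. -/
def tauShift (hX : IsTw A.toBAlgebra X) (hY : IsTw A.toBAlgebra Y) :
    DegreeShift A.toBAlgebra Y (X.shift A.toBNuAlgebra) X where
  equiv := Theta A.toBNuAlgebra Y.X X.X
  mem _ _ e h := e ▸ Theta_mem A.toBNuAlgebra h
  symm_mem _ _ e h := e ▸ Theta_symm_mem A.toBNuAlgebra h
  bTw1_equiv := bTw1_Theta hX hY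

/-- The entry of `ξ_h` in terms of the isomorphism `tauShift`. -/
theorem xi_eq (hX : IsTw A.toBAlgebra X) (hY : IsTw A.toBAlgebra Y)
    (h : ZHom A.toBAlgebra Y (X.shift A.toBNuAlgebra)) :
    xi A X Y h.1 = sumConf A X Y (-(tauShift hX hY).equiv h.1) :=
  congrArg (fun t => sumConf A X Y (-t)) (circ_tau A h.2.1)

theorem isSpecialConflation_xi (hX : IsTw A.toBAlgebra X) (hY : IsTw A.toBAlgebra Y)
    (h : ZHom A.toBAlgebra Y (X.shift A.toBNuAlgebra)) :
    IsSpecialConflation A (xi A X Y h.1) := by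
  rw [xi_eq hX hY]
  exact isSpecialConflation_sumConf hX hY ((tauShift hX hY).neg_equiv_mem h.2)
    ((tauShift hX hY).bTw1_neg_equiv h.2)

/-- The conflations `ξ_h` and `ξ_h'` are equivalent if and only if `h` and `h'` have the same
class. -/
theorem confRel_xi_iff (hX : IsTw A.toBAlgebra X) (hY : IsTw A.toBAlgebra Y)
    (h h' : ZHom A.toBAlgebra Y (X.shift A.toBNuAlgebra)) :
    ConfRel A ⟨xi A X Y h.1, isSpecialConflation_xi hX hY h⟩
      ⟨xi A X Y h'.1, isSpecialConflation_xi hX hY h'⟩ ↔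
    h.1 - h'.1 ∈ IHom A.toBAlgebra Y (X.shift A.toBNuAlgebra) :=
  (confRel_sumConf_sumConf_iff hX hY (xi_eq hX hY h) (xi_eq hX hY h')).trans
    ((tauShift hX hY).exists_boundary_iff h.1 h'.1)

/-- Every special conflation is equivalent to some `ξ_h`. -/
theorem exists_confRel_xi (hX : IsTw A.toBAlgebra X) (hY : IsTw A.toBAlgebra Y)
    (ξ : SpecialConflation A X Y) :
    ∃ h : ZHom A.toBAlgebra Y (X.shift A.toBNuAlgebra),
      ConfRel A ⟨xi A X Y h.1, isSpecialConflation_xi hX hY h⟩ ξ := by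
  obtain ⟨S, hf, hg⟩ := ξ.2.exists_splitting hX hY
  obtain ⟨h, hh, e⟩ := (tauShift hX hY).exists_cycle (S.γ_mem ξ.2.1.1) (S.bTw1_γ hX ξ.2.1 hY)
  refine ⟨⟨h, hh⟩, (confRel_sumConf_iff hX hY (xi_eq hX hY ⟨h, hh⟩) S hf hg).mpr
    ⟨0, Submodule.zero_mem _, ?_⟩⟩
  rw [e, map_zero, sub_self]

end Bijection

end BNu

end

theorem mainTheorem6 {k : Type uk} [Field k] {P : Type uP} {Z : Type uZ} [AddCommGroup Z]
    [Module k Z] (A : BNu.UnitaryBNuAlgebra k P Z) (X Y : BNu.TwPair.{w} k P Z)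
    (hX : BNu.IsTw A.toBAlgebra X) (hY : BNu.IsTw A.toBAlgebra Y) :
    BNu.IsTw A.toBAlgebra (X.shift A.toBNuAlgebra) ∧
    Equivalence (BNu.ConfRel A (X := X) (Y := Y)) ∧
    ∃ hξ : ∀ h : BNu.ZHom A.toBAlgebra Y (X.shift A.toBNuAlgebra),
        BNu.IsSpecialConflation A (BNu.xi A X Y h.1),
      (Function.Surjective
        (fun h : BNu.ZHom A.toBAlgebra Y (X.shift A.toBNuAlgebra) =>
          (Quot.mk _ ⟨BNu.xi A X Y h.1, hξ h⟩ : BNu.Ext A X Y))) ∧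
      ∃ Ψ : BNu.HHom A.toBAlgebra Y (X.shift A.toBNuAlgebra) → BNu.Ext A X Y,
        (∀ h : BNu.ZHom A.toBAlgebra Y (X.shift A.toBNuAlgebra),
          Ψ (Quotient.mk _ h) = Quot.mk _ ⟨BNu.xi A X Y h.1, hξ h⟩) ∧
        Function.Bijective Ψ := by
  have hE := BNu.confRel_equivalence hX hY
  have hsurj : Function.Surjective
      (fun h : BNu.ZHom A.toBAlgebra Y (X.shift A.toBNuAlgebra) =>
        (Quot.mk _ ⟨BNu.xi A X Y h.1, BNu.isSpecialConflation_xi hX hY h⟩ :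
          BNu.Ext A X Y)) := by
    rintro ⟨ξ⟩
    obtain ⟨h, hh⟩ := BNu.exists_confRel_xi hX hY ξ
    exact ⟨h, Quot.sound hh⟩
  refine ⟨hX.shift, hE, BNu.isSpecialConflation_xi hX hY, hsurj,
    Quotient.lift _ fun h h' hhh' => Quot.sound ((BNu.confRel_xi_iff hX hY h h').mpr hhh'),
    fun h => rfl, ?_, ?_⟩
  · rintro ⟨h⟩ ⟨h'⟩ e
    exact Quotient.sound ((BNu.confRel_xi_iff hX hY h h').mp ((hE.quot_mk_eq_iff _ _).mp e))
  · intro c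
    obtain ⟨h, hh⟩ := hsurj c
    exact ⟨Quotient.mk _ h, hh⟩
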